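/- **Conventions.** Let $[N]=\{1,\dots,N\}$ and $\|g\|_1=\sum_{i=1}^N|g(i)|$. For a distribution $p$ on $[N]$ let $H(i)=p(i)/\sum_{j\ge i}p(j)$ be its hazard rate, defined for those $i$ with $\sum_{j\ge i}p(j)>0$; $p$ is a *monotone hazard rate (MHR)* distribution if $H$ is non-decreasing where it is defined. Let $\mathcal M_{N,k}$ be the class of $k$-mixtures of MHR distributions on $[N]$, i.e. of all $\sum_{j=1}^k w_jp_j$ with $w_j\ge 0$, $\sum_j w_j=1$ and every $p_j$ an MHR distribution on $[N]$. For a distribution $f$ on $[N]$ put $\mathrm{OPT}_{N,k}(f)=\inf_{q\in\mathcal M_{N,k}}\|q-f\|_1$. The model of computation is the real RAM with unit cost: natural numbers with addition, truncated subtraction, comparison and use as array indices; exact real numbers with $+,-,\times,/$ and comparison, without rounding. An algorithm is one fixed finite program, with input $N,k,\varepsilon$ and access to i.i.d. samples from the unknown distribution. Drawing $r$ samples costs $r$ units of time and delivers them in sorted order (the time needed for sorting the samples is not counted). The hypothesis $h:[N]\to\mathbb R$ is output as a list of pairs (right end point, value), each costing at least one unit of time: $h(i)$ is the value in the first pair of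 the list whose end point is at least $i$, and $0$ if there is none. **Theorem.** There are an algorithm and universal constants $C\ge 1$ and $A,B$ such that the following holds for all integers $N,k\ge 1$ and all $0<\varepsilon\le 1/2$. On input $N,k,\varepsilon$ and any sequence of sample values in $[N]$, the algorithm halts, draws at most $$A\cdot\frac{k\log(N/\varepsilon)}{\varepsilon^3}$$ samples, and runs in time at most $$B\cdot\frac{k\log(N/\varepsilon)}{\varepsilon^3}\,\log(1/\varepsilon).$$ For every distribution $f$ on $[N]$ (not necessarily in $\mathcal M_{N,k}$), when the samples are i.i.d. from $f$, with probability at least $9/10$ the hypothesis $h$ that it outputs satisfies $$\|h-f\|_1\le C\cdot \mathrm{OPT}_{N,k}(f)+\varepsilon .$$ -/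

import Mathlib

/-! ### Distributions on `[N]`

`[N] = {1, …, N}` is modelled by `Fin N`, the index `i : Fin N` standing for the integer `i + 1`. -/

/-- The `ℓ₁`-distance between two real functions on `[N]`. -/
noncomputable def l1Dist {N : ℕ} (g h : Fin N → ℝ) : ℝ := ∑ i, |g i - h i|

/-- The probability mass function of a distribution on `[N]`, as a real function. -/
noncomputable def massFn {N : ℕ} (p : PMF (Fin N)) : Fin N → ℝ := fun i => (p i).toReal

/-- The tail mass `∑_{j ≥ i} p(j)`. -/
noncomputable def tailMass {N : ℕ} (p : PMF (Fin N)) (i : Fin N) : ℝ :=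
  ∑ j ∈ Finset.Ici i, massFn p j

/-- The hazard rate `H(i) = p(i) / ∑_{j ≥ i} p(j)`, meaningful where the tail mass is positive. -/
noncomputable def hazardRate {N : ℕ} (p : PMF (Fin N)) (i : Fin N) : ℝ :=
  massFn p i / tailMass p i

/-- Monotone hazard rate: `H` is non-decreasing on the set where it is defined, i.e. where the tail
mass is positive (this set is an initial segment of `[N]`). -/
def IsMHR {N : ℕ} (p : PMF (Fin N)) : Prop :=
  ∀ i j : Fin N, i ≤ j → 0 < tailMass p j → hazardRate p i ≤ hazardRate p j

/-- The `k`-mixtures `∑_j w_j p_j` of members of a class `D`; `PMF.bind w p` has mass function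
`i ↦ ∑_j w_j p_j(i)`. -/
def mixtures {N : ℕ} (k : ℕ) (D : Set (PMF (Fin N))) : Set (PMF (Fin N)) :=
  {q | ∃ (w : PMF (Fin k)) (p : Fin k → PMF (Fin N)), (∀ j, p j ∈ D) ∧ q = w.bind p}

/-- `OPT_D(f) = inf_{q ∈ D} ‖q - f‖₁`. -/
noncomputable def optDist {N : ℕ} (D : Set (PMF (Fin N))) (f : PMF (Fin N)) : ℝ :=
  sInf ((fun q => l1Dist (massFn q) (massFn f)) '' D)

/-! ### A real RAM with sample access

Programs are finite texts of an imperative language over two kinds of data: natural numbers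
(counters, sample points and array indices) and exact real numbers. Both are kept in scalar
variables and in arrays of unbounded length. On natural numbers only addition, truncated
subtraction and comparison are available; on reals the four field operations and comparison (there
is no rounding from reals to natural numbers, and the only constants are natural numbers).
Every operation costs one unit of time. -/

namespace RealRAM

/-- Expressions with natural-number values. -/
inductive NExpr : Type
  | const (c : ℕ)
  | var (x : ℕ)
  | read (a : ℕ) (i : NExpr)
  | add (e₁ e₂ : NExpr)
  | sub (e₁ e₂ : NExpr)

/-- Expressions with real values. -/
inductive RExpr : Type
  | ofNat (e : NExpr)
  | var (x : ℕ)
  | read (a : ℕ) (i : NExpr)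
  | add (e₁ e₂ : RExpr)
  | sub (e₁ e₂ : RExpr)
  | mul (e₁ e₂ : RExpr)
  | div (e₁ e₂ : RExpr)

/-- Tests. -/
inductive Test : Type
  | nle (e₁ e₂ : NExpr)
  | rle (e₁ e₂ : RExpr)
  | not (b : Test)
  | and (b₁ b₂ : Test)

/-- Commands. `draw a e` draws as many fresh samples as the value of `e` and writes them, in
non-decreasing order, to the cells `0, 1, 2, …` of the array `a` of natural numbers.
`emit e v` appends the pair (value of `e`, value of `v`) to the output. -/
inductive Cmd : Type
  | skip
  | nset (x : ℕ) (e : NExpr)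
  | nwrite (a : ℕ) (i e : NExpr)
  | rset (x : ℕ) (e : RExpr)
  | rwrite (a : ℕ) (i : NExpr) (e : RExpr)
  | draw (a : ℕ) (e : NExpr)
  | emit (e : NExpr) (v : RExpr)
  | seq (c₁ c₂ : Cmd)
  | ite (b : Test) (c₁ c₂ : Cmd)
  | loop (b : Test) (c : Cmd)

/-- A machine state: the variables and arrays of both kinds, the number of samples drawn so far, and
the output produced so far. -/
structure State where
  nvar : ℕ → ℕ
  narr : ℕ → ℕ → ℕ
  rvar : ℕ → ℝ
  rarr : ℕ → ℕ → ℝ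
  drawn : ℕ
  out : List (ℕ × ℝ)

/-- The value of a natural-number expression. -/
def NExpr.eval (s : State) : NExpr → ℕ
  | const c => c
  | var x => s.nvar x
  | read a i => s.narr a (i.eval s)
  | add e₁ e₂ => e₁.eval s + e₂.eval s
  | sub e₁ e₂ => e₁.eval s - e₂.eval s

/-- The number of operations in a natural-number expression. -/
def NExpr.cost : NExpr → ℕ
  | const _ => 1
  | var _ => 1
  | read _ i => i.cost + 1
  | add e₁ e₂ => e₁.cost + e₂.cost + 1
  | sub e₁ e₂ => e₁.cost + e₂.cost + 1

/-- The value of a real expression. -/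
noncomputable def RExpr.eval (s : State) : RExpr → ℝ
  | ofNat e => (e.eval s : ℝ)
  | var x => s.rvar x
  | read a i => s.rarr a (i.eval s)
  | add e₁ e₂ => e₁.eval s + e₂.eval s
  | sub e₁ e₂ => e₁.eval s - e₂.eval s
  | mul e₁ e₂ => e₁.eval s * e₂.eval s
  | div e₁ e₂ => e₁.eval s / e₂.eval s

/-- The number of operations in a real expression. -/
def RExpr.cost : RExpr → ℕ
  | ofNat e => e.cost + 1
  | var _ => 1
  | read _ i => i.cost + 1
  | add e₁ e₂ => e₁.cost + e₂.cost + 1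
  | sub e₁ e₂ => e₁.cost + e₂.cost + 1
  | mul e₁ e₂ => e₁.cost + e₂.cost + 1
  | div e₁ e₂ => e₁.cost + e₂.cost + 1

/-- The truth value of a test. -/
def Test.eval (s : State) : Test → Prop
  | nle e₁ e₂ => e₁.eval s ≤ e₂.eval s
  | rle e₁ e₂ => e₁.eval s ≤ e₂.eval s
  | not b => ¬ b.eval s
  | and b₁ b₂ => b₁.eval s ∧ b₂.eval s

/-- The number of operations in a test. -/
def Test.cost : Test → ℕ
  | nle e₁ e₂ => e₁.cost + e₂.cost + 1
  | rle e₁ e₂ => e₁.cost + e₂.cost + 1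
  | not b => b.cost + 1
  | and b₁ b₂ => b₁.cost + b₂.cost + 1

/-- The `r` samples `ω d, …, ω (d + r - 1)` in non-decreasing order, as integers in `{1, …, N}`. -/
def sortedSamples {N : ℕ} (ω : ℕ → Fin N) (d r : ℕ) : List ℕ :=
  ((Multiset.range r).map fun j => (ω (d + j) : ℕ) + 1).sort (· ≤ ·)

/-- `Exec ω c s T s'`: on the stream of samples `ω`, the command `c` started in the state `s`
terminates in the state `s'` after exactly `T` units of time. Drawing `r` samples costs `r` units
beside the evaluation of `r`. -/
inductive Exec {N : ℕ} (ω : ℕ → Fin N) : Cmd → State → ℕ → State → Prop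
  | skip (s : State) : Exec ω .skip s 1 s
  | nset (s : State) (x : ℕ) (e : NExpr) :
      Exec ω (.nset x e) s (e.cost + 1)
        { s with nvar := Function.update s.nvar x (e.eval s) }
  | nwrite (s : State) (a : ℕ) (i e : NExpr) :
      Exec ω (.nwrite a i e) s (i.cost + e.cost + 1)
        { s with
          narr := Function.update s.narr a
            (Function.update (s.narr a) (i.eval s) (e.eval s)) }
  | rset (s : State) (x : ℕ) (e : RExpr) :
      Exec ω (.rset x e) s (e.cost + 1)
        { s with rvar := Function.update s.rvar x (e.eval s) }
  | rwrite (s : State) (a : ℕ) (i : NExpr) (e : RExpr) :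
      Exec ω (.rwrite a i e) s (i.cost + e.cost + 1)
        { s with
          rarr := Function.update s.rarr a
            (Function.update (s.rarr a) (i.eval s) (e.eval s)) }
  | draw (s : State) (a : ℕ) (e : NExpr) :
      Exec ω (.draw a e) s (e.cost + e.eval s + 1)
        { s with
          narr := Function.update s.narr a
            (fun j => (sortedSamples ω s.drawn (e.eval s)).getD j (s.narr a j))
          drawn := s.drawn + e.eval s }
  | emit (s : State) (e : NExpr) (v : RExpr) :
      Exec ω (.emit e v) s (e.cost + v.cost + 1)
        { s with out := s.out ++ [(e.eval s, v.eval s)] }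
  | seq {c₁ c₂ : Cmd} {s s' s'' : State} {T₁ T₂ : ℕ} :
      Exec ω c₁ s T₁ s' → Exec ω c₂ s' T₂ s'' → Exec ω (.seq c₁ c₂) s (T₁ + T₂) s''
  | iteTrue {b : Test} {c₁ c₂ : Cmd} {s s' : State} {T : ℕ} :
      b.eval s → Exec ω c₁ s T s' → Exec ω (.ite b c₁ c₂) s (b.cost + T + 1) s'
  | iteFalse {b : Test} {c₁ c₂ : Cmd} {s s' : State} {T : ℕ} :
      ¬ b.eval s → Exec ω c₂ s T s' → Exec ω (.ite b c₁ c₂) s (b.cost + T + 1) s'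
  | loopStep {b : Test} {c : Cmd} {s s' s'' : State} {T₁ T₂ : ℕ} :
      b.eval s → Exec ω c s T₁ s' → Exec ω (.loop b c) s' T₂ s'' →
        Exec ω (.loop b c) s (b.cost + T₁ + T₂ + 1) s''
  | loopDone {b : Test} {c : Cmd} {s : State} :
      ¬ b.eval s → Exec ω (.loop b c) s (b.cost + 1) s

/-- The initial state: the inputs `N`, `k` are in the natural-number variables `0` and `1`, the
input `ε` is in the real variable `0`, and everything else is zero or empty. -/
noncomputable def initState (N k : ℕ) (ε : ℝ) : State where
  nvar := fun x => if x = 0 then N else if x = 1 then k else 0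
  narr := fun _ _ => 0
  rvar := fun x => if x = 0 then ε else 0
  rarr := fun _ _ => 0
  drawn := 0
  out := []

/-- The hypothesis on `[N]` written out by a list of pairs (right end point, value): a point takes
the value of the first pair whose end point is at least that point, and `0` if there is none. In
particular it is a histogram with at most one piece more than there are pairs. -/
noncomputable def hypothesis (N : ℕ) (l : List (ℕ × ℝ)) : Fin N → ℝ := fun i =>
  ((l.find? fun q => decide ((i : ℕ) + 1 ≤ q.1)).map Prod.snd).getD 0

end RealRAM

/-! An MHR mass function is the product of a non-decreasing hazard rate and a non-increasing tail
mass. Rounding the logarithms of both factors to multiples of `η` gives a histogram with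
`O(log(N/η)/η)` pieces at `ℓ₁`-distance `O(η)`. A mixture inherits the break points of all `k`
components, so some histogram `g` with at most `t = O(k log(N/ε)/ε)` pieces is almost as close to
`f` as `OPT` (`exists_histogram_near_mixture`). It remains to learn a distribution near an unknown
`t`-piece histogram from `O(t/ε²)` samples.

The statistical input is `nine_tenths_le_sampleLaw_uniform_deviation`: with `O(M/δ²)` samples, the
empirical distribution and `f` differ by at most `δ` when tested against every function bounded by
`1` with at most `M` jumps. It is proved by chaining along dyadic grids on the quantile scale, with
fourth moments; no logarithmic factor is lost.

The algorithm scans the sorted samples greedily. It extends the current piece while some constant in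
`[0, 1]` reproduces the empirical cumulative distribution on it up to a tolerance `τ`, and breaks
otherwise. Each break is paid for either by a jump of `g` or by a discrepancy larger than `τ`
between `g` and the samples. Hence many breaks yield a test function with few jumps and a large
value (`exists_test_of_le_breaks`), which by uniform deviation is possible only if `τ t` is `O(δ +
‖g - f‖₁)`. The tolerance is doubled until a scan makes at most `3 t` breaks. Since `τ` times the
number of breaks never exceeds `2` (`mul_breaks_le`), this takes `O(log(1/ε))` linear scans. At the
accepted tolerance, testing against the sign of `g - h`, which has `O(t)` jumps, bounds `‖g - h‖₁`
(`sum_abs_histVal_sub_le`). -/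

namespace MHRLearning
open Finset

/-! ### Jumps of sequences -/

open scoped Classical in
/-- The indices `i < N` with `s i ≠ s (i + 1)`. -/
noncomputable def jumpSet {α : Type*} (s : ℕ → α) (N : ℕ) : Finset ℕ :=
  (range N).filter fun i => s i ≠ s (i + 1)

theorem mem_jumpSet {α : Type*} {s : ℕ → α} {N i : ℕ} :
    i ∈ jumpSet s N ↔ i < N ∧ s i ≠ s (i + 1) := by
  simp [jumpSet]

/-- The sum of a function over a level set of a monotone sequence, summed by parts. -/
theorem abs_sum_Ico_diff_mul_le (s e : ℕ → ℝ) (B : ℝ) (p q : ℕ) (hs : ∀ i, |s i| ≤ 1)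
    (he : ∀ i ∈ Ico p q, |e i| ≤ B)
    (hmono : ∀ i ∈ Ico p q, ∀ j ∈ Ico p q, i ≤ j → e i ≤ e j) (hB : 0 ≤ B) :
    |∑ i ∈ Ico p q, (s (i + 1) - s i) * e i| ≤ 4 * B := by
  rcases le_or_gt q p with h | h
  · simp [Ico_eq_empty_of_le h, hB]
  obtain ⟨r, rfl⟩ : ∃ r, q = p + r + 1 := ⟨q - p - 1, by omega⟩
  -- By Abel summation the left side is `|s p * e p + ∑ s (i + 1) * (e (i + 1) - e i)|`. As `e` is
  -- monotone and `|s| ≤ 1`, its total rise bounds the sum. With `|e| ≤ B` this is at most `3 B`,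
  -- and the boundary term adds one more `B`, however often `s` jumps.
  have key : ∀ m ≤ r, |∑ i ∈ Ico p (p + m + 1), (s (i + 1) - s i) * e i
      - s (p + m + 1) * e (p + m)| ≤ e (p + m) - e p + |e p| := by
    intro m
    induction m with
    | zero =>
      intro _
      have : (s (p + 1) - s p) * e p - s (p + 1) * e p = - (s p * e p) := by ring
      simp only [add_zero, Nat.Ico_succ_singleton, sum_singleton, sub_self, zero_add]
      rw [this, abs_neg, abs_mul]
      exact mul_le_of_le_one_left (abs_nonneg _) (hs p)
    | succ m ih =>
      intro hm
      have h1 := ih (by omega)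
      have h2 : e (p + m) ≤ e (p + m + 1) :=
        hmono _ (by simp; omega) _ (by simp; omega) (by omega)
      rw [← add_assoc, sum_Ico_succ_top (by omega : p ≤ p + m + 1)]
      have e1 : ∑ i ∈ Ico p (p + m + 1), (s (i + 1) - s i) * e i
          + (s (p + m + 1 + 1) - s (p + m + 1)) * e (p + m + 1)
          - s (p + m + 1 + 1) * e (p + m + 1)
          = (∑ i ∈ Ico p (p + m + 1), (s (i + 1) - s i) * e i - s (p + m + 1) * e (p + m))
            + s (p + m + 1) * (e (p + m) - e (p + m + 1)) := by ring
      rw [e1]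
      have h3 : |s (p + m + 1) * (e (p + m) - e (p + m + 1))| ≤ e (p + m + 1) - e (p + m) := by
        rw [abs_mul, abs_of_nonpos (sub_nonpos.2 h2), neg_sub]
        exact mul_le_of_le_one_left (by linarith) (hs _)
      have := abs_add_le (∑ i ∈ Ico p (p + m + 1), (s (i + 1) - s i) * e i
        - s (p + m + 1) * e (p + m)) (s (p + m + 1) * (e (p + m) - e (p + m + 1)))
      linarith
  have h1 := key r le_rfl
  have h2 := abs_le.1 (he (p + r) (by simp))
  have h3 := abs_le.1 (he p (by simp))
  have h4 : |e p| ≤ B := he p (by simp)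
  have h5 : |s (p + r + 1) * e (p + r)| ≤ B := by
    rw [abs_mul]
    exact (mul_le_of_le_one_left (abs_nonneg _) (hs _)).trans (he (p + r) (by simp))
  have h6 : |e (p + r)| ≤ B := he (p + r) (by simp)
  have h7 := abs_le.1 h1
  have h8 := abs_le.1 h5
  rw [abs_le]
  have hbound : e (p + r) - e p + |e p| ≤ 3 * B := by linarith
  constructor <;> linarith

theorem exists_filter_eq_Ico (κ : ℕ → ℕ) (hκ : Monotone κ) (N c : ℕ) :
    ∃ p q, (range N).filter (fun i => κ i = c) = Ico p q := by
  induction N with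
  | zero => exact ⟨0, 0, by simp⟩
  | succ N ih =>
    obtain ⟨p, q, h⟩ := ih
    rw [range_add_one, filter_insert]
    by_cases hc : κ N = c
    · rw [if_pos hc]
      by_cases hne : ((range N).filter fun i => κ i = c).Nonempty
      · obtain ⟨i, hi⟩ := hne
        refine ⟨p, N + 1, ?_⟩
        ext j
        have hi' := hi
        rw [h, mem_Ico] at hi'
        have key : ∀ j, (j < N ∧ κ j = c) ↔ (p ≤ j ∧ j < q) := by
          intro j
          have := Finset.ext_iff.1 h j
          simpa using this
        have hi0 := (key i).2 hi'
        simp only [mem_insert, mem_filter, mem_range, mem_Ico]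
        constructor
        · rintro (rfl | h1)
          · omega
          · have := (key j).1 h1
            omega
        · rintro ⟨h1, h2⟩
          rcases Nat.lt_or_ge j N with h3 | h3
          · right
            refine ⟨h3, ?_⟩
            rcases le_total j i with h4 | h4
            · exact ((key j).2 ⟨h1, by omega⟩).2
            · apply le_antisymm
              · exact hc ▸ hκ h3.le
              · exact hi0.2 ▸ hκ h4
          · left; omega
      · rw [not_nonempty_iff_eq_empty] at hne
        rw [hne]
        exact ⟨N, N + 1, by simp⟩
    · rw [if_neg hc]
      exact ⟨p, q, h⟩

/-- If `e` is monotone and bounded by `B` on the level sets of `κ`, a sum against the increments of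
`e` is controlled by the level sets in which `s` jumps. -/
theorem abs_sum_mul_incr_le (N : ℕ) (s e B : ℕ → ℝ) (κ : ℕ → ℕ) (hκ : Monotone κ)
    (hs : ∀ i, |s i| ≤ 1) (he : ∀ i ≤ N, |e i| ≤ B (κ i)) (hB : ∀ c, 0 ≤ B c)
    (hmono : ∀ i j, i ≤ j → j ≤ N → κ i = κ j → e i ≤ e j) (h0 : e 0 = 0) (hN : e N = 0) :
    |∑ i ∈ range N, s i * (e (i + 1) - e i)| ≤
      ∑ c ∈ (jumpSet s N).image (fun i => κ (i + 1)), 4 * B c := by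
  classical
  have parts : ∀ m, ∑ i ∈ range m, s i * (e (i + 1) - e i)
      = s m * e m - s 0 * e 0 - ∑ i ∈ range m, (s (i + 1) - s i) * e (i + 1) := by
    intro m
    induction m with
    | zero => simp
    | succ m ih => rw [sum_range_succ, sum_range_succ, ih]; ring
  rw [parts, h0, hN, mul_zero, mul_zero, sub_self, zero_sub, abs_neg]
  have e1 : ∑ i ∈ range N, (s (i + 1) - s i) * e (i + 1)
      = ∑ i ∈ jumpSet s N, (s (i + 1) - s i) * e (i + 1) := by
    symm
    apply sum_subset
    · intro i hi
      exact mem_range.2 (mem_jumpSet.1 hi).1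
    · intro i hi hni
      rw [mem_jumpSet, not_and, not_not] at hni
      rw [hni (mem_range.1 hi), sub_self, zero_mul]
  rw [e1, ← sum_fiberwise_of_maps_to (s := jumpSet s N) (g := fun i => κ (i + 1))
    (t := (jumpSet s N).image fun i => κ (i + 1)) (fun i hi => mem_image_of_mem _ hi)]
  refine (abs_sum_le_sum_abs _ _).trans (sum_le_sum fun c _ => ?_)
  -- Indices without a jump contribute zero, so the jumps in one level set may be replaced by the
  -- whole level set. This is an interval on which `e` is monotone, and it costs `4 * B c` once, not
  -- once per jump.
  have e2 : ∑ i ∈ jumpSet s N with κ (i + 1) = c, (s (i + 1) - s i) * e (i + 1)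
      = ∑ i ∈ range N with κ (i + 1) = c, (s (i + 1) - s i) * e (i + 1) := by
    apply sum_subset
    · intro i hi
      rw [mem_filter] at hi ⊢
      exact ⟨mem_range.2 (mem_jumpSet.1 hi.1).1, hi.2⟩
    · intro i hi hni
      rw [mem_filter] at hi hni
      rw [mem_jumpSet] at hni
      have : s i = s (i + 1) := by
        by_contra h
        exact hni ⟨⟨mem_range.1 hi.1, h⟩, hi.2⟩
      rw [this, sub_self, zero_mul]
  rw [e2]
  obtain ⟨p, q, hpq⟩ := exists_filter_eq_Ico (fun i => κ (i + 1))
    (fun i j h => hκ (Nat.succ_le_succ h)) N c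
  have hmem : ∀ i ∈ Ico p q, i < N ∧ κ (i + 1) = c := by
    intro i hi
    rw [← hpq, mem_filter, mem_range] at hi
    exact hi
  rw [hpq]
  apply abs_sum_Ico_diff_mul_le s (fun i => e (i + 1)) (B c) p q hs
  · intro i hi
    obtain ⟨h1, h2⟩ := hmem i hi
    rw [← h2]
    exact he _ h1
  · intro i hi j hj hij
    obtain ⟨h1, h2⟩ := hmem i hi
    obtain ⟨h3, h4⟩ := hmem j hj
    exact hmono _ _ (by omega) h3 (by rw [h2, h4])
  · exact hB c

theorem sum_abs_incr_comp_le (g : ℕ → ℝ) (κ : ℕ → ℕ) (hκ : Monotone κ) (N : ℕ) :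
    ∑ i ∈ range N, |g (κ (i + 1)) - g (κ i)| ≤ ∑ c ∈ Ico (κ 0) (κ N), |g (c + 1) - g c| := by
  induction N with
  | zero => simp
  | succ N ih =>
    rw [sum_range_succ, ← sum_Ico_consecutive _ (hκ (Nat.zero_le N)) (hκ (Nat.le_succ N))]
    refine add_le_add ih ?_
    rw [← sum_Ico_sub g (hκ (Nat.le_succ N))]
    exact abs_sum_le_sum_abs _ _

/-- Truncation at a threshold: above `l` the first power is dominated by the fourth, whose
expectation can be controlled. -/
theorem abs_le_add_pow_four_div (x l : ℝ) (hl : 0 < l) : |x| ≤ l + x ^ 4 / l ^ 3 := by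
  rcases le_or_gt |x| l with h | h
  · have : 0 ≤ x ^ 4 / l ^ 3 := by positivity
    linarith
  · have h1 : |x| ≤ x ^ 4 / l ^ 3 := by
      rw [le_div_iff₀ (by positivity)]
      have : l ^ 3 ≤ |x| ^ 3 := pow_le_pow_left₀ hl.le h.le 3
      calc |x| * l ^ 3 ≤ |x| * |x| ^ 3 := by gcongr
        _ = x ^ 4 := by rw [← pow_succ', Even.pow_abs (by decide)]
    linarith

/-- Sums of absolute values over at most `M` indices, by fourth powers. -/
theorem sum_abs_le_card_mul_add {ι : Type*} (T U : Finset ι) (hTU : T ⊆ U) (x : ι → ℝ) (l : ℝ)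
    (hl : 0 < l) (M : ℕ) (hT : T.card ≤ M) :
    ∑ c ∈ T, |x c| ≤ M * l + (∑ c ∈ U, x c ^ 4) / l ^ 3 := by
  calc ∑ c ∈ T, |x c| ≤ ∑ c ∈ T, (l + x c ^ 4 / l ^ 3) :=
        sum_le_sum fun c _ => abs_le_add_pow_four_div _ _ hl
    _ = T.card * l + (∑ c ∈ T, x c ^ 4) / l ^ 3 := by
        rw [sum_add_distrib, sum_const, nsmul_eq_mul, sum_div]
    _ ≤ M * l + (∑ c ∈ U, x c ^ 4) / l ^ 3 := by
        have h1 : (T.card : ℝ) ≤ M := by exact_mod_cast hT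
        have h2 : ∑ c ∈ T, x c ^ 4 ≤ ∑ c ∈ U, x c ^ 4 :=
          sum_le_sum_of_subset_of_nonneg hTU fun c _ _ => by positivity
        gcongr

end MHRLearning

namespace MHRLearning
open Finset

/-! ### Chaining along dyadic grids -/

/-- The mesh `1 / (M 2 ^ l)` of the grid at level `l`. -/
noncomputable def mesh (M l : ℕ) : ℝ := 1 / (M * 2 ^ l)

/-- The index of the grid cell of level `l` that contains `u`. -/
noncomputable def cell (M l : ℕ) (u : ℝ) : ℕ := ⌊u * (M * 2 ^ l)⌋₊

theorem mesh_pos {M : ℕ} (hM : 0 < M) (l : ℕ) : 0 < mesh M l := by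
  unfold mesh; positivity

theorem cell_mono (M l : ℕ) : Monotone (cell M l) := fun _ _ h =>
  Nat.floor_mono (mul_le_mul_of_nonneg_right h (by positivity))

/-- The grids are nested, and halving the index gives the parent cell. This makes the increments
along the levels telescope. -/
theorem cell_succ_div_two (M l : ℕ) (u : ℝ) : cell M (l + 1) u / 2 = cell M l u := by
  unfold cell
  have := Nat.floor_div_natCast (u * (M * 2 ^ (l + 1))) 2
  rw [← this]
  congr 1
  push_cast
  ring

theorem cell_zero (M l : ℕ) : cell M l 0 = 0 := by simp [cell]

theorem cell_one (M l : ℕ) : cell M l 1 = M * 2 ^ l := by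
  unfold cell
  rw [one_mul]
  exact_mod_cast Nat.floor_natCast (R := ℝ) (M * 2 ^ l)

theorem cell_mul_mesh_le {M : ℕ} (hM : 0 < M) (l : ℕ) {u : ℝ} (hu : 0 ≤ u) :
    cell M l u * mesh M l ≤ u := by
  have hp : (0 : ℝ) < M * 2 ^ l := by positivity
  unfold mesh
  rw [mul_one_div, div_le_iff₀ hp]
  exact Nat.floor_le (by positivity)

theorem le_cell_add_one_mul_mesh {M : ℕ} (hM : 0 < M) (l : ℕ) (u : ℝ) :
    u ≤ (cell M l u + 1 : ℕ) * mesh M l := by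
  have hp : (0 : ℝ) < M * 2 ^ l := by positivity
  unfold mesh
  rw [mul_one_div, le_div_iff₀ hp]
  push_cast
  exact (Nat.lt_floor_add_one _).le

theorem natCast_mul_mesh {M : ℕ} (hM : 0 < M) (l : ℕ) :
    ((M * 2 ^ l : ℕ) : ℝ) * mesh M l = 1 := by
  unfold mesh
  push_cast
  exact mul_one_div_cancel (by positivity)

/-- The increment of `G` between the grid point of level `l + 1` with index `c` and the grid point of
level `l` below it. -/
noncomputable def refineIncr (M : ℕ) (G : ℝ → ℝ) (l c : ℕ) : ℝ :=
  G (c * mesh M (l + 1)) - G ((c / 2 : ℕ) * mesh M l)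

/-- The increment of `G` over the grid cell of level `l` with index `c`. -/
noncomputable def cellIncr (M : ℕ) (G : ℝ → ℝ) (l c : ℕ) : ℝ :=
  G ((c + 1 : ℕ) * mesh M l) - G (c * mesh M l)

/-- The part of the chaining bound that depends on `G`. -/
noncomputable def chainSum (M L : ℕ) (lam : ℕ → ℝ) (G : ℝ → ℝ) : ℝ :=
  (∑ c ∈ range M, cellIncr M G 0 c ^ 4) / lam 0 ^ 3
    + (∑ l ∈ range L, 4 *
        ((∑ c ∈ range (M * 2 ^ (l + 1) + 1), refineIncr M G l c ^ 4) / lam (l + 1) ^ 3))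
    + 4 * ((∑ c ∈ range (M * 2 ^ L + 1), cellIncr M G L c ^ 4) / lam L ^ 3)

/-- Chaining for sums against the increments of `A ∘ F - F`, with `A` and `F` monotone. -/
theorem abs_sum_mul_incr_le_chain (N M L : ℕ) (hM : 0 < M) (F s lam : ℕ → ℝ) (A G : ℝ → ℝ)
    (hF : Monotone F) (hF0 : F 0 = 0) (hFN : F N = 1) (hA : Monotone A) (hA0 : A 0 = 0)
    (hA1 : A 1 = 1) (hG : ∀ u, G u = A u - min u 1) (hs : ∀ i, |s i| ≤ 1)
    (hlam : ∀ l, 0 < lam l) (hcard : (jumpSet s N).card ≤ M) :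
    |∑ i ∈ range N, s i * (G (F (i + 1)) - G (F i))| ≤
      M * lam 0 + (∑ l ∈ range L, 4 * (M * lam (l + 1))) + 4 * (M * lam L) + 8 * (M * mesh M L)
        + chainSum M L lam G := by
  have hF0' : ∀ i, 0 ≤ F i := fun i => hF0 ▸ hF (Nat.zero_le i)
  have hF1 : ∀ i ≤ N, F i ≤ 1 := fun i hi => hFN ▸ hF hi
  have hG0 : G 0 = 0 := by rw [hG, hA0]; norm_num
  have hG1 : G 1 = 0 := by rw [hG, hA1]; norm_num
  set κ : ℕ → ℕ → ℕ := fun l i => cell M l (F i) with hκdef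
  have hκ : ∀ l, Monotone (κ l) := fun l => (cell_mono M l).comp hF
  have hκ0 : ∀ l, κ l 0 = 0 := fun l => by simp only [hκdef, hF0, cell_zero]
  have hκN : ∀ l, κ l N = M * 2 ^ l := fun l => by simp only [hκdef, hFN, cell_one]
  have hκle : ∀ l, ∀ i ≤ N, κ l i ≤ M * 2 ^ l := fun l i hi => hκN l ▸ hκ l hi
  set g0 : ℕ → ℝ := fun i => G (κ 0 i * mesh M 0) with hg0
  set e : ℕ → ℕ → ℝ := fun l i => refineIncr M G l (κ (l + 1) i) with hedef
  -- The remainder below the finest grid is not monotone within a cell, but it is the difference `a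
  -- - b` of two functions that are.
  set a : ℕ → ℝ := fun i => A (F i) - A (κ L i * mesh M L) with hadef
  set b : ℕ → ℝ := fun i => F i - κ L i * mesh M L with hbdef
  have hdecomp : ∀ i ≤ N, G (F i) = g0 i + ∑ l ∈ range L, e l i + (a i - b i) := by
    intro i hi
    have h1 : ∑ l ∈ range L, e l i = G (κ L i * mesh M L) - G (κ 0 i * mesh M 0) := by
      rw [← sum_range_sub (fun l => G (κ l i * mesh M l))]
      refine sum_congr rfl fun l _ => ?_
      simp only [hedef, refineIncr, hκdef, cell_succ_div_two]
    have h2 : (κ L i : ℝ) * mesh M L ≤ F i := cell_mul_mesh_le hM L (hF0' i)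
    rw [h1, hG (F i), hG (κ L i * mesh M L), min_eq_left (hF1 i hi),
      min_eq_left (h2.trans (hF1 i hi))]
    ring
  have hsum : ∑ i ∈ range N, s i * (G (F (i + 1)) - G (F i))
      = ∑ i ∈ range N, s i * (g0 (i + 1) - g0 i)
        + ∑ l ∈ range L, ∑ i ∈ range N, s i * (e l (i + 1) - e l i)
        + (∑ i ∈ range N, s i * (a (i + 1) - a i) - ∑ i ∈ range N, s i * (b (i + 1) - b i)) := by
    rw [sum_comm, ← sum_add_distrib, ← sum_sub_distrib, ← sum_add_distrib]
    refine sum_congr rfl fun i hi => ?_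
    have hi' := mem_range.1 hi
    rw [hdecomp (i + 1) hi', hdecomp i hi'.le, ← mul_sum, sum_sub_distrib]
    ring
  have himg : ∀ l, ((jumpSet s N).image fun i => κ l (i + 1)) ⊆ range (M * 2 ^ l + 1) := by
    intro l c hc
    obtain ⟨i, hi, rfl⟩ := mem_image.1 hc
    have := hκle l (i + 1) (mem_jumpSet.1 hi).1
    exact mem_range.2 (by omega)
  have hcimg : ∀ l, ((jumpSet s N).image fun i => κ l (i + 1)).card ≤ M := fun l =>
    card_image_le.trans hcard
  -- the coarsest grid
  have hb0 : |∑ i ∈ range N, s i * (g0 (i + 1) - g0 i)|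
      ≤ M * lam 0 + (∑ c ∈ range M, cellIncr M G 0 c ^ 4) / lam 0 ^ 3 := by
    refine (abs_sum_le_sum_abs _ _).trans ?_
    have h1 : ∑ i ∈ range N, |s i * (g0 (i + 1) - g0 i)|
        ≤ ∑ i ∈ range N, |g0 (i + 1) - g0 i| := by
      refine sum_le_sum fun i _ => ?_
      rw [abs_mul]
      exact mul_le_of_le_one_left (abs_nonneg _) (hs i)
    refine h1.trans ((sum_abs_incr_comp_le (fun c => G (c * mesh M 0)) (κ 0) (hκ 0) N).trans ?_)
    have h2 : Ico (κ 0 0) (κ 0 N) = range M := by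
      rw [hκ0, hκN, pow_zero, mul_one, range_eq_Ico]
    rw [h2]
    exact sum_abs_le_card_mul_add _ _ (Subset.refl _) (cellIncr M G 0) _ (hlam 0) M (by simp)
  -- the refinements
  have hbl : ∀ l, |∑ i ∈ range N, s i * (e l (i + 1) - e l i)| ≤ 4 * (M * lam (l + 1)) + 4 *
      ((∑ c ∈ range (M * 2 ^ (l + 1) + 1), refineIncr M G l c ^ 4) / lam (l + 1) ^ 3) := by
    intro l
    refine (abs_sum_mul_incr_le N s (e l) (fun c => |refineIncr M G l c|) (κ (l + 1))
      (hκ (l + 1)) hs (fun i _ => le_rfl) (fun c => abs_nonneg _) ?_ ?_ ?_).trans ?_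
    · intro i j _ _ hij
      simp only [hedef, hij, le_refl]
    · simp [hedef, hκ0, refineIncr, hG0]
    · have h1 : (M * 2 ^ (l + 1)) / 2 = M * 2 ^ l := by
        rw [pow_succ, ← mul_assoc, Nat.mul_div_cancel _ (by norm_num)]
      simp only [hedef, hκN, refineIncr, h1, natCast_mul_mesh hM, sub_self]
    · rw [← mul_sum, ← mul_add]
      exact mul_le_mul_of_nonneg_left (sum_abs_le_card_mul_add _ _ (himg (l + 1)) _ _
        (hlam (l + 1)) M (hcimg (l + 1))) (by norm_num)
  -- the remainder
  have hba : |∑ i ∈ range N, s i * (a (i + 1) - a i)| ≤ 4 * (M * lam L) + 4 * (M * mesh M L) +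
      4 * ((∑ c ∈ range (M * 2 ^ L + 1), cellIncr M G L c ^ 4) / lam L ^ 3) := by
    have hge : ∀ i, A (κ L i * mesh M L) ≤ A (F i) := fun i => hA (cell_mul_mesh_le hM L (hF0' i))
    refine (abs_sum_mul_incr_le N s a (fun c => |cellIncr M G L c| + mesh M L) (κ L)
      (hκ L) hs ?_ (fun c => add_nonneg (abs_nonneg _) (mesh_pos hM L).le) ?_ ?_ ?_).trans ?_
    · intro i _
      rw [abs_of_nonneg (sub_nonneg.2 (hge i))]
      have h1 : A (F i) ≤ A ((κ L i + 1 : ℕ) * mesh M L) := hA (le_cell_add_one_mul_mesh hM L _)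
      -- The cell that starts at `1` reaches beyond `1`. For this reason `G` is compared with `min u
      -- 1`, and the index ranges contain `M * 2 ^ l` itself.
      have h2 : min ((κ L i + 1 : ℕ) * mesh M L) 1 ≤ min (κ L i * mesh M L) 1 + mesh M L := by
        have := (mesh_pos hM L)
        push_cast
        rw [add_mul, one_mul]
        rcases le_total ((κ L i : ℝ) * mesh M L) 1 with h | h
        · rw [min_eq_left h]; exact min_le_left _ _
        · rw [min_eq_right h]; exact (min_le_right _ _).trans (by linarith)
      have h3 := le_abs_self (cellIncr M G L (κ L i))
      unfold cellIncr at h3 ⊢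
      rw [hG, hG] at h3 ⊢
      linarith
    · intro i j hij _ hκij
      simp only [hadef, hκij]
      exact sub_le_sub_right (hA (hF hij)) _
    · simp [hadef, hκ0, hF0]
    · simp only [hadef, hκN, natCast_mul_mesh hM, hFN, sub_self]
    · rw [← mul_sum, sum_add_distrib, sum_const, nsmul_eq_mul]
      have h1 := sum_abs_le_card_mul_add _ _ (himg L) (cellIncr M G L) _ (hlam L) M (hcimg L)
      have h2 : ((((jumpSet s N).image fun i => κ L (i + 1)).card : ℕ) : ℝ) * mesh M L
          ≤ M * mesh M L :=
        mul_le_mul_of_nonneg_right (by exact_mod_cast hcimg L) (mesh_pos hM L).le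
      linarith
  have hbb : |∑ i ∈ range N, s i * (b (i + 1) - b i)| ≤ 4 * (M * mesh M L) := by
    refine (abs_sum_mul_incr_le N s b (fun _ => mesh M L) (κ L)
      (hκ L) hs ?_ (fun c => (mesh_pos hM L).le) ?_ ?_ ?_).trans ?_
    · intro i _
      have h1 := cell_mul_mesh_le hM L (hF0' i)
      have h2 := le_cell_add_one_mul_mesh hM L (F i)
      push_cast at h2
      rw [abs_of_nonneg (sub_nonneg.2 h1)]
      linarith
    · intro i j hij _ hκij
      simp only [hbdef, hκij]
      exact sub_le_sub_right (hF hij) _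
    · simp [hbdef, hκ0, hF0]
    · simp only [hbdef, hκN, natCast_mul_mesh hM, hFN, sub_self]
    · rw [sum_const, nsmul_eq_mul]
      have h1 : ((((jumpSet s N).image fun i => κ L (i + 1)).card : ℕ) : ℝ) ≤ M := by
        exact_mod_cast hcimg L
      have := mesh_pos hM L
      nlinarith
  have hbsum : |∑ l ∈ range L, ∑ i ∈ range N, s i * (e l (i + 1) - e l i)| ≤
      ∑ l ∈ range L, (4 * (M * lam (l + 1)) + 4 *
      ((∑ c ∈ range (M * 2 ^ (l + 1) + 1), refineIncr M G l c ^ 4) / lam (l + 1) ^ 3)) :=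
    (abs_sum_le_sum_abs _ _).trans (sum_le_sum fun l _ => hbl l)
  rw [sum_add_distrib] at hbsum
  rw [hsum]
  unfold chainSum
  refine (abs_add_le _ _).trans ((add_le_add (abs_add_le _ _) (abs_sub _ _)).trans ?_)
  linarith

end MHRLearning

namespace MHRLearning
open Finset MeasureTheory ProbabilityTheory

/-! ### Moments of sums over independent samples -/

/-- The law of an infinite sequence of independent samples from `f`. -/
noncomputable abbrev sampleLaw {N : ℕ} (f : PMF (Fin N)) : Measure (ℕ → Fin N) :=
  Measure.infinitePi (fun _ : ℕ => f.toMeasure)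

/-- The sum of `ψ` over the first `n` samples. -/
noncomputable def sampleSum {N : ℕ} (ψ : Fin N → ℝ) (n : ℕ) (ω : ℕ → Fin N) : ℝ :=
  ∑ j ∈ range n, ψ (ω j)

theorem measurable_sampleSum {N : ℕ} (ψ : Fin N → ℝ) (n : ℕ) : Measurable (sampleSum ψ n) := by
  unfold sampleSum
  exact Finset.measurable_sum _ fun j _ => (measurable_of_finite ψ).comp (measurable_pi_apply j)

theorem abs_sampleSum_le {N : ℕ} (ψ : Fin N → ℝ) (hψ : ∀ x, |ψ x| ≤ 1) (n : ℕ) (ω : ℕ → Fin N) :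
    |sampleSum ψ n ω| ≤ n := by
  refine (abs_sum_le_sum_abs _ _).trans ((sum_le_sum fun j _ => hψ (ω j)).trans ?_)
  simp

theorem integral_eval_sampleLaw {N : ℕ} (f : PMF (Fin N)) (ψ : Fin N → ℝ) (j : ℕ) :
    ∫ ω, ψ (ω j) ∂(sampleLaw f) = ∑ x, massFn f x * ψ x := by
  have h := measurePreserving_eval_infinitePi (fun _ : ℕ => f.toMeasure) j
  have h1 : ∫ y, ψ y ∂f.toMeasure = ∫ ω, ψ (ω j) ∂(sampleLaw f) := by
    rw [← h.map_eq, integral_map h.measurable.aemeasurable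
      (measurable_of_finite ψ).aestronglyMeasurable]
  rw [← h1, PMF.integral_eq_sum]
  simp [massFn]

theorem integrable_of_abs_le {Ω : Type*} [MeasurableSpace Ω] {μ : Measure Ω} [IsFiniteMeasure μ]
    {g : Ω → ℝ} (hg : Measurable g) (C : ℝ) (h : ∀ x, |g x| ≤ C) : Integrable g μ :=
  Integrable.of_bound hg.aestronglyMeasurable C (Filter.Eventually.of_forall h)

theorem integrable_sampleSum_pow_mul {N : ℕ} (f : PMF (Fin N)) (ψ : Fin N → ℝ)
    (hψ : ∀ x, |ψ x| ≤ 1) (n a b : ℕ) :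
    Integrable (fun ω => sampleSum ψ n ω ^ a * ψ (ω n) ^ b) (sampleLaw f) := by
  refine integrable_of_abs_le (((measurable_sampleSum ψ n).pow_const a).mul
    (((measurable_of_finite ψ).comp (measurable_pi_apply n)).pow_const b)) ((n : ℝ) ^ a * 1 ^ b) ?_
  intro ω
  rw [abs_mul, abs_pow, abs_pow]
  have h1 := abs_sampleSum_le ψ hψ n ω
  have h2 := hψ (ω n)
  gcongr

/-- Sample number `n` is independent of the samples before it, so mixed moments factor. The moment
bounds follow from this by induction on `n`. -/
theorem integral_sampleSum_pow_mul {N : ℕ} (f : PMF (Fin N)) (ψ : Fin N → ℝ) (n a b : ℕ) :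
    ∫ ω, sampleSum ψ n ω ^ a * ψ (ω n) ^ b ∂(sampleLaw f)
      = (∫ ω, sampleSum ψ n ω ^ a ∂(sampleLaw f)) * ∑ x, massFn f x * ψ x ^ b := by
  have hind : iIndepFun (fun (j : ℕ) (ω : ℕ → Fin N) => ψ (ω j)) (sampleLaw f) :=
    iIndepFun_infinitePi (X := fun _ => ψ) fun _ => measurable_of_finite ψ
  have hm : ∀ j : ℕ, Measurable fun ω : ℕ → Fin N => ψ (ω j) := fun j =>
    (measurable_of_finite ψ).comp (measurable_pi_apply j)
  have h1 := hind.indepFun_finsetSum_of_notMem hm (s := range n) (i := n) (by simp)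
  have h2 : (∑ j ∈ range n, fun ω : ℕ → Fin N => ψ (ω j)) = sampleSum ψ n := by
    ext ω; simp [sampleSum]
  rw [h2] at h1
  have h3 := h1.comp (measurable_id.pow_const a) (measurable_id.pow_const b)
  have h4 := h3.integral_fun_mul_eq_mul_integral
    (((measurable_sampleSum ψ n).pow_const a).aestronglyMeasurable)
    (((hm n).pow_const b).aestronglyMeasurable)
  rw [← integral_eval_sampleLaw f (fun x => ψ x ^ b) n]
  exact h4

theorem sum_massFn {N : ℕ} (f : PMF (Fin N)) : ∑ x, massFn f x = 1 := by
  have h := f.tsum_coe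
  rw [tsum_fintype] at h
  have h2 : (∑ x, f x).toReal = 1 := by rw [h]; simp
  rw [ENNReal.toReal_sum fun x _ => f.apply_ne_top x] at h2
  exact h2

theorem massFn_nonneg {N : ℕ} (f : PMF (Fin N)) (x : Fin N) : 0 ≤ massFn f x :=
  ENNReal.toReal_nonneg

section
variable {N : ℕ} (f : PMF (Fin N)) (ψ : Fin N → ℝ) (hψ : ∀ x, |ψ x| ≤ 1)
  (hmean : ∑ x, massFn f x * ψ x = 0) (p : ℝ) (hp : ∑ x, massFn f x * ψ x ^ 2 ≤ p)
include hψ hmean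

theorem integral_sampleSum (n : ℕ) : ∫ ω, sampleSum ψ n ω ∂(sampleLaw f) = 0 := by
  unfold sampleSum
  rw [integral_finsetSum]
  · exact sum_eq_zero fun j _ => by rw [integral_eval_sampleLaw f ψ j, hmean]
  · intro j _
    exact integrable_of_abs_le ((measurable_of_finite ψ).comp (measurable_pi_apply j)) 1
      fun ω => hψ (ω j)

include hp

theorem integral_sampleSum_sq_le (n : ℕ) : ∫ ω, sampleSum ψ n ω ^ 2 ∂(sampleLaw f) ≤ n * p := by
  induction n with
  | zero => simp [sampleSum]
  | succ n ih =>
    have hI := integrable_sampleSum_pow_mul f ψ hψ n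
    have e1 : ∀ ω, sampleSum ψ (n + 1) ω ^ 2 = sampleSum ψ n ω ^ 2 * ψ (ω n) ^ 0
        + 2 * (sampleSum ψ n ω ^ 1 * ψ (ω n) ^ 1) + sampleSum ψ n ω ^ 0 * ψ (ω n) ^ 2 := by
      intro ω
      have : sampleSum ψ (n + 1) ω = sampleSum ψ n ω + ψ (ω n) := sum_range_succ _ _
      rw [this]; ring
    simp_rw [e1]
    rw [integral_add ((hI 2 0).fun_add ((hI 1 1).const_mul 2)) (hI 0 2),
      integral_add (hI 2 0) ((hI 1 1).const_mul 2), integral_const_mul,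
      integral_sampleSum_pow_mul, integral_sampleSum_pow_mul, integral_sampleSum_pow_mul]
    simp only [pow_zero, mul_one, sum_massFn, pow_one, hmean, mul_zero, add_zero, integral_const,
      probReal_univ, smul_eq_mul, one_mul]
    push_cast
    linarith

/-- In the binomial expansion of the fourth power, the terms linear in the new sample vanish because
`ψ` is centred, and the term linear in the old sum vanishes because that sum is centred. Each step
therefore adds at most `6 n p²` from the squares and `p` from the fourth power. -/
theorem integral_sampleSum_pow_four_le (n : ℕ) :
    ∫ ω, sampleSum ψ n ω ^ 4 ∂(sampleLaw f) ≤ n * p + 3 * n ^ 2 * p ^ 2 := by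
  have hp0 : 0 ≤ p := le_trans (sum_nonneg fun x _ => mul_nonneg (massFn_nonneg f x)
    (sq_nonneg _)) hp
  have h4 : ∑ x, massFn f x * ψ x ^ 4 ≤ p := by
    refine le_trans (sum_le_sum fun x _ => mul_le_mul_of_nonneg_left ?_ (massFn_nonneg f x)) hp
    have h1 : ψ x ^ 2 ≤ 1 := by
      rw [← sq_abs]; exact pow_le_one₀ (abs_nonneg _) (hψ x)
    nlinarith [sq_nonneg (ψ x)]
  induction n with
  | zero => simp [sampleSum]
  | succ n ih =>
    have hI := integrable_sampleSum_pow_mul f ψ hψ n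
    have e1 : ∀ ω, sampleSum ψ (n + 1) ω ^ 4 = sampleSum ψ n ω ^ 4 * ψ (ω n) ^ 0
        + 4 * (sampleSum ψ n ω ^ 3 * ψ (ω n) ^ 1) + 6 * (sampleSum ψ n ω ^ 2 * ψ (ω n) ^ 2)
        + 4 * (sampleSum ψ n ω ^ 1 * ψ (ω n) ^ 3) + sampleSum ψ n ω ^ 0 * ψ (ω n) ^ 4 := by
      intro ω
      have : sampleSum ψ (n + 1) ω = sampleSum ψ n ω + ψ (ω n) := sum_range_succ _ _
      rw [this]; ring
    simp_rw [e1]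
    have i1 := (hI 4 0).fun_add ((hI 3 1).const_mul 4)
    have i2 := i1.fun_add ((hI 2 2).const_mul 6)
    have i3 := i2.fun_add ((hI 1 3).const_mul 4)
    rw [integral_add i3 (hI 0 4), integral_add i2 ((hI 1 3).const_mul 4),
      integral_add i1 ((hI 2 2).const_mul 6), integral_add (hI 4 0) ((hI 3 1).const_mul 4),
      integral_const_mul, integral_const_mul, integral_const_mul,
      integral_sampleSum_pow_mul, integral_sampleSum_pow_mul, integral_sampleSum_pow_mul,
      integral_sampleSum_pow_mul, integral_sampleSum_pow_mul]
    have h0 := integral_sampleSum f ψ hψ hmean n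
    simp only [pow_zero, mul_one, sum_massFn, pow_one, hmean, mul_zero, add_zero, integral_const,
      probReal_univ, smul_eq_mul, one_mul, h0, zero_mul]
    have h2 := integral_sampleSum_sq_le f ψ hψ hmean p hp n
    have h3 : (∫ ω, sampleSum ψ n ω ^ 2 ∂(sampleLaw f)) * ∑ x, massFn f x * ψ x ^ 2
        ≤ (n * p) * p := by
      apply mul_le_mul h2 hp
      · exact sum_nonneg fun x _ => mul_nonneg (massFn_nonneg f x) (sq_nonneg _)
      · positivity
    push_cast
    nlinarith [sq_nonneg p]

end

end MHRLearning

namespace MHRLearning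
open Finset MeasureTheory ProbabilityTheory

/-! ### Uniform deviations of the empirical distribution -/

/-- Extension by zero of a function on `Fin N`. -/
noncomputable def extendZero {N : ℕ} (g : Fin N → ℝ) (i : ℕ) : ℝ :=
  if h : i < N then g ⟨i, h⟩ else 0

theorem extendZero_val {N : ℕ} (g : Fin N → ℝ) (x : Fin N) : extendZero g x = g x := by
  simp [extendZero]

theorem extendZero_of_le {N : ℕ} (g : Fin N → ℝ) {i : ℕ} (h : N ≤ i) : extendZero g i = 0 := by
  simp [extendZero, not_lt.2 h]

/-- The mass of the first `i` points. -/
noncomputable def cumMass {N : ℕ} (f : PMF (Fin N)) (i : ℕ) : ℝ :=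
  ∑ j ∈ range i, extendZero (massFn f) j

/-- The fraction of the first `n` samples that lies in the first `i` points. -/
noncomputable def empCum {N : ℕ} (ω : ℕ → Fin N) (n i : ℕ) : ℝ :=
  (((range n).filter fun j => (ω j : ℕ) < i).card : ℝ) / n

/-- The part of the atom `x` that lies below the level `u` on the quantile scale. -/
noncomputable def quantileFrac {N : ℕ} (f : PMF (Fin N)) (u : ℝ) (x : Fin N) : ℝ :=
  (min u (cumMass f (x + 1)) - min u (cumMass f x)) / massFn f x

section
variable {N : ℕ} (f : PMF (Fin N))

theorem extendZero_massFn_nonneg (i : ℕ) : 0 ≤ extendZero (massFn f) i := by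
  unfold extendZero
  split_ifs
  · exact massFn_nonneg f _
  · exact le_rfl

theorem cumMass_succ (i : ℕ) : cumMass f (i + 1) = cumMass f i + extendZero (massFn f) i :=
  sum_range_succ _ _

theorem cumMass_succ_val (x : Fin N) : cumMass f (x + 1) = cumMass f x + massFn f x := by
  rw [cumMass_succ, extendZero_val]

theorem cumMass_mono : Monotone (cumMass f) :=
  monotone_nat_of_le_succ fun i => by
    rw [cumMass_succ]; linarith [extendZero_massFn_nonneg f i]

theorem cumMass_zero : cumMass f 0 = 0 := by simp [cumMass]

theorem cumMass_top : cumMass f N = 1 := by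
  rw [← sum_massFn f, cumMass, ← Fin.sum_univ_eq_sum_range]
  exact sum_congr rfl fun x _ => extendZero_val _ x

theorem cumMass_nonneg (i : ℕ) : 0 ≤ cumMass f i := cumMass_zero f ▸ cumMass_mono f (Nat.zero_le i)

theorem massFn_mul_quantileFrac (u : ℝ) (x : Fin N) :
    massFn f x * quantileFrac f u x = min u (cumMass f (x + 1)) - min u (cumMass f x) := by
  unfold quantileFrac
  by_cases h : massFn f x = 0
  · rw [h, cumMass_succ_val, h]; simp
  · rw [mul_div_cancel₀ _ h]

/-- On the quantile scale every `f` looks uniform: splitting atoms makes a grid cell inside `[0, 1]`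
have mass exactly its length, however large the atoms of `f` are. -/
theorem sum_massFn_mul_quantileFrac {u : ℝ} (hu : 0 ≤ u) :
    ∑ x, massFn f x * quantileFrac f u x = min u 1 := by
  simp_rw [massFn_mul_quantileFrac]
  rw [Fin.sum_univ_eq_sum_range (fun i => min u (cumMass f (i + 1)) - min u (cumMass f i)),
    sum_range_sub (fun i => min u (cumMass f i)), cumMass_zero, cumMass_top, min_eq_right hu,
    sub_zero]

theorem min_sub_min_mono {a b : ℝ} (hab : a ≤ b) {u v : ℝ} (huv : u ≤ v) :
    min u b - min u a ≤ min v b - min v a := by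
  rcases le_total u a with h1 | h1 <;> rcases le_total u b with h2 | h2 <;>
    rcases le_total v a with h3 | h3 <;> rcases le_total v b with h4 | h4 <;>
    simp only [min_eq_left, min_eq_right, h1, h2, h3, h4] <;> linarith

theorem quantileFrac_mono (x : Fin N) : Monotone fun u => quantileFrac f u x := fun _ _ h =>
  div_le_div_of_nonneg_right (min_sub_min_mono (cumMass_mono f (Nat.le_succ _)) h)
    (massFn_nonneg f x)

theorem quantileFrac_nonneg (u : ℝ) (x : Fin N) : 0 ≤ quantileFrac f u x :=
  div_nonneg (sub_nonneg.2 (min_le_min_left _ (cumMass_mono f (Nat.le_succ _))))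
    (massFn_nonneg f x)

theorem quantileFrac_le_one (u : ℝ) (x : Fin N) : quantileFrac f u x ≤ 1 := by
  refine div_le_one_of_le₀ ?_ (massFn_nonneg f x)
  rw [cumMass_succ_val]
  have := massFn_nonneg f x
  rcases le_total u (cumMass f x) with h | h
  · rw [min_eq_left h, min_eq_left (by linarith)]; linarith
  · rw [min_eq_right h]; linarith [min_le_right u (cumMass f x + massFn f x)]

/-- At levels that are cumulative masses no atom is split, so the average is the genuine empirical
distribution function. Null atoms are excluded because there `quantileFrac` is `0` as a division by
zero. -/
theorem quantileFrac_cumMass (i : ℕ) (x : Fin N) (hx : massFn f x ≠ 0) :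
    quantileFrac f (cumMass f i) x = if (x : ℕ) < i then 1 else 0 := by
  unfold quantileFrac
  split_ifs with h
  · rw [min_eq_right (cumMass_mono f h), min_eq_right (cumMass_mono f h.le), cumMass_succ_val,
      add_sub_cancel_left, div_self hx]
  · rw [not_lt] at h
    rw [min_eq_left (cumMass_mono f (h.trans (Nat.le_succ _))), min_eq_left (cumMass_mono f h),
      sub_self, zero_div]

/-- The empirical average of `quantileFrac f u`. -/
noncomputable def quantileAvg (n : ℕ) (ω : ℕ → Fin N) (u : ℝ) : ℝ :=
  sampleSum (quantileFrac f u) n ω / n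

/-- The deviation of `quantileAvg` from its mean. -/
noncomputable def quantileDev (n : ℕ) (ω : ℕ → Fin N) (u : ℝ) : ℝ :=
  quantileAvg f n ω u - min u 1

theorem quantileAvg_mono (n : ℕ) (ω : ℕ → Fin N) : Monotone (quantileAvg f n ω) := fun _ _ h =>
  div_le_div_of_nonneg_right (sum_le_sum fun _ _ => quantileFrac_mono f _ h) (Nat.cast_nonneg n)

theorem quantileAvg_cumMass (n : ℕ) (ω : ℕ → Fin N) (hω : ∀ j, massFn f (ω j) ≠ 0) (i : ℕ) :
    quantileAvg f n ω (cumMass f i) = empCum ω n i := by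
  unfold quantileAvg empCum sampleSum
  simp_rw [quantileFrac_cumMass f i _ (hω _)]
  simp

theorem ae_massFn_ne_zero : ∀ᵐ ω ∂(sampleLaw f), ∀ j, massFn f (ω j) ≠ 0 := by
  rw [ae_all_iff]
  intro j
  have h := measurePreserving_eval_infinitePi (fun _ : ℕ => f.toMeasure) j
  have h1 : ∀ᵐ x ∂f.toMeasure, massFn f x ≠ 0 := by
    rw [ae_iff, PMF.toMeasure_apply_eq_zero_iff _ (Set.toFinite _).measurableSet]
    rw [Set.disjoint_left]
    intro x hx hx'
    simp only [ne_eq, not_not, Set.mem_ofPred_eq, massFn, ENNReal.toReal_eq_zero_iff,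
      f.apply_ne_top x, or_false] at hx'
    exact (f.mem_support_iff x).1 hx hx'
  exact h.quasiMeasurePreserving.ae h1

theorem measurable_quantileDev (n : ℕ) (u : ℝ) : Measurable fun ω => quantileDev f n ω u :=
  ((measurable_sampleSum _ n).div_const _).sub_const _

theorem abs_quantileDev_le (n : ℕ) (ω : ℕ → Fin N) {u : ℝ} (hu : 0 ≤ u) :
    |quantileDev f n ω u| ≤ 1 := by
  have h0 : 0 ≤ quantileAvg f n ω u := div_nonneg (sum_nonneg fun _ _ => quantileFrac_nonneg f _ _)
    (Nat.cast_nonneg n)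
  have h1 : quantileAvg f n ω u ≤ 1 := by
    refine div_le_one_of_le₀ ?_ (Nat.cast_nonneg n)
    refine (sum_le_sum fun j _ => quantileFrac_le_one f u (ω j)).trans ?_
    simp
  have h2 : min u 1 ≤ 1 := min_le_right _ _
  have h3 : 0 ≤ min u 1 := le_min hu zero_le_one
  unfold quantileDev
  rw [abs_le]
  constructor <;> linarith

theorem integrable_quantileDev_sub_pow (n : ℕ) {u v : ℝ} (hu : 0 ≤ u) (hv : 0 ≤ v) :
    Integrable (fun ω => (quantileDev f n ω v - quantileDev f n ω u) ^ 4) (sampleLaw f) := by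
  refine integrable_of_abs_le (((measurable_quantileDev f n v).sub
    (measurable_quantileDev f n u)).pow_const 4) (2 ^ 4) fun ω => ?_
  rw [abs_pow]
  have h1 := abs_quantileDev_le f n ω hu
  have h2 := abs_quantileDev_le f n ω hv
  have h3 := abs_sub (quantileDev f n ω v) (quantileDev f n ω u)
  gcongr
  linarith

/-- The increment is an average of `n` centred variables with values in `[-1, 1]` and variance at
most `p`. The condition `1 ≤ n p` lets the term `n² p²` of the fourth-moment bound absorb `n p`; it
limits how fine the grids may become. -/
theorem integral_quantileDev_sub_pow_le {n : ℕ} {u v p : ℝ} (hu : 0 ≤ u) (huv : u ≤ v)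
    (hp : v - u ≤ p) (hn : 1 ≤ n * p) :
    ∫ ω, (quantileDev f n ω v - quantileDev f n ω u) ^ 4 ∂(sampleLaw f) ≤ 4 * p ^ 2 / n ^ 2 := by
  have hn0 : (0 : ℝ) < n := by
    rcases Nat.eq_zero_or_pos n with h | h
    · subst h; norm_num at hn
    · exact_mod_cast h
  set m := min v 1 - min u 1 with hm
  have hm0 : 0 ≤ m := sub_nonneg.2 (min_le_min_right _ huv)
  have hm1 : m ≤ 1 := by
    have : 0 ≤ min u 1 := le_min hu zero_le_one
    linarith [min_le_right v 1]
  have hmp : m ≤ v - u := by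
    rcases le_total u 1 with h | h
    · rw [hm, min_eq_left h]; linarith [min_le_left v 1]
    · rw [hm, min_eq_right h]; linarith [min_le_right v 1]
  set χ : Fin N → ℝ := fun x => quantileFrac f v x - quantileFrac f u x with hχ
  have hχ0 : ∀ x, 0 ≤ χ x := fun x => sub_nonneg.2 (quantileFrac_mono f x huv)
  have hχ1 : ∀ x, χ x ≤ 1 := fun x => by
    have := quantileFrac_nonneg f u x
    have := quantileFrac_le_one f v x
    simp only [hχ]; linarith
  have hχm : ∑ x, massFn f x * χ x = m := by
    simp only [hχ, mul_sub, sum_sub_distrib]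
    rw [sum_massFn_mul_quantileFrac f hu, sum_massFn_mul_quantileFrac f (hu.trans huv)]
  have e1 : ∀ ω, quantileDev f n ω v - quantileDev f n ω u
      = sampleSum (fun x => χ x - m) n ω / n := by
    intro ω
    have h1 : sampleSum (fun x => χ x - m) n ω
        = sampleSum (quantileFrac f v) n ω - sampleSum (quantileFrac f u) n ω - n * m := by
      simp [sampleSum, hχ, sum_sub_distrib]
    rw [h1]
    unfold quantileDev quantileAvg
    field_simp
    rw [hm]
    ring
  simp_rw [e1, div_pow]
  rw [integral_div]
  have hmean : ∑ x, massFn f x * (χ x - m) = 0 := by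
    simp only [mul_sub, sum_sub_distrib, hχm, ← sum_mul, sum_massFn]; ring
  -- Since `0 ≤ χ ≤ 1`, the bound `χ² ≤ χ` makes the variance at most `m - m²`.
  have hvar : ∑ x, massFn f x * (χ x - m) ^ 2 ≤ p := by
    have h1 : ∑ x, massFn f x * (χ x - m) ^ 2 ≤ ∑ x, massFn f x * (χ x - 2 * m * χ x + m ^ 2) := by
      refine sum_le_sum fun x _ => mul_le_mul_of_nonneg_left ?_ (massFn_nonneg f x)
      nlinarith [hχ0 x, hχ1 x]
    have h2 : ∑ x, massFn f x * (χ x - 2 * m * χ x + m ^ 2)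
        = (1 - 2 * m) * (∑ x, massFn f x * χ x) + m ^ 2 * ∑ x, massFn f x := by
      rw [mul_sum, mul_sum, ← sum_add_distrib]
      exact sum_congr rfl fun x _ => by ring
    rw [h2, hχm, sum_massFn] at h1
    nlinarith
  have h4 := integral_sampleSum_pow_four_le f (fun x => χ x - m)
    (fun x => abs_le.2 ⟨by linarith [hχ0 x], by linarith [hχ1 x]⟩) hmean p hvar n
  rw [div_le_div_iff₀ (by positivity) (by positivity)]
  have hp0 : 0 < p := by
    by_contra h
    nlinarith
  have h5 : n * p ≤ n ^ 2 * p ^ 2 := by nlinarith [mul_pos hn0 hp0]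
  calc _ ≤ (n * p + 3 * n ^ 2 * p ^ 2) * (n : ℝ) ^ 2 := by gcongr
    _ ≤ (4 * (n ^ 2 * p ^ 2)) * (n : ℝ) ^ 2 := by gcongr; linarith
    _ = _ := by ring

end

end MHRLearning

/-! ### Expectation of the chaining bound, and the uniform deviation inequality. -/

namespace MHRLearning
open Finset MeasureTheory ProbabilityTheory

theorem mesh_zero_or_succ_bounds {M : ℕ} (hM : 0 < M) (l c : ℕ) :
    ((c / 2 : ℕ) : ℝ) * mesh M l ≤ c * mesh M (l + 1) ∧
      c * mesh M (l + 1) - ((c / 2 : ℕ) : ℝ) * mesh M l ≤ mesh M (l + 1) := by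
  have h1 : mesh M l = 2 * mesh M (l + 1) := by
    unfold mesh
    rw [pow_succ]
    field_simp
  have h2 := mesh_pos hM (l + 1)
  have h3 : (2 * (c / 2 : ℕ) : ℝ) ≤ c := by exact_mod_cast Nat.mul_div_le c 2
  have h4 : (c : ℝ) ≤ 2 * (c / 2 : ℕ) + 1 := by
    have : c ≤ 2 * (c / 2) + 1 := by omega
    exact_mod_cast this
  rw [h1]
  constructor <;> nlinarith

/-- The geometric thresholds used at the levels of the chain. -/
noncomputable def chainThreshold (δ : ℝ) (M l : ℕ) : ℝ := δ / (112 * M) * (5 / 6) ^ l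

section
variable {N : ℕ} (f : PMF (Fin N)) {n M L : ℕ} {δ : ℝ}

/-- There are about `2 ^ l` times `M` cells, each with a fourth moment proportional to `4 ^ (-l)`,
so the level total decays like `2 ^ (-l)`. Dividing by the cube of a threshold with ratio `5/6`
leaves the ratio `108/125 < 1`. A threshold ratio strictly between `2 ^ (-1/3)` and `1` makes both
the thresholds and these expectations summable. -/
theorem integral_levelSum_le (hM : 0 < M) (hδ : 0 < δ) (l K : ℕ) (hK : K ≤ 2 * (M * 2 ^ l))
    (hn : (M * 2 ^ l : ℝ) ≤ n) (X : ℕ → (ℕ → Fin N) → ℝ)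
    (hX : ∀ c, ∫ ω, X c ω ^ 4 ∂(sampleLaw f) ≤ 4 * mesh M l ^ 2 / n ^ 2)
    (hI : ∀ c, Integrable (fun ω => X c ω ^ 4) (sampleLaw f)) :
    ∫ ω, (∑ c ∈ range K, X c ω ^ 4) / chainThreshold δ M l ^ 3 ∂(sampleLaw f) ≤
      8 * 112 ^ 3 * M ^ 2 / (n ^ 2 * δ ^ 3) * (108 / 125) ^ l := by
  have hM' : (0 : ℝ) < M := by exact_mod_cast hM
  have hn0 : (0 : ℝ) < n := lt_of_lt_of_le (by positivity) hn
  have hlam : 0 < chainThreshold δ M l := by unfold chainThreshold; positivity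
  rw [integral_div, integral_finsetSum _ fun c _ => hI c, div_le_iff₀ (by positivity)]
  refine (sum_le_sum fun c _ => hX c).trans ?_
  rw [sum_const, card_range, nsmul_eq_mul]
  have h1 : (K : ℝ) ≤ 2 * (M * 2 ^ l) := by exact_mod_cast hK
  refine (mul_le_mul_of_nonneg_right h1 (by positivity)).trans (le_of_eq ?_)
  unfold mesh chainThreshold
  have h2 : (108 / 125 : ℝ) ^ l * ((5 / 6) ^ l) ^ 3 * 2 ^ l = 1 := by
    rw [← pow_mul, mul_comm l 3, pow_mul, ← mul_pow, ← mul_pow]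
    norm_num
  have h3 : (2 : ℝ) ^ l ≠ 0 := by positivity
  have h4 : ((108 / 125 : ℝ) ^ l * ((5 / 6) ^ l) ^ 3) = 1 / 2 ^ l := by
    rw [eq_div_iff h3, h2]
  calc 2 * ((M : ℝ) * 2 ^ l) * (4 * (1 / (M * 2 ^ l)) ^ 2 / n ^ 2)
      = 8 / (M * n ^ 2) * (1 / 2 ^ l) := by field_simp; ring
    _ = _ := by
      rw [← h4]
      field_simp

theorem mul_geom_bound (D : ℝ) (hD : 0 ≤ D) (r : ℝ) (hr0 : 0 ≤ r) (hr1 : r < 1) (L : ℕ) :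
    ∑ l ∈ range L, D * r ^ (l + 1) ≤ D * (r / (1 - r)) := by
  rw [← mul_sum]
  refine mul_le_mul_of_nonneg_left ?_ hD
  have h : ∑ l ∈ range L, r ^ (l + 1) = r * ∑ l ∈ range L, r ^ l := by
    rw [mul_sum]; exact sum_congr rfl fun l _ => by ring
  rw [h, div_eq_mul_inv]
  refine mul_le_mul_of_nonneg_left ?_ hr0
  have := geom_sum_eq (ne_of_lt hr1) L
  rw [this, ← neg_div_neg_eq, neg_sub, neg_sub, ← one_div]
  have h2 : 0 < 1 - r := by linarith
  gcongr
  linarith [pow_nonneg hr0 L]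

theorem integral_chainSum_le (hM : 0 < M) (hδ : 0 < δ) (hn : (M * 2 ^ L : ℝ) ≤ n) :
    Integrable (fun ω => chainSum M L (chainThreshold δ M) (quantileDev f n ω)) (sampleLaw f) ∧
    ∫ ω, chainSum M L (chainThreshold δ M) (quantileDev f n ω) ∂(sampleLaw f) ≤
      8 * 112 ^ 3 * M ^ 2 / (n ^ 2 * δ ^ 3) * 31 := by
  have hM' : (0 : ℝ) < M := by exact_mod_cast hM
  set D : ℝ := 8 * 112 ^ 3 * M ^ 2 / (n ^ 2 * δ ^ 3) with hD
  have hD0 : 0 ≤ D := by positivity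
  have hle : ∀ l ≤ L, (M * 2 ^ l : ℝ) ≤ n := fun l hl => le_trans (by gcongr; norm_num) hn
  have hmesh : ∀ l ≤ L, (1 : ℝ) ≤ n * mesh M l := by
    intro l hl
    unfold mesh
    rw [mul_one_div, le_div_iff₀ (by positivity), one_mul]
    exact hle l hl
  have hmp := fun l => mesh_pos hM l
  have hcell : ∀ l (c : ℕ), ((c : ℝ) * mesh M l ≤ (c + 1 : ℕ) * mesh M l ∧
      ((c + 1 : ℕ) : ℝ) * mesh M l - c * mesh M l ≤ mesh M l) := by
    intro l c
    have := hmp l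
    push_cast
    constructor <;> nlinarith
  have hIc : ∀ l c, Integrable (fun ω => cellIncr M (quantileDev f n ω) l c ^ 4) (sampleLaw f) :=
    fun l c => integrable_quantileDev_sub_pow f n (mul_nonneg (Nat.cast_nonneg _) (hmp _).le)
      (mul_nonneg (Nat.cast_nonneg _) (hmp _).le)
  have hIr : ∀ l c, Integrable (fun ω => refineIncr M (quantileDev f n ω) l c ^ 4) (sampleLaw f) :=
    fun l c => integrable_quantileDev_sub_pow f n (mul_nonneg (Nat.cast_nonneg _) (hmp _).le)
      (mul_nonneg (Nat.cast_nonneg _) (hmp _).le)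
  have hpos2 : ∀ l, 1 ≤ M * 2 ^ l := fun l => Nat.succ_le_of_lt (by positivity)
  have b0 := integral_levelSum_le f hM hδ 0 M (by omega) (hle 0 (Nat.zero_le _))
    (fun c ω => cellIncr M (quantileDev f n ω) 0 c)
    (fun c => integral_quantileDev_sub_pow_le f (mul_nonneg (Nat.cast_nonneg _) (hmp _).le)
      (hcell 0 c).1 (hcell 0 c).2 (hmesh 0 (Nat.zero_le _))) (hIc 0)
  have bL := integral_levelSum_le f hM hδ L (M * 2 ^ L + 1) (by have := hpos2 L; omega) hn
    (fun c ω => cellIncr M (quantileDev f n ω) L c)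
    (fun c => integral_quantileDev_sub_pow_le f (mul_nonneg (Nat.cast_nonneg _) (hmp _).le)
      (hcell L c).1 (hcell L c).2 (hmesh L le_rfl)) (hIc L)
  have bl : ∀ l < L, _ := fun l hl => integral_levelSum_le f hM hδ (l + 1) (M * 2 ^ (l + 1) + 1)
    (by have := hpos2 (l + 1); omega) (hle (l + 1) hl)
    (fun c ω => refineIncr M (quantileDev f n ω) l c)
    (fun c => integral_quantileDev_sub_pow_le f (mul_nonneg (Nat.cast_nonneg _) (hmp _).le)
      (mesh_zero_or_succ_bounds hM l c).1 (mesh_zero_or_succ_bounds hM l c).2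
      (hmesh (l + 1) hl)) (hIr l)
  have i0 : Integrable (fun ω => (∑ c ∈ range M, cellIncr M (quantileDev f n ω) 0 c ^ 4)
      / chainThreshold δ M 0 ^ 3) (sampleLaw f) :=
    (integrable_finsetSum _ fun c _ => hIc 0 c).div_const _
  have iL : Integrable (fun ω => 4 * ((∑ c ∈ range (M * 2 ^ L + 1),
      cellIncr M (quantileDev f n ω) L c ^ 4) / chainThreshold δ M L ^ 3)) (sampleLaw f) :=
    ((integrable_finsetSum _ fun c _ => hIc L c).div_const _).const_mul 4
  have il : ∀ l ∈ range L, Integrable (fun ω => 4 * ((∑ c ∈ range (M * 2 ^ (l + 1) + 1),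
      refineIncr M (quantileDev f n ω) l c ^ 4) / chainThreshold δ M (l + 1) ^ 3))
      (sampleLaw f) := fun l _ =>
    ((integrable_finsetSum _ fun c _ => hIr l c).div_const _).const_mul 4
  have is := integrable_finsetSum _ il
  unfold chainSum
  refine ⟨(i0.fun_add is).fun_add iL, ?_⟩
  rw [integral_add (i0.fun_add is) iL, integral_add i0 is, integral_finsetSum _ il,
    integral_const_mul]
  have hs : ∑ l ∈ range L, ∫ ω, 4 * ((∑ c ∈ range (M * 2 ^ (l + 1) + 1),
      refineIncr M (quantileDev f n ω) l c ^ 4) / chainThreshold δ M (l + 1) ^ 3) ∂(sampleLaw f)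
      ≤ ∑ l ∈ range L, (4 * D) * (108 / 125) ^ (l + 1) := by
    refine sum_le_sum fun l hl => ?_
    rw [integral_const_mul, mul_assoc]
    exact mul_le_mul_of_nonneg_left (bl l (mem_range.1 hl)) (by norm_num)
  -- The geometric series contributes `4 · 108/17 < 26`; the coarsest grid adds `1` and the
  -- remainder `4`, hence the factor `31`.
  have hg := mul_geom_bound (4 * D) (by positivity) (108 / 125) (by norm_num) (by norm_num) L
  have hL1 : (108 / 125 : ℝ) ^ L ≤ 1 := pow_le_one₀ (by norm_num) (by norm_num)
  have hL2 : D * (108 / 125) ^ L ≤ D := mul_le_of_le_one_right hD0 hL1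
  rw [pow_zero, mul_one, ← hD] at b0
  rw [← hD] at bL
  norm_num at hg
  linarith

/-- With probability at least `9/10`, the empirical distribution of `n` samples is `δ`-close to `f`
against all test functions with at most `M` jumps. -/
theorem nine_tenths_le_sampleLaw_uniform_deviation (hM : 0 < M) (hδ : 0 < δ) (hδ1 : δ ≤ 1)
    (hn : 10 ^ 5 * M ≤ n * δ ^ 2) :
    9 / 10 ≤ sampleLaw f {ω | ∀ s : ℕ → ℝ, (∀ i, |s i| ≤ 1) → (jumpSet s N).card ≤ M →
      |∑ i ∈ range N, s i * (empCum ω n (i + 1) - empCum ω n i - extendZero (massFn f) i)|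
        ≤ δ} := by
  have hM' : (0 : ℝ) < M := by exact_mod_cast hM
  have hM1 : (1 : ℝ) ≤ M := by exact_mod_cast hM
  have hnpos : (0 : ℝ) < n := by
    by_contra h
    have : (n : ℝ) = 0 := le_antisymm (not_lt.1 h) (Nat.cast_nonneg n)
    rw [this] at hn
    nlinarith
  -- The lower bound on `2 ^ L` makes the discretisation error `8 / 2 ^ L` at most `δ / 4`. The
  -- upper bound keeps `M * 2 ^ L ≤ n`, as the moment estimate requires on the finest grid.
  obtain ⟨L, hL1, hL2⟩ : ∃ L : ℕ, 32 / δ ≤ 2 ^ L ∧ (2 : ℝ) ^ L ≤ 64 / δ := by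
    obtain ⟨L, h1, h2⟩ := exists_nat_pow_near (x := 32 / δ) (y := 2)
      (by rw [le_div_iff₀ hδ]; linarith) (by norm_num)
    refine ⟨L + 1, h2.le, ?_⟩
    rw [pow_succ]
    calc (2 : ℝ) ^ L * 2 ≤ 32 / δ * 2 := by gcongr
      _ = 64 / δ := by ring
  have hnL : (M * 2 ^ L : ℝ) ≤ n := by
    have h1 : (M : ℝ) * 2 ^ L ≤ M * (64 / δ) := by gcongr
    refine h1.trans ?_
    rw [← mul_div_assoc, div_le_iff₀ hδ]
    have h2 : n * δ ^ 2 ≤ n * δ := by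
      have : δ ^ 2 ≤ δ := by nlinarith
      gcongr
    linarith
  obtain ⟨hint, hexp⟩ := integral_chainSum_le f hM hδ hnL
  set R : (ℕ → Fin N) → ℝ := fun ω => chainSum M L (chainThreshold δ M) (quantileDev f n ω) with hR
  have hlam : ∀ l, 0 < chainThreshold δ M l := fun l => by unfold chainThreshold; positivity
  have hR0 : ∀ ω, 0 ≤ R ω := by
    intro ω
    have h1 := fun l => (hlam l).le
    simp only [hR, chainSum]
    have e4 : ∀ x : ℝ, 0 ≤ x ^ 4 := fun x => by positivity
    refine add_nonneg (add_nonneg ?_ ?_) ?_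
    · exact div_nonneg (sum_nonneg fun c _ => e4 _) (pow_nonneg (h1 _) 3)
    · exact sum_nonneg fun l _ => mul_nonneg (by norm_num)
        (div_nonneg (sum_nonneg fun c _ => e4 _) (pow_nonneg (h1 _) 3))
    · exact mul_nonneg (by norm_num) (div_nonneg (sum_nonneg fun c _ => e4 _) (pow_nonneg (h1 _) 3))
  -- All randomness sits in `R`, which does not depend on the test function. One application of
  -- Markov's inequality therefore covers all `s` at once.
  have hmarkov := mul_meas_ge_le_integral_of_nonneg (μ := sampleLaw f)
    (Filter.Eventually.of_forall hR0) hint (δ / 2)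
  have hexp2 : (8 * 112 ^ 3 * M ^ 2 / (n ^ 2 * δ ^ 3) * 31 : ℝ) ≤ δ / 20 := by
    rw [div_mul_eq_mul_div, div_le_iff₀ (by positivity)]
    have h2 : (10 ^ 5 * M : ℝ) ^ 2 ≤ (n * δ ^ 2) ^ 2 := by gcongr
    nlinarith
  have hbad : (sampleLaw f).real {ω | δ / 2 ≤ R ω} ≤ 1 / 10 := by
    have h1 : δ / 2 * (sampleLaw f).real {ω | δ / 2 ≤ R ω} ≤ δ / 20 :=
      hmarkov.trans (hexp.trans hexp2)
    have h2 : δ / 20 = δ / 2 * (1 / 10) := by ring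
    rw [h2] at h1
    exact le_of_mul_le_mul_left h1 (by positivity)
  -- the deterministic part
  have hdet : ∀ ω, (∀ j, massFn f (ω j) ≠ 0) → R ω < δ / 2 → ∀ s : ℕ → ℝ, (∀ i, |s i| ≤ 1) →
      (jumpSet s N).card ≤ M →
      |∑ i ∈ range N, s i * (empCum ω n (i + 1) - empCum ω n i - extendZero (massFn f) i)|
        ≤ δ := by
    intro ω hω hRω s hs hcard
    have hcum1 : ∀ i ≤ N, cumMass f i ≤ 1 := fun i hi => cumMass_top f ▸ cumMass_mono f hi
    have hA0 : quantileAvg f n ω 0 = 0 := by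
      have h := quantileAvg_cumMass f n ω hω 0
      rw [cumMass_zero] at h
      rw [h]; simp [empCum]
    have hA1 : quantileAvg f n ω 1 = 1 := by
      have h := quantileAvg_cumMass f n ω hω N
      rw [cumMass_top] at h
      rw [h]; simp [empCum, hnpos.ne']
    have h := abs_sum_mul_incr_le_chain N M L hM (cumMass f) s (chainThreshold δ M)
      (quantileAvg f n ω) (quantileDev f n ω) (cumMass_mono f) (cumMass_zero f) (cumMass_top f)
      (quantileAvg_mono f n ω) hA0 hA1 (fun u => rfl) hs hlam hcard
    have e1 : ∑ i ∈ range N, s i * (empCum ω n (i + 1) - empCum ω n i - extendZero (massFn f) i)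
        = ∑ i ∈ range N, s i * (quantileDev f n ω (cumMass f (i + 1))
          - quantileDev f n ω (cumMass f i)) := by
      refine sum_congr rfl fun i hi => ?_
      have hi' := mem_range.1 hi
      unfold quantileDev
      rw [quantileAvg_cumMass f n ω hω, quantileAvg_cumMass f n ω hω,
        min_eq_left (hcum1 _ hi'), min_eq_left (hcum1 _ hi'.le), cumMass_succ]
      ring
    rw [e1]
    refine h.trans ?_
    -- The thresholds cost at most `(1 + 4 · 5 + 4) δ / 112` and the mesh at most `δ / 4`. Together
    -- this is below `δ / 2`, and `R` supplies the other half.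
    have hml : ∀ l, M * chainThreshold δ M l = δ / 112 * (5 / 6) ^ l := by
      intro l; unfold chainThreshold; field_simp
    have hsum : ∑ l ∈ range L, 4 * (M * chainThreshold δ M (l + 1)) ≤ 4 * (δ / 112) * 5 := by
      have h1 := mul_geom_bound (4 * (δ / 112)) (by positivity) (5 / 6) (by norm_num)
        (by norm_num) L
      norm_num at h1
      refine le_trans (le_of_eq (sum_congr rfl fun l _ => ?_)) h1
      rw [hml]; ring
    have hlast : M * chainThreshold δ M L ≤ δ / 112 := by
      rw [hml]
      exact mul_le_of_le_one_right (by positivity) (pow_le_one₀ (by norm_num) (by norm_num))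
    have hmesh : M * mesh M L ≤ δ / 32 := by
      unfold mesh
      have h1 : (M : ℝ) * (1 / (M * 2 ^ L)) = 1 / 2 ^ L := by field_simp
      rw [h1, div_le_iff₀ (by positivity)]
      rw [div_le_iff₀ hδ] at hL1
      linarith
    have h0 := hml 0
    rw [pow_zero, mul_one] at h0
    have hR' : chainSum M L (chainThreshold δ M) (quantileDev f n ω) < δ / 2 := hRω
    linarith
  -- the probability
  have hmeas : MeasurableSet {ω | δ / 2 ≤ R ω}ᶜ := by
    refine (measurableSet_le measurable_const ?_).compl
    simp only [hR, chainSum, cellIncr, refineIncr]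
    have hq := fun u => measurable_quantileDev f n u
    fun_prop
  have hgood : 9 / 10 ≤ (sampleLaw f) {ω | δ / 2 ≤ R ω}ᶜ := by
    have h1 : (sampleLaw f).real {ω | δ / 2 ≤ R ω}ᶜ = 1 - (sampleLaw f).real {ω | δ / 2 ≤ R ω} :=
      probReal_compl_eq_one_sub (compl_compl {ω | δ / 2 ≤ R ω} ▸ hmeas.compl)
    have h2 : (9 / 10 : ℝ) ≤ (sampleLaw f).real {ω | δ / 2 ≤ R ω}ᶜ := by rw [h1]; linarith
    have h3 := ENNReal.ofReal_le_ofReal h2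
    rw [ofReal_measureReal] at h3
    refine le_trans (le_of_eq ?_) h3
    rw [ENNReal.ofReal_div_of_pos (by norm_num)]
    norm_num
  -- Measurability of the event in the statement is not needed: almost everywhere it contains the
  -- measurable event `R < δ / 2`.
  refine hgood.trans (measure_mono_ae ?_)
  filter_upwards [ae_massFn_ne_zero f] with ω hω hRω
  exact hdet ω hω (not_le.1 hRω)

end

end MHRLearning

namespace MHRLearning
open Finset

/-! ### Histogram approximation of MHR distributions -/

/-- Every jump of a non-decreasing integer sequence raises it by at least `1`. -/
theorem card_jumpSet_add_le (a : ℕ → ℕ) (ha : Monotone a) (N : ℕ) :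
    (jumpSet a N).card + a 0 ≤ a N := by
  classical
  induction N with
  | zero => simp [jumpSet]
  | succ N ih =>
    have h1 : a N ≤ a (N + 1) := ha (Nat.le_succ N)
    by_cases h : a N = a (N + 1)
    · have : jumpSet a (N + 1) = jumpSet a N := by
        ext i
        rw [mem_jumpSet, mem_jumpSet]
        constructor
        · rintro ⟨h2, h3⟩
          refine ⟨?_, h3⟩
          rcases Nat.lt_succ_iff_lt_or_eq.1 h2 with h4 | rfl
          · exact h4
          · exact absurd h h3
        · rintro ⟨h2, h3⟩
          exact ⟨by omega, h3⟩
      rw [this]; omega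
    · have : jumpSet a (N + 1) ⊆ insert N (jumpSet a N) := by
        intro i hi
        rw [mem_jumpSet] at hi
        rw [mem_insert, mem_jumpSet]
        rcases Nat.lt_succ_iff_lt_or_eq.1 hi.1 with h4 | rfl
        · exact Or.inr ⟨h4, hi.2⟩
        · exact Or.inl rfl
      have h2 := (card_le_card this).trans (card_insert_le _ _)
      omega

section
variable {N : ℕ} (p : PMF (Fin N))

/-- The mass of the points from the index `i` on. -/
noncomputable def upperMass (i : ℕ) : ℝ := 1 - cumMass p i

theorem upperMass_anti : Antitone (upperMass p) := fun _ _ h =>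
  sub_le_sub_left (cumMass_mono p h) 1

theorem extendZero_massFn_eq_sub (i : ℕ) :
    extendZero (massFn p) i = upperMass p i - upperMass p (i + 1) := by
  unfold upperMass
  rw [cumMass_succ]; ring

theorem upperMass_of_le {i : ℕ} (h : N ≤ i) : upperMass p i = 0 := by
  have h1 : ∀ m, cumMass p (N + m) = 1 := by
    intro m
    induction m with
    | zero => exact cumMass_top p
    | succ m ih => rw [← add_assoc, cumMass_succ, ih, extendZero_of_le _ (by omega), add_zero]
  obtain ⟨m, rfl⟩ := Nat.exists_eq_add_of_le h
  rw [upperMass, h1, sub_self]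

theorem upperMass_nonneg (i : ℕ) : 0 ≤ upperMass p i := by
  rcases le_total N i with h | h
  · rw [upperMass_of_le p h]
  · rw [← upperMass_of_le p le_rfl]; exact upperMass_anti p h

theorem upperMass_le_one (i : ℕ) : upperMass p i ≤ 1 := by
  unfold upperMass; linarith [cumMass_nonneg p i]

theorem tailMass_eq (x : Fin N) : tailMass p x = upperMass p x := by
  have h1 : ∑ j, massFn p j = (∑ j ∈ Iio x, massFn p j) + ∑ j ∈ Ici x, massFn p j := by
    rw [← sum_union]
    · congr 1
      ext j
      simp [lt_or_ge]
    · rw [disjoint_left]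
      intro j hj hj'
      exact absurd (mem_Ici.1 hj') (not_le.2 (mem_Iio.1 hj))
  have h2 : ∑ j ∈ Iio x, massFn p j = cumMass p x := by
    unfold cumMass
    symm
    refine sum_bij' (fun i hi => ⟨i, (mem_range.1 hi).trans x.2⟩) (fun j _ => (j : ℕ)) ?_ ?_ ?_ ?_ ?_
    · intro i hi
      exact mem_Iio.2 (mem_range.1 hi)
    · intro j hj
      have h := mem_Iio.1 hj
      exact mem_range.2 h
    · intro i hi; rfl
    · intro j hj; rfl
    · intro i hi
      exact extendZero_val (massFn p) ⟨i, (mem_range.1 hi).trans x.2⟩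
  rw [sum_massFn, h2] at h1
  unfold tailMass upperMass
  linarith

open scoped Classical in
/-- The hazard rate, continued by `1` where the tail mass vanishes. -/
noncomputable def hazardExt (i : ℕ) : ℝ :=
  if 0 < upperMass p i then extendZero (massFn p) i / upperMass p i else 1

theorem massFn_le_upperMass (i : ℕ) : extendZero (massFn p) i ≤ upperMass p i := by
  rw [extendZero_massFn_eq_sub]; linarith [upperMass_nonneg p (i + 1)]

theorem hazardExt_le_one (i : ℕ) : hazardExt p i ≤ 1 := by
  unfold hazardExt
  split_ifs with h
  · exact div_le_one_of_le₀ (massFn_le_upperMass p i) h.le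
  · exact le_rfl

theorem hazardExt_mul_upperMass (i : ℕ) :
    hazardExt p i * upperMass p i = extendZero (massFn p) i := by
  unfold hazardExt
  split_ifs with h
  · rw [div_mul_cancel₀ _ h.ne']
  · have h1 : upperMass p i = 0 := le_antisymm (not_lt.1 h) (upperMass_nonneg p i)
    have h2 := massFn_le_upperMass p i
    have h3 := extendZero_massFn_nonneg p i
    linarith

/-- The continuation preserves monotonicity because no hazard rate exceeds `1`. -/
theorem hazardExt_mono (hp : IsMHR p) : Monotone (hazardExt p) := by
  intro i j hij
  by_cases hj : 0 < upperMass p j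
  · have hjN : j < N := by
      by_contra h
      rw [upperMass_of_le p (not_lt.1 h)] at hj
      exact lt_irrefl _ hj
    have hi : 0 < upperMass p i := hj.trans_le (upperMass_anti p hij)
    have hiN : i < N := hij.trans_lt hjN
    have h := hp ⟨i, hiN⟩ ⟨j, hjN⟩ hij (by rw [tailMass_eq]; exact hj)
    unfold hazardRate at h
    rw [tailMass_eq, tailMass_eq] at h
    unfold hazardExt
    rw [if_pos hi, if_pos hj]
    simpa [extendZero, hiN, hjN] using h
  · have : hazardExt p j = 1 := if_neg hj
    rw [this]
    exact hazardExt_le_one p i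

end

theorem iff_of_indicator_eq {P Q : Prop} [Decidable P] [Decidable Q]
    (h : (if P then 1 else 0 : ℕ) = if Q then 1 else 0) : P ↔ Q := by
  split_ifs at h with h1 h2 h2
  · exact iff_of_true h1 h2
  · exact iff_of_false h1 h2

/-- Every MHR distribution is close to a histogram with few pieces. -/
theorem exists_histogram_near_mhr {N : ℕ} (hN : 1 ≤ N) (p : PMF (Fin N)) (hp : IsMHR p) {η : ℝ}
    (hη : 0 < η) (hη1 : η ≤ 1) :
    ∃ g : ℕ → ℝ, (∀ i, 0 ≤ g i ∧ g i ≤ 1) ∧ (∀ i, N ≤ i → g i = 0) ∧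
      ((jumpSet g N).card : ℝ) ≤ 2 * (Real.log (N / η) / η) + 2 ∧
      ∑ i ∈ range N, |g i - extendZero (massFn p) i| ≤ 4 * η := by
  classical
  have hN' : (0 : ℝ) < N := by exact_mod_cast hN
  have hN1 : (1 : ℝ) ≤ N := by exact_mod_cast hN
  -- Points of hazard below `m` carry mass at most `N * m = η`, and points of tail mass below `η`
  -- carry at most `η` together, so `g` may vanish there. Elsewhere `log (1 / T)` and `log (H / m)`
  -- range over intervals of length at most `log (N / η)`. These are cut into steps of length `η`,
  -- counted by `a` and `b`; `c` and `d` record the two cut-offs.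
  set m : ℝ := η / N with hm
  have hm0 : 0 < m := div_pos hη hN'
  have hm1 : m ≤ 1 := (div_le_self hη.le hN1).trans hη1
  set T := upperMass p with hT
  set H := hazardExt p with hH
  have hTanti := upperMass_anti p
  have hHmono := hazardExt_mono p hp
  set a : ℕ → ℕ := fun i => ⌊-Real.log (max (T i) η) / η⌋₊ with ha
  set b : ℕ → ℕ := fun i => ⌊Real.log (max (H i) m / m) / η⌋₊ with hb
  set c : ℕ → ℕ := fun i => if T i < η then 1 else 0 with hc
  set d : ℕ → ℕ := fun i => if m ≤ H i then 1 else 0 with hd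
  have hTη : ∀ i, 0 < max (T i) η := fun i => lt_max_of_lt_right hη
  have hHm : ∀ i, 0 < max (H i) m := fun i => lt_max_of_lt_right hm0
  have amono : Monotone a := fun i j hij => Nat.floor_mono <|
    div_le_div_of_nonneg_right (neg_le_neg (Real.log_le_log (hTη j)
      (max_le_max_right _ (hTanti hij)))) hη.le
  have bmono : Monotone b := fun i j hij => Nat.floor_mono <|
    div_le_div_of_nonneg_right (Real.log_le_log (div_pos (hHm i) hm0)
      (div_le_div_of_nonneg_right (max_le_max_right _ (hHmono hij)) hm0.le)) hη.le
  have cmono : Monotone c := by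
    intro i j hij
    simp only [hc]
    split_ifs with h1 h2
    · exact le_rfl
    · exact absurd ((hTanti hij).trans_lt h1) h2
    · exact Nat.zero_le _
    · exact le_rfl
  have dmono : Monotone d := by
    intro i j hij
    simp only [hd]
    split_ifs with h1 h2
    · exact le_rfl
    · exact absurd (h1.trans (hHmono hij)) h2
    · exact Nat.zero_le _
    · exact le_rfl
  have hlog : Real.log (1 / η) ≤ Real.log (N / η) := Real.log_le_log (by positivity)
    (div_le_div_of_nonneg_right hN1 hη.le)
  have hlog0 : 0 ≤ Real.log (1 / η) := Real.log_nonneg (by rw [le_div_iff₀ hη]; linarith)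
  have abound : (a N : ℝ) ≤ Real.log (N / η) / η := by
    have h1 : -Real.log (max (T N) η) ≤ Real.log (1 / η) := by
      rw [one_div, Real.log_inv]
      exact neg_le_neg (Real.log_le_log hη (le_max_right _ _))
    have h2 : 0 ≤ -Real.log (max (T N) η) := by
      rw [neg_nonneg]
      exact Real.log_nonpos (hTη N).le (max_le (upperMass_le_one p N) hη1)
    refine (Nat.floor_le (div_nonneg h2 hη.le)).trans ?_
    exact div_le_div_of_nonneg_right (h1.trans hlog) hη.le
  have bbound : (b N : ℝ) ≤ Real.log (N / η) / η := by
    have h1 : 1 ≤ max (H N) m / m := by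
      rw [le_div_iff₀ hm0, one_mul]; exact le_max_right _ _
    refine (Nat.floor_le (div_nonneg (Real.log_nonneg h1) hη.le)).trans ?_
    refine div_le_div_of_nonneg_right (Real.log_le_log (by positivity) ?_) hη.le
    rw [div_le_iff₀ hm0, hm]
    have h2 : (N : ℝ) / η * (η / N) = 1 := by field_simp
    rw [h2]
    exact max_le (hazardExt_le_one p N) hm1
  have cbound : c N ≤ 1 := by simp only [hc]; split_ifs <;> omega
  have dbound : d N ≤ 1 := by simp only [hd]; split_ifs <;> omega
  -- Both logarithms are rounded down. As `a` comes from `-log T`, rounding `log T` down costs the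
  -- extra `-1` in the exponent.
  set g : ℕ → ℝ := fun i =>
    if η ≤ T i ∧ m ≤ H i then m * Real.exp (((b i : ℝ) - a i - 1) * η) else 0 with hg
  have hmain : ∀ i, η ≤ T i → m ≤ H i →
      g i ≤ H i * T i ∧ H i * T i ≤ g i * Real.exp (2 * η) := by
    intro i h1 h2
    have hT0 : 0 < T i := hη.trans_le h1
    have hH0 : 0 < H i := hm0.trans_le h2
    have hTlog : Real.log (T i) ≤ 0 := Real.log_nonpos hT0.le (upperMass_le_one p i)
    have hHlog : 0 ≤ Real.log (H i / m) := Real.log_nonneg (by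
      rw [le_div_iff₀ hm0, one_mul]; exact h2)
    have a1 : (a i : ℝ) ≤ -Real.log (T i) / η := by
      simp only [ha, max_eq_left h1]
      exact Nat.floor_le (div_nonneg (by linarith) hη.le)
    have a2 : -Real.log (T i) / η < a i + 1 := by
      simp only [ha, max_eq_left h1]
      exact Nat.lt_floor_add_one _
    have b1 : (b i : ℝ) ≤ Real.log (H i / m) / η := by
      simp only [hb, max_eq_left h2]
      exact Nat.floor_le (div_nonneg hHlog hη.le)
    have b2 : Real.log (H i / m) / η < b i + 1 := by
      simp only [hb, max_eq_left h2]
      exact Nat.lt_floor_add_one _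
    rw [le_div_iff₀ hη] at a1 b1
    rw [div_lt_iff₀ hη] at a2 b2
    have hprod : H i * T i = m * Real.exp (Real.log (H i / m) + Real.log (T i)) := by
      rw [Real.exp_add, Real.exp_log (div_pos hH0 hm0), Real.exp_log hT0]
      field_simp
    have hgi : g i = m * Real.exp (((b i : ℝ) - a i - 1) * η) := if_pos ⟨h1, h2⟩
    rw [hprod, hgi, mul_assoc, ← Real.exp_add]
    constructor
    · exact mul_le_mul_of_nonneg_left (Real.exp_le_exp.2 (by linarith)) hm0.le
    · exact mul_le_mul_of_nonneg_left (Real.exp_le_exp.2 (by linarith)) hm0.le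
  have hg0 : ∀ i, 0 ≤ g i := by
    intro i
    simp only [hg]
    split_ifs
    · positivity
    · exact le_rfl
  have hprod1 : ∀ i, H i * T i ≤ 1 := fun i => by
    rw [hazardExt_mul_upperMass p i]
    exact (massFn_le_upperMass p i).trans (upperMass_le_one p i)
  have hH0 : ∀ i, 0 ≤ H i := by
    intro i
    simp only [hH, hazardExt]
    split_ifs with h
    · exact div_nonneg (extendZero_massFn_nonneg p i) h.le
    · exact zero_le_one
  refine ⟨g, fun i => ⟨hg0 i, ?_⟩, ?_, ?_, ?_⟩
  · by_cases h : η ≤ T i ∧ m ≤ H i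
    · exact (hmain i h.1 h.2).1.trans (hprod1 i)
    · have : g i = 0 := if_neg h
      rw [this]; exact zero_le_one
  · intro i hi
    refine if_neg fun h => ?_
    have : T i = 0 := upperMass_of_le p hi
    linarith [h.1]
  -- The value of `g` is determined by `a`, `b`, `c`, `d`. These are all non-decreasing, so their
  -- sum stays constant only if each of them does.
  · have hsub : jumpSet g N ⊆ jumpSet (fun i => a i + b i + c i + d i) N := by
      intro i hi
      rw [mem_jumpSet] at hi ⊢
      refine ⟨hi.1, fun h => hi.2 ?_⟩
      have h1 := amono (Nat.le_succ i)
      have h2 := bmono (Nat.le_succ i)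
      have h3 := cmono (Nat.le_succ i)
      have h4 := dmono (Nat.le_succ i)
      simp only [Nat.succ_eq_add_one] at h1 h2 h3 h4
      have e1 : a i = a (i + 1) := by omega
      have e2 : b i = b (i + 1) := by omega
      have e3 : c i = c (i + 1) := by omega
      have e4 : d i = d (i + 1) := by omega
      have t1 : η ≤ T i ↔ η ≤ T (i + 1) := by
        rw [← not_lt, ← not_lt]
        exact not_congr (iff_of_indicator_eq e3)
      have t2 : m ≤ H i ↔ m ≤ H (i + 1) := iff_of_indicator_eq e4
      simp only [hg, t1, t2, e1, e2]
    have h1 := card_jumpSet_add_le _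
      (((amono.add bmono).add cmono).add dmono) N
    have h2 : (jumpSet g N).card ≤ a N + b N + c N + d N := by
      refine (card_le_card hsub).trans ?_
      exact (Nat.le_add_right _ _).trans h1
    have h3 : ((jumpSet g N).card : ℝ) ≤ a N + b N + c N + d N := by exact_mod_cast h2
    have h4 : (c N : ℝ) ≤ 1 := by exact_mod_cast cbound
    have h5 : (d N : ℝ) ≤ 1 := by exact_mod_cast dbound
    linarith
  -- The three terms pay for the rounding, for the cut-off tail (a telescoping sum), and for the
  -- small hazards. Summed over `i` they give `2 η + η + η`.
  · have hterm : ∀ i, |g i - extendZero (massFn p) i| ≤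
        2 * η * extendZero (massFn p) i + (min (T i) η - min (T (i + 1)) η) + m := by
      intro i
      have hp0 := extendZero_massFn_nonneg p i
      have hpe := hazardExt_mul_upperMass p i
      have hmin : 0 ≤ min (T i) η - min (T (i + 1)) η :=
        sub_nonneg.2 (min_le_min_right _ (hTanti (Nat.le_succ i)))
      have hηp : 0 ≤ 2 * η * extendZero (massFn p) i := by positivity
      by_cases h1 : η ≤ T i
      · by_cases h2 : m ≤ H i
        · obtain ⟨h3, h4⟩ := hmain i h1 h2
          rw [hpe] at h3 h4
          rw [abs_sub_comm, abs_of_nonneg (by linarith)]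
          have h5 : extendZero (massFn p) i * Real.exp (-(2 * η)) ≤ g i := by
            rw [Real.exp_neg, ← div_eq_mul_inv, div_le_iff₀ (Real.exp_pos _)]
            exact h4
          have h6 := Real.add_one_le_exp (-(2 * η))
          have h7 := mul_le_mul_of_nonneg_left h6 hp0
          linarith
        · have h3 : g i = 0 := if_neg fun h => h2 h.2
          rw [h3, zero_sub, abs_neg, abs_of_nonneg hp0]
          have h4 : extendZero (massFn p) i ≤ m := by
            rw [← hpe]
            have h5 : T i ≤ 1 := upperMass_le_one p i
            have h6 : 0 ≤ T i := upperMass_nonneg p i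
            have h7 : 0 ≤ H i * (1 - T i) + (m - H i) :=
              add_nonneg (mul_nonneg (hH0 i) (by linarith)) (by linarith [not_le.1 h2])
            linarith
          linarith
      · have h3 : g i = 0 := if_neg fun h => h1 h.1
        rw [h3, zero_sub, abs_neg, abs_of_nonneg hp0]
        have h4 : T (i + 1) ≤ T i := hTanti (Nat.le_succ i)
        rw [not_le] at h1
        rw [min_eq_left h1.le, min_eq_left (h4.trans h1.le)]
        have h5 : extendZero (massFn p) i = T i - T (i + 1) := extendZero_massFn_eq_sub p i
        linarith
    refine (sum_le_sum fun i _ => hterm i).trans ?_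
    rw [sum_add_distrib, sum_add_distrib, ← mul_sum, sum_range_sub' (fun i => min (T i) η)]
    have h1 : ∑ i ∈ range N, extendZero (massFn p) i = 1 := cumMass_top p
    have h2 : 0 ≤ min (T N) η := le_min (upperMass_nonneg p N) hη.le
    have h3 : min (T 0) η ≤ η := min_le_right _ _
    have h4 : (N : ℝ) * m = η := by rw [hm]; field_simp
    rw [h1, sum_const, card_range, nsmul_eq_mul, h4]
    linarith

/-- Every `k`-mixture of MHR distributions is close to a histogram with few pieces. -/
theorem exists_histogram_near_mixture {N k : ℕ} (hN : 1 ≤ N) {q : PMF (Fin N)}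
    (hq : q ∈ mixtures k {p : PMF (Fin N) | IsMHR p}) {η : ℝ} (hη : 0 < η) (hη1 : η ≤ 1) :
    ∃ g : ℕ → ℝ, (∀ i, 0 ≤ g i ∧ g i ≤ 1) ∧ (∀ i, N ≤ i → g i = 0) ∧
      ((jumpSet g N).card : ℝ) ≤ k * (2 * (Real.log (N / η) / η) + 2) ∧
      ∑ i ∈ range N, |g i - extendZero (massFn q) i| ≤ 4 * η := by
  classical
  obtain ⟨w, p, hp, rfl⟩ := hq
  choose g hg01 hgN hgj hge using fun j => exists_histogram_near_mhr hN (p j) (hp j) hη hη1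
  have hw0 := massFn_nonneg w
  have hw1 := sum_massFn w
  have hmass : ∀ i, extendZero (massFn (w.bind p)) i
      = ∑ j, massFn w j * extendZero (massFn (p j)) i := by
    intro i
    by_cases hi : i < N
    · simp only [extendZero, hi, dif_pos]
      unfold massFn
      rw [PMF.bind_apply, tsum_fintype, ENNReal.toReal_sum]
      · simp
      · intro j _
        exact ENNReal.mul_ne_top (w.apply_ne_top j) ((p j).apply_ne_top _)
    · simp [extendZero, hi]
  refine ⟨fun i => ∑ j, massFn w j * g j i, fun i => ⟨?_, ?_⟩, ?_, ?_, ?_⟩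
  · exact sum_nonneg fun j _ => mul_nonneg (hw0 j) (hg01 j i).1
  · rw [← hw1]
    exact sum_le_sum fun j _ => mul_le_of_le_one_right (hw0 j) (hg01 j i).2
  · intro i hi
    exact sum_eq_zero fun j _ => by rw [hgN j i hi, mul_zero]
  -- A mixture can jump only where a component does, whereas the errors are averaged; only the
  -- number of pieces grows with `k`.
  · have hsub : jumpSet (fun i => ∑ j, massFn w j * g j i) N
        ⊆ univ.biUnion fun j => jumpSet (g j) N := by
      intro i hi
      rw [mem_jumpSet] at hi
      by_contra h
      refine hi.2 (sum_congr rfl fun j _ => ?_)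
      have : g j i = g j (i + 1) := by
        by_contra h2
        exact h (mem_biUnion.2 ⟨j, mem_univ j, mem_jumpSet.2 ⟨hi.1, h2⟩⟩)
      rw [this]
    have h1 : ((jumpSet (fun i => ∑ j, massFn w j * g j i) N).card : ℝ)
        ≤ ∑ j, ((jumpSet (g j) N).card : ℝ) := by
      exact_mod_cast (card_le_card hsub).trans card_biUnion_le
    refine h1.trans ((sum_le_sum fun j _ => hgj j).trans ?_)
    rw [sum_const, card_univ, Fintype.card_fin, nsmul_eq_mul]
  · have h1 : ∀ i, |(∑ j, massFn w j * g j i) - extendZero (massFn (w.bind p)) i|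
        ≤ ∑ j, massFn w j * |g j i - extendZero (massFn (p j)) i| := by
      intro i
      rw [hmass, ← sum_sub_distrib]
      refine (abs_sum_le_sum_abs _ _).trans (le_of_eq (sum_congr rfl fun j _ => ?_))
      rw [← mul_sub, abs_mul, abs_of_nonneg (hw0 j)]
    refine (sum_le_sum fun i _ => h1 i).trans ?_
    rw [sum_comm]
    simp_rw [← mul_sum]
    refine (sum_le_sum fun j _ => mul_le_mul_of_nonneg_left (hge j) (hw0 j)).trans ?_
    rw [← sum_mul, hw1, one_mul]

end MHRLearning

namespace MHRLearning
open Finset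

/-! ### Fitting a histogram to the empirical distribution in one scan -/

/-- The state of the scan. The current piece starts after the position `base`, and
`lo ≤ c ≤ hi` describes the values `c` that fit the samples between `base` and `last`;
`baseCount` and `lastCount` are the numbers of samples up to these positions. -/
structure Scan where
  base : ℕ
  baseCount : ℕ
  last : ℕ
  lastCount : ℕ
  lo : ℝ
  hi : ℝ
  breaks : ℕ
  out : List (ℕ × ℝ)

namespace Scan

/-- The state at the beginning. -/
noncomputable def init : Scan := ⟨0, 0, 0, 0, 0, 1, 0, []⟩

/-- The updated lower bound when `j` samples lie at or below `x`. -/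
noncomputable def newLo (σ : Scan) (n : ℕ) (τ : ℝ) (x j : ℕ) : ℝ :=
  max σ.lo ((((j - σ.baseCount : ℕ) : ℝ) / n - τ) / (x - σ.base : ℕ))

/-- The updated upper bound when `j` samples lie at or below `x`. -/
noncomputable def newHi (σ : Scan) (n : ℕ) (τ : ℝ) (x j : ℕ) : ℝ :=
  -- No sample lies strictly between `last` and `x`, so the cumulative frequency is flat up to `x -
  -- 1`. There the upper constraint is tightest at `x - 1`; it is void if `x - 1` does not lie
  -- beyond `base`.
  if x ≤ σ.base + 1 then min σ.hi ((((j - σ.baseCount : ℕ) : ℝ) / n + τ) / (x - σ.base : ℕ))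
  else min (min σ.hi ((((j - σ.baseCount : ℕ) : ℝ) / n + τ) / (x - σ.base : ℕ)))
    ((((σ.lastCount - σ.baseCount : ℕ) : ℝ) / n + τ) / (x - (σ.base + 1) : ℕ))

open scoped Classical in
/-- Process the position `x`, with `j` samples at or below it. -/
noncomputable def step (σ : Scan) (n : ℕ) (τ : ℝ) (x j : ℕ) : Scan :=
  if σ.newLo n τ x j ≤ σ.newHi n τ x j then
    { σ with last := x, lastCount := j, lo := σ.newLo n τ x j, hi := σ.newHi n τ x j }
  else
    -- The closed piece ends at `last`, and the empty gap up to `x - 1` receives the value `0`. The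
    -- new piece holds the single position `x`, which a constant always fits.
    { base := x - 1, baseCount := σ.lastCount, last := x, lastCount := j,
      lo := max 0 (((j - σ.lastCount : ℕ) : ℝ) / n - τ),
      hi := min 1 (((j - σ.lastCount : ℕ) : ℝ) / n + τ),
      breaks := σ.breaks + 1, out := σ.out ++ [(σ.last, σ.lo)] ++ [(x - 1, 0)] }

end Scan

/-- The state after `j` of the sorted samples `S 0, …, S (n - 1)` have been scanned. -/
noncomputable def scan (S : ℕ → ℕ) (n : ℕ) (τ : ℝ) : ℕ → Scan
  | 0 => Scan.init
  -- A position is processed only at its last sample. The entry `S n`, later assumed to be `0`, is a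
  -- sentinel that makes the last position count as finished.
  | j + 1 => if S j = S (j + 1) then scan S n τ j else (scan S n τ j).step n τ (S j) (j + 1)

/-- The number of samples at positions up to `y`. -/
def sampleCount (S : ℕ → ℕ) (n y : ℕ) : ℕ := ((range n).filter fun i => S i ≤ y).card

/-- The fraction of samples at positions up to `y`. -/
noncomputable def sampleFrac (S : ℕ → ℕ) (n y : ℕ) : ℝ := (sampleCount S n y : ℝ) / n

/-- The value at the position `i + 1` of the histogram described by a list of pairs. -/
noncomputable def histVal (l : List (ℕ × ℝ)) (i : ℕ) : ℝ :=
  ((l.find? fun q => decide (i + 1 ≤ q.1)).map Prod.snd).getD 0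

/-- The constant `c` fits a sequence `V` of cumulative frequencies between `a` and `b`. -/
def Fits (V : ℕ → ℝ) (τ : ℝ) (a b : ℕ) (c : ℝ) : Prop :=
  0 ≤ c ∧ c ≤ 1 ∧ ∀ y, a < y → y ≤ b → |V y - V a - c * ((y : ℝ) - a)| ≤ τ

theorem sampleCount_eq {S : ℕ → ℕ} {n m y : ℕ} (hm : m ≤ n) (h1 : ∀ i < m, S i ≤ y)
    (h2 : ∀ i, m ≤ i → i < n → y < S i) : sampleCount S n y = m := by
  unfold sampleCount
  have : (range n).filter (fun i => S i ≤ y) = range m := by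
    ext i
    rw [mem_filter, mem_range, mem_range]
    constructor
    · rintro ⟨h3, h4⟩
      by_contra h
      exact absurd (h2 i (not_lt.1 h) h3) (not_lt.2 h4)
    · intro h
      exact ⟨h.trans_le hm, h1 i h⟩
  rw [this, card_range]

theorem sampleCount_mono (S : ℕ → ℕ) (n : ℕ) : Monotone (sampleCount S n) := fun _ _ h =>
  card_le_card fun i hi => by
    rw [mem_filter] at hi ⊢
    exact ⟨hi.1, hi.2.trans h⟩

theorem sampleFrac_mono (S : ℕ → ℕ) (n : ℕ) : Monotone (sampleFrac S n) := fun _ _ h =>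
  div_le_div_of_nonneg_right (by exact_mod_cast sampleCount_mono S n h) (Nat.cast_nonneg n)

theorem sampleFrac_nonneg (S : ℕ → ℕ) (n y : ℕ) : 0 ≤ sampleFrac S n y :=
  div_nonneg (Nat.cast_nonneg _) (Nat.cast_nonneg _)

theorem sampleFrac_le_one (S : ℕ → ℕ) (n y : ℕ) : sampleFrac S n y ≤ 1 := by
  refine div_le_one_of_le₀ ?_ (Nat.cast_nonneg _)
  have := card_filter_le (range n) fun i => S i ≤ y
  rw [card_range] at this
  exact_mod_cast this

/-- The part of the scan invariant that concerns positions and counts. -/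
structure ScanCounts (S : ℕ → ℕ) (n j : ℕ) (σ : Scan) : Prop where
  lastCount_le : σ.lastCount ≤ j
  le_last : ∀ i < σ.lastCount, S i ≤ σ.last
  last_lt : ∀ i, σ.lastCount ≤ i → i < n → σ.last < S i
  pending : ∀ i, σ.lastCount ≤ i → i ≤ j → j < n → S i = S j
  complete : j = n → σ.lastCount = n
  base_le : σ.base ≤ σ.last
  baseCount_eq : sampleCount S n σ.base = σ.baseCount

section
variable {S : ℕ → ℕ} {n N : ℕ} {τ : ℝ}

/-- The samples read but not yet counted all lie at `S j`, so the open interval between `last` and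
`S j` contains no sample. -/
theorem ScanCounts.count_eq {j : ℕ} {σ : Scan} (h : ScanCounts S n j σ) (hj : j < n)
    (hS : ∀ i i', i ≤ i' → i' < n → S i ≤ S i') {y : ℕ} (h1 : σ.last ≤ y) (h2 : y < S j) :
    sampleCount S n y = σ.lastCount := by
  refine sampleCount_eq (h.lastCount_le.trans hj.le) (fun i hi => (h.le_last i hi).trans h1) ?_
  intro i hi hin
  rcases le_total i j with hij | hij
  · rw [h.pending i hi hij hj]; exact h2
  · exact h2.trans_le (hS j i hij hin)

theorem ScanCounts.skip {j : ℕ} {σ : Scan} (h : ScanCounts S n j σ) (hjn : j + 1 < n)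
    (he : S j = S (j + 1)) : ScanCounts S n (j + 1) σ where
  lastCount_le := h.lastCount_le.trans (Nat.le_succ j)
  le_last := h.le_last
  last_lt := h.last_lt
  pending := by
    intro i h1 h2 _
    rcases Nat.le_succ_iff.1 h2 with h3 | h3
    · rw [h.pending i h1 h3 (by omega), he]
    · rw [h3]
  complete := fun h1 => absurd h1 hjn.ne
  base_le := h.base_le
  baseCount_eq := h.baseCount_eq

theorem ScanCounts.step {j : ℕ} {σ : Scan} (h : ScanCounts S n j σ) (hj : j < n)
    (hS : ∀ i i', i ≤ i' → i' < n → S i ≤ S i') (he : S j ≠ S (j + 1)) (τ : ℝ) :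
    ScanCounts S n (j + 1) (σ.step n τ (S j) (j + 1)) := by
  have hlast : σ.last < S j := h.last_lt j h.lastCount_le hj
  have e1 : (σ.step n τ (S j) (j + 1)).last = S j := by unfold Scan.step; split_ifs <;> rfl
  have e2 : (σ.step n τ (S j) (j + 1)).lastCount = j + 1 := by unfold Scan.step; split_ifs <;> rfl
  constructor
  · rw [e2]
  · rw [e1, e2]
    exact fun i hi => hS i j (by omega) hj
  · rw [e1, e2]
    intro i h1 h2
    have h3 : S j ≤ S (j + 1) := hS j (j + 1) (Nat.le_succ j) (by omega)
    exact (lt_of_le_of_ne h3 he).trans_le (hS (j + 1) i h1 h2)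
  · rw [e2]
    intro i h1 h2 _
    rw [le_antisymm h2 h1]
  · rw [e2]; exact id
  · rw [e1]
    unfold Scan.step
    split_ifs
    · exact h.base_le.trans hlast.le
    · exact Nat.sub_le _ _
  · unfold Scan.step
    split_ifs
    · exact h.baseCount_eq
    · exact h.count_eq hj hS (by simp only; omega) (by simp only; omega)

/-- The values between the updated bounds are those that fit up to the new position. -/
theorem newLo_le_and_le_newHi_iff {j : ℕ} {σ : Scan} (h : ScanCounts S n j σ) (hj : j < n)
    (hS : ∀ i i', i ≤ i' → i' < n → S i ≤ S i') (he : S j ≠ S (j + 1)) (hτ : 0 ≤ τ)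
    (hfit : ∀ c, (σ.lo ≤ c ∧ c ≤ σ.hi) ↔ Fits (sampleFrac S n) τ σ.base σ.last c) (c : ℝ) :
    (σ.newLo n τ (S j) (j + 1) ≤ c ∧ c ≤ σ.newHi n τ (S j) (j + 1)) ↔
      Fits (sampleFrac S n) τ σ.base (S j) c := by
  set x := S j with hx
  have hlast : σ.last < x := h.last_lt j h.lastCount_le hj
  have hbase := h.base_le
  have hn : (0 : ℝ) < n := by exact_mod_cast (Nat.zero_le j).trans_lt hj
  have hcx : sampleCount S n x = j + 1 := by
    refine sampleCount_eq hj (fun i hi => hS i j (by omega) hj) fun i h1 h2 => ?_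
    have h3 : S j ≤ S (j + 1) := hS j (j + 1) (Nat.le_succ j) (by omega)
    exact (lt_of_le_of_ne h3 he).trans_le (hS (j + 1) i h1 h2)
  have hcy : ∀ y, σ.last ≤ y → y < x → sampleCount S n y = σ.lastCount := fun y h1 h2 =>
    h.count_eq hj hS h1 h2
  have hcb := h.baseCount_eq
  have hble : σ.baseCount ≤ σ.lastCount := by
    rw [← hcb, ← hcy σ.last le_rfl hlast]; exact sampleCount_mono S n hbase
  have hblx : σ.baseCount ≤ j + 1 := hble.trans (h.lastCount_le.trans (Nat.le_succ j))
  have hVx : sampleFrac S n x - sampleFrac S n σ.base = ((j + 1 - σ.baseCount : ℕ) : ℝ) / n := by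
    unfold sampleFrac
    rw [hcx, hcb, Nat.cast_sub hblx, sub_div]
  have hVy : ∀ y, σ.last ≤ y → y < x →
      sampleFrac S n y - sampleFrac S n σ.base = ((σ.lastCount - σ.baseCount : ℕ) : ℝ) / n := by
    intro y h1 h2
    unfold sampleFrac
    rw [hcy y h1 h2, hcb, Nat.cast_sub hble, sub_div]
  have hxb : ((x - σ.base : ℕ) : ℝ) = (x : ℝ) - σ.base := Nat.cast_sub (by omega)
  have hxb0 : (0 : ℝ) < (x - σ.base : ℕ) := by exact_mod_cast (by omega : 0 < x - σ.base)
  have hhi : c ≤ σ.newHi n τ x (j + 1) ↔ (c ≤ σ.hi ∧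
      c * ((x : ℝ) - σ.base) ≤ ((j + 1 - σ.baseCount : ℕ) : ℝ) / n + τ) ∧
      (σ.base + 1 < x → c * (((x - 1 : ℕ) : ℝ) - σ.base)
        ≤ ((σ.lastCount - σ.baseCount : ℕ) : ℝ) / n + τ) := by
    unfold Scan.newHi
    split_ifs with h1
    · rw [le_min_iff, le_div_iff₀ hxb0, hxb]
      exact ⟨fun h2 => ⟨h2, fun h3 => by omega⟩, fun h2 => h2.1⟩
    · have h2 : ((x - (σ.base + 1) : ℕ) : ℝ) = ((x - 1 : ℕ) : ℝ) - σ.base := by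
        rw [← Nat.cast_sub (by omega)]
        congr 1
        omega
      have h3 : (0 : ℝ) < (x - (σ.base + 1) : ℕ) := by
        exact_mod_cast (by omega : 0 < x - (σ.base + 1))
      rw [le_min_iff, le_min_iff, le_div_iff₀ hxb0, le_div_iff₀ h3, hxb, h2]
      exact ⟨fun h4 => ⟨h4.1, fun _ => h4.2⟩, fun h4 => ⟨h4.1, h4.2 (by omega)⟩⟩
  have hlo : σ.newLo n τ x (j + 1) ≤ c ↔ σ.lo ≤ c ∧
      ((j + 1 - σ.baseCount : ℕ) : ℝ) / n - τ ≤ c * ((x : ℝ) - σ.base) := by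
    unfold Scan.newLo
    rw [max_le_iff, div_le_iff₀ hxb0, hxb]
  rw [hhi, hlo]
  constructor
  · rintro ⟨⟨l1, l2⟩, ⟨u1, u2⟩, u3⟩
    have hf := (hfit c).1 ⟨l1, u1⟩
    refine ⟨hf.1, hf.2.1, fun y hy1 hy2 => ?_⟩
    rcases le_or_gt y σ.last with h1 | h1
    · exact hf.2.2 y hy1 h1
    rcases Nat.lt_or_ge y x with h2 | h2
    · rw [hVy y h1.le h2, abs_le]
      have h3 := u3 (by omega)
      have h4 : (y : ℝ) ≤ ((x - 1 : ℕ) : ℝ) := by exact_mod_cast (by omega : y ≤ x - 1)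
      have h5 : c * ((y : ℝ) - σ.base) ≤ c * (((x - 1 : ℕ) : ℝ) - σ.base) :=
        mul_le_mul_of_nonneg_left (by linarith) hf.1
      refine ⟨by linarith, ?_⟩
      -- On the flat stretch the lower constraint on `c` is tightest at `last`, where it is already
      -- known. If `last = base` it reads `0 ≤ τ`.
      have h6 : c * ((σ.last : ℝ) - σ.base) ≤ c * ((y : ℝ) - σ.base) :=
        mul_le_mul_of_nonneg_left (by
          have : (σ.last : ℝ) ≤ y := by exact_mod_cast h1.le
          linarith) hf.1
      have h7 : ((σ.lastCount - σ.baseCount : ℕ) : ℝ) / n - c * ((σ.last : ℝ) - σ.base) ≤ τ := by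
        rw [← hVy σ.last le_rfl hlast]
        rcases Nat.eq_or_lt_of_le hbase with h8 | h8
        · rw [h8]; simpa using hτ
        · exact (abs_le.1 (hf.2.2 σ.last h8 le_rfl)).2
      linarith
    · have h3 : y = x := le_antisymm hy2 h2
      rw [h3, hVx, abs_le]
      constructor <;> linarith
  · rintro ⟨f1, f2, f3⟩
    have hf := (hfit c).2 ⟨f1, f2, fun y h1 h2 => f3 y h1 (h2.trans hlast.le)⟩
    have hx1 := f3 x (by omega) le_rfl
    rw [hVx, abs_le] at hx1
    refine ⟨⟨hf.1, by linarith [hx1.2]⟩, ⟨hf.2, by linarith [hx1.1]⟩, fun h1 => ?_⟩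
    have hx2 := f3 (x - 1) (by omega) (by omega)
    rw [hVy (x - 1) (by omega) (by omega), abs_le] at hx2
    linarith [hx2.1]

/-- The bounds kept by the scan describe the values that fit the current piece. -/
def ScanFits (S : ℕ → ℕ) (n : ℕ) (τ : ℝ) (σ : Scan) : Prop :=
  σ.lo ≤ σ.hi ∧ ∀ c, (σ.lo ≤ c ∧ c ≤ σ.hi) ↔ Fits (sampleFrac S n) τ σ.base σ.last c

theorem ScanFits.init : ScanFits S n τ Scan.init := by
  refine ⟨zero_le_one, fun c => ?_⟩
  simp only [Scan.init, Fits]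
  exact ⟨fun h => ⟨h.1, h.2, fun y h1 h2 => absurd h1 (by omega)⟩, fun h => ⟨h.1, h.2.1⟩⟩

theorem ScanFits.step {j : ℕ} {σ : Scan} (h : ScanCounts S n j σ) (hj : j < n)
    (hS : ∀ i i', i ≤ i' → i' < n → S i ≤ S i') (he : S j ≠ S (j + 1)) (hτ : 0 ≤ τ)
    (hfit : ScanFits S n τ σ) : ScanFits S n τ (σ.step n τ (S j) (j + 1)) := by
  have key := newLo_le_and_le_newHi_iff h hj hS he hτ hfit.2
  have hlast : σ.last < S j := h.last_lt j h.lastCount_le hj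
  have hn : (0 : ℝ) < n := by exact_mod_cast (Nat.zero_le j).trans_lt hj
  unfold Scan.step
  split_ifs with h1
  · exact ⟨h1, key⟩
  · have hjl : σ.lastCount ≤ j + 1 := h.lastCount_le.trans (Nat.le_succ j)
    have hq0 : (0 : ℝ) ≤ ((j + 1 - σ.lastCount : ℕ) : ℝ) / n := by positivity
    have hq1 : ((j + 1 - σ.lastCount : ℕ) : ℝ) / n ≤ 1 := by
      rw [div_le_one hn]; exact_mod_cast (by omega : j + 1 - σ.lastCount ≤ n)
    refine ⟨?_, fun c => ?_⟩
    · simp only [max_le_iff, le_min_iff]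
      exact ⟨⟨zero_le_one, by linarith⟩, by linarith, by linarith⟩
    have hcx : sampleCount S n (S j) = j + 1 := by
      have h2 := h.step hj hS he τ
      have e1 : (σ.step n τ (S j) (j + 1)).last = S j := by unfold Scan.step; split_ifs; rfl
      have e2 : (σ.step n τ (S j) (j + 1)).lastCount = j + 1 := by
        unfold Scan.step; split_ifs; rfl
      refine sampleCount_eq hj (fun i hi => hS i j (by omega) hj) fun i h3 h4 => ?_
      have := h2.last_lt i (by rw [e2]; exact h3) h4
      rwa [e1] at this
    have hcy := h.count_eq hj hS (y := S j - 1) (by omega) (by omega)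
    have hV : sampleFrac S n (S j) - sampleFrac S n (S j - 1)
        = ((j + 1 - σ.lastCount : ℕ) : ℝ) / n := by
      unfold sampleFrac
      rw [hcx, hcy, Nat.cast_sub hjl, sub_div]
    have hpos : (S j : ℝ) - (S j - 1 : ℕ) = 1 := by
      rw [Nat.cast_sub (by omega)]; push_cast; ring
    simp only [Fits, max_le_iff, le_min_iff]
    constructor
    · rintro ⟨⟨c0, c1⟩, c2, c3⟩
      refine ⟨c0, c2, fun y y1 y2 => ?_⟩
      have : y = S j := by omega
      rw [this, hV, hpos, abs_le]
      constructor <;> linarith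
    · rintro ⟨c0, c1, c2⟩
      have := c2 (S j) (by omega) le_rfl
      rw [hV, hpos, abs_le] at this
      exact ⟨⟨c0, by linarith [this.2]⟩, c1, by linarith [this.1]⟩

theorem ScanCounts.init (hS1 : ∀ i < n, 1 ≤ S i) : ScanCounts S n 0 Scan.init where
  lastCount_le := le_rfl
  le_last := fun i hi => absurd hi (Nat.not_lt_zero i)
  last_lt := fun i _ hi => hS1 i hi
  pending := fun i _ hi _ => by rw [Nat.le_zero.1 hi]
  complete := fun h => h
  base_le := le_rfl
  baseCount_eq := sampleCount_eq (Nat.zero_le n) (fun i hi => absurd hi (Nat.not_lt_zero i))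
    fun i _ hi => hS1 i hi

/-- Induction along the scan. -/
theorem scan_induction (P : Scan → Prop)
    (h0 : P Scan.init)
    (hstep : ∀ j < n, S j ≠ S (j + 1) → P (scan S n τ j) →
      P ((scan S n τ j).step n τ (S j) (j + 1))) :
    ∀ j ≤ n, P (scan S n τ j) := by
  intro j
  induction j with
  | zero => intro _; exact h0
  | succ j ih =>
    intro hj
    rw [scan]
    split_ifs with h
    · exact ih (by omega)
    · exact hstep j hj h (ih (by omega))

theorem scanCounts_scan (hS1 : ∀ i < n, 1 ≤ S i) (hS0 : S n = 0)
    (hS : ∀ i i', i ≤ i' → i' < n → S i ≤ S i') : ∀ j ≤ n, ScanCounts S n j (scan S n τ j) := by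
  intro j
  induction j with
  | zero => intro _; exact ScanCounts.init hS1
  | succ j ih =>
    intro hj
    rw [scan]
    split_ifs with h
    · refine (ih (by omega)).skip (lt_of_le_of_ne hj fun h1 => ?_) h
      have := hS1 j hj
      rw [h, h1, hS0] at this
      omega
    · exact (ih (by omega)).step hj hS h τ

theorem scanFits_scan (hS1 : ∀ i < n, 1 ≤ S i) (hS0 : S n = 0)
    (hS : ∀ i i', i ≤ i' → i' < n → S i ≤ S i') (hτ : 0 ≤ τ) :
    ∀ j ≤ n, ScanFits S n τ (scan S n τ j) :=
  scan_induction _ ScanFits.init fun j hj he h =>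
    ScanFits.step (scanCounts_scan hS1 hS0 hS j hj.le) hj hS he hτ h

end

end MHRLearning

namespace MHRLearning
open Finset

/-! ### Quality of the fitted histogram -/

/-- The list `l` describes values at exactly the first `b` positions. -/
def Covers (l : List (ℕ × ℝ)) (b : ℕ) : Prop := ∀ i, (∃ q ∈ l, i + 1 ≤ q.1) ↔ i < b

theorem Covers.append {l : List (ℕ × ℝ)} {b b' : ℕ} (h : Covers l b) (hb : b ≤ b') (c : ℝ) :
    Covers (l ++ [(b', c)]) b' := by
  intro i
  constructor
  · rintro ⟨q, hq, hi⟩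
    rcases List.mem_append.1 hq with h1 | h1
    · exact ((h i).1 ⟨q, h1, hi⟩).trans_le hb
    · rw [List.mem_singleton.1 h1] at hi; exact hi
  · intro hi
    exact ⟨(b', c), by simp, hi⟩

theorem histVal_append {l : List (ℕ × ℝ)} {b : ℕ} (h : Covers l b) (b' : ℕ) (c : ℝ) (i : ℕ) :
    histVal (l ++ [(b', c)]) i = if i < b then histVal l i else if i < b' then c else 0 := by
  unfold histVal
  rw [List.find?_append]
  split_ifs with h1 h2
  · obtain ⟨q, hq, hi⟩ := (h i).2 h1
    have : (l.find? fun q => decide (i + 1 ≤ q.1)).isSome :=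
      List.find?_isSome.2 ⟨q, hq, by simpa using hi⟩
    rw [Option.or_of_isSome this]
  · have : l.find? (fun q => decide (i + 1 ≤ q.1)) = none := by
      rw [List.find?_eq_none]
      intro q hq hi
      exact h1 ((h i).1 ⟨q, hq, by simpa using hi⟩)
    rw [this, Option.none_or, List.find?_singleton, if_pos (by simpa using h2)]
    rfl
  · have : l.find? (fun q => decide (i + 1 ≤ q.1)) = none := by
      rw [List.find?_eq_none]
      intro q hq hi
      exact h1 ((h i).1 ⟨q, hq, by simpa using hi⟩)
    rw [this, Option.none_or, List.find?_singleton, if_neg (by simpa using h2)]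
    rfl

/-- A histogram has at most as many jumps as there are pairs. -/
theorem card_jumpSet_histVal_le (l : List (ℕ × ℝ)) (N : ℕ) :
    (jumpSet (histVal l) N).card ≤ l.length := by
  classical
  -- Unless some pair ends exactly at `i + 1`, the positions `i + 1` and `i + 2` select the same
  -- pair. The list need not be ordered for this.
  have hsub : (jumpSet (histVal l) N).image (fun i => i + 1) ⊆ (l.map Prod.fst).toFinset := by
    intro y hy
    obtain ⟨i, hi, rfl⟩ := mem_image.1 hy
    rw [List.mem_toFinset]
    by_contra hnot
    refine (mem_jumpSet.1 hi).2 ?_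
    unfold histVal
    have : ∀ q ∈ l, decide (i + 1 ≤ q.1) = decide (i + 1 + 1 ≤ q.1) := by
      intro q hq
      have hne : q.1 ≠ i + 1 := fun h => hnot (List.mem_map.2 ⟨q, hq, h⟩)
      rw [decide_eq_decide]
      omega
    have h2 : ∀ l' : List (ℕ × ℝ), (∀ q ∈ l', decide (i + 1 ≤ q.1) = decide (i + 1 + 1 ≤ q.1)) →
        l'.find? (fun q => decide (i + 1 ≤ q.1)) = l'.find? (fun q => decide (i + 1 + 1 ≤ q.1)) := by
      intro l'
      induction l' with
      | nil => intro _; rfl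
      | cons q t ih =>
        intro h
        rw [List.find?_cons, List.find?_cons, h q (by simp), ih fun q' hq' => h q' (by simp [hq'])]
    rw [h2 l this]
  calc (jumpSet (histVal l) N).card
      = ((jumpSet (histVal l) N).image fun i => i + 1).card :=
        (card_image_of_injective _ (add_left_injective 1)).symm
    _ ≤ (l.map Prod.fst).toFinset.card := card_le_card hsub
    _ ≤ (l.map Prod.fst).length := List.toFinset_card_le _
    _ = l.length := by simp

-- Summation by parts without monotonicity: the centred `W` is bounded by `τ`, so the boundary term
-- costs `τ` and each jump of `s`, of size at most `2`, costs `2 τ`.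
open scoped Classical in
theorem abs_sum_Ico_mul_incr_le (s W : ℕ → ℝ) (τ : ℝ) (a b : ℕ) (hab : a ≤ b)
    (hs : ∀ i, |s i| ≤ 1) (hW : ∀ y, a < y → y ≤ b → |W y - W a| ≤ τ) (hτ : 0 ≤ τ) :
    |∑ i ∈ Ico a b, s i * (W (i + 1) - W i)| ≤
      τ * (1 + 2 * ((Ico a b).filter fun i => s i ≠ s (i + 1)).card) := by
  have key : ∀ b', a ≤ b' → b' ≤ b →
      |∑ i ∈ Ico a b', s i * (W (i + 1) - W i) - s b' * (W b' - W a)| ≤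
        2 * τ * ((Ico a b').filter fun i => s i ≠ s (i + 1)).card := by
    intro b' hb'
    induction b', hb' using Nat.le_induction with
    | base => intro _; simp
    | succ m hm ih =>
      intro hmb
      have h1 := ih (by omega)
      rw [sum_Ico_succ_top hm]
      have e1 : ∑ i ∈ Ico a m, s i * (W (i + 1) - W i) + s m * (W (m + 1) - W m)
          - s (m + 1) * (W (m + 1) - W a)
          = (∑ i ∈ Ico a m, s i * (W (i + 1) - W i) - s m * (W m - W a))
            + (s m - s (m + 1)) * (W (m + 1) - W a) := by ring
      rw [e1]
      refine (abs_add_le _ _).trans ?_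
      have e2 : Ico a (m + 1) = insert m (Ico a m) := by
        ext i
        simp only [mem_insert, mem_Ico]
        omega
      rw [e2, filter_insert]
      split_ifs with h2
      · rw [card_insert_of_notMem (by simp)]
        have h3 : |(s m - s (m + 1)) * (W (m + 1) - W a)| ≤ 2 * τ := by
          rw [abs_mul]
          have h4 : |s m - s (m + 1)| ≤ 2 := by
            have := abs_sub (s m) (s (m + 1))
            linarith [hs m, hs (m + 1)]
          exact mul_le_mul h4 (hW _ (by omega) hmb) (abs_nonneg _) (by norm_num)
        push_cast
        linarith
      · rw [not_not] at h2
        rw [h2, sub_self, zero_mul, abs_zero, add_zero]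
        rw [h2] at h1
        exact h1
  have h1 := key b hab le_rfl
  have h2 : |s b * (W b - W a)| ≤ τ := by
    rcases Nat.eq_or_lt_of_le hab with h3 | h3
    · rw [h3, sub_self, mul_zero, abs_zero]; exact hτ
    · rw [abs_mul]
      exact (mul_le_of_le_one_left (abs_nonneg _) (hs b)).trans (hW b h3 le_rfl)
  have h3 := abs_le.1 h1
  have h4 := abs_le.1 h2
  rw [abs_le]
  constructor <;> linarith

/-- The histogram described by `l` agrees with `V` on the first `b` positions up to an error `τ` for
each pair and each jump of the test function. -/
def FitQuality (V : ℕ → ℝ) (τ : ℝ) (l : List (ℕ × ℝ)) (b : ℕ) : Prop :=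
  Covers l b ∧ ∀ s : ℕ → ℝ, (∀ i, |s i| ≤ 1) →
    |∑ i ∈ range b, s i * (V (i + 1) - V i - histVal l i)| ≤
      τ * (l.length + 2 * (jumpSet s b).card)

/-- On the new piece the summands are increments of `V i - c * i`, which stays within `τ` of its
value at `b`. The jumps of `s` before and after `b` are counted separately, so the costs add up. -/
theorem FitQuality.append {V : ℕ → ℝ} {τ c : ℝ} {l : List (ℕ × ℝ)} {b b' : ℕ} (hτ : 0 ≤ τ)
    (h : FitQuality V τ l b) (hb : b ≤ b')
    (hc : ∀ y, b < y → y ≤ b' → |V y - V b - c * ((y : ℝ) - b)| ≤ τ) :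
    FitQuality V τ (l ++ [(b', c)]) b' := by
  classical
  refine ⟨h.1.append hb c, fun s hs => ?_⟩
  have e1 : ∑ i ∈ range b', s i * (V (i + 1) - V i - histVal (l ++ [(b', c)]) i)
      = ∑ i ∈ range b, s i * (V (i + 1) - V i - histVal l i)
        + ∑ i ∈ Ico b b', s i * ((V (i + 1) - c * (i + 1 : ℕ)) - (V i - c * i)) := by
    rw [← sum_range_add_sum_Ico _ hb]
    congr 1
    · refine sum_congr rfl fun i hi => ?_
      rw [histVal_append h.1, if_pos (mem_range.1 hi)]
    · refine sum_congr rfl fun i hi => ?_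
      have hi' := mem_Ico.1 hi
      rw [histVal_append h.1, if_neg (not_lt.2 hi'.1), if_pos hi'.2]
      push_cast
      ring
  have h1 := h.2 s hs
  have h2 := abs_sum_Ico_mul_incr_le s (fun i => V i - c * i) τ b b' hb hs (by
    intro y h3 h4
    have := hc y h3 h4
    have e : V y - c * y - (V b - c * b) = V y - V b - c * ((y : ℝ) - b) := by ring
    rwa [e]) hτ
  have h3 : (jumpSet s b).card + ((Ico b b').filter fun i => s i ≠ s (i + 1)).card
      ≤ (jumpSet s b').card := by
    rw [← card_union_of_disjoint]
    · refine card_le_card fun i hi => ?_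
      rw [mem_union, mem_filter, mem_Ico, mem_jumpSet] at hi
      rw [mem_jumpSet]
      rcases hi with h3 | h3
      · exact ⟨h3.1.trans_le hb, h3.2⟩
      · exact ⟨h3.1.2, h3.2⟩
    · rw [disjoint_left]
      intro i h3 h4
      rw [mem_filter, mem_Ico] at h4
      have := (mem_jumpSet.1 h3).1
      omega
  have h3' : ((jumpSet s b).card : ℝ) + ((Ico b b').filter fun i => s i ≠ s (i + 1)).card
      ≤ (jumpSet s b').card := by exact_mod_cast h3
  rw [e1]
  refine (abs_add_le _ _).trans ((add_le_add h1 h2).trans ?_)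
  rw [← mul_add, List.length_append]
  refine mul_le_mul_of_nonneg_left ?_ hτ
  push_cast
  simp only [List.length_cons, List.length_nil]
  push_cast
  linarith

section
variable {S : ℕ → ℕ} {n N : ℕ} {τ : ℝ}

theorem ScanFits.append {σ : Scan} {j : ℕ} (hc : ScanCounts S n j σ) (hf : ScanFits S n τ σ)
    (hτ : 0 ≤ τ) (hq : FitQuality (sampleFrac S n) τ σ.out σ.base) :
    FitQuality (sampleFrac S n) τ (σ.out ++ [(σ.last, σ.lo)]) σ.last :=
  hq.append hτ hc.base_le ((hf.2 σ.lo).1 ⟨le_rfl, hf.1⟩).2.2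

/-- A break appends two pieces that both fit up to `τ`: the finished one with the constant `lo`, and
the empty gap with the value `0`. -/
theorem fitQuality_scan (hS1 : ∀ i < n, 1 ≤ S i) (hS0 : S n = 0)
    (hS : ∀ i i', i ≤ i' → i' < n → S i ≤ S i') (hτ : 0 ≤ τ) :
    ∀ j ≤ n, FitQuality (sampleFrac S n) τ (scan S n τ j).out (scan S n τ j).base ∧
      (scan S n τ j).out.length = 2 * (scan S n τ j).breaks := by
  refine scan_induction
    (fun σ => FitQuality (sampleFrac S n) τ σ.out σ.base ∧ σ.out.length = 2 * σ.breaks) ?_ ?_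
  · refine ⟨⟨fun i => ?_, fun s _ => ?_⟩, rfl⟩
    · simp [Scan.init]
    · simp [Scan.init, jumpSet]
  · rintro j hj he ⟨hq, hl⟩
    have hc := scanCounts_scan (τ := τ) hS1 hS0 hS j hj.le
    have hf := scanFits_scan hS1 hS0 hS hτ j hj.le
    set σ := scan S n τ j
    have hlast : σ.last < S j := hc.last_lt j hc.lastCount_le hj
    unfold Scan.step
    split_ifs
    · exact ⟨hq, hl⟩
    · refine ⟨(hf.append hc hτ hq).append hτ (by omega) fun y h1 h2 => ?_, ?_⟩
      · unfold sampleFrac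
        rw [hc.count_eq hj hS h1.le (by omega), hc.count_eq hj hS le_rfl hlast]
        simpa using hτ
      · simp only [List.length_append, hl, List.length_cons, List.length_nil]
        ring

/-- The histogram returned by the scan. -/
noncomputable def scanOut (S : ℕ → ℕ) (n : ℕ) (τ : ℝ) : List (ℕ × ℝ) :=
  (scan S n τ n).out ++ [((scan S n τ n).last, (scan S n τ n).lo)]

theorem length_scanOut (hS1 : ∀ i < n, 1 ≤ S i) (hS0 : S n = 0)
    (hS : ∀ i i', i ≤ i' → i' < n → S i ≤ S i') (hτ : 0 ≤ τ) :
    (scanOut S n τ).length = 2 * (scan S n τ n).breaks + 1 := by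
  unfold scanOut
  rw [List.length_append, (fitQuality_scan hS1 hS0 hS hτ n le_rfl).2]
  rfl

theorem scan_last_le (hSN : ∀ i < n, S i ≤ N) : ∀ j ≤ n, (scan S n τ j).last ≤ N := by
  refine scan_induction (fun σ => σ.last ≤ N) (Nat.zero_le _) fun j hj _ _ => ?_
  unfold Scan.step
  split_ifs <;> exact hSN j hj

/-- Beyond the last sample both the empirical mass and the histogram vanish, so the estimate for the
covered positions extends to `N`. -/
theorem scanOut_quality (hn : 0 < n) (hS1 : ∀ i < n, 1 ≤ S i) (hSN : ∀ i < n, S i ≤ N)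
    (hS0 : S n = 0) (hS : ∀ i i', i ≤ i' → i' < n → S i ≤ S i') (hτ : 0 ≤ τ) (s : ℕ → ℝ)
    (hs : ∀ i, |s i| ≤ 1) :
    |∑ i ∈ range N, s i * (sampleFrac S n (i + 1) - sampleFrac S n i - histVal (scanOut S n τ) i)|
      ≤ τ * ((scanOut S n τ).length + 2 * (jumpSet s N).card) := by
  have hc := scanCounts_scan (τ := τ) hS1 hS0 hS n le_rfl
  have hf := scanFits_scan hS1 hS0 hS hτ n le_rfl
  have hq := hf.append hc hτ (fitQuality_scan hS1 hS0 hS hτ n le_rfl).1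
  change FitQuality _ _ (scanOut S n τ) _ at hq
  set σ := scan S n τ n
  have hcomp := hc.complete rfl
  have hlastS : ∀ i < n, S i ≤ σ.last := fun i hi => hc.le_last i (by rw [hcomp]; exact hi)
  have hcount : ∀ y, σ.last ≤ y → sampleFrac S n y = 1 := by
    intro y hy
    unfold sampleFrac
    rw [sampleCount_eq le_rfl (fun i hi => (hlastS i hi).trans hy) fun i h1 h2 => by omega]
    exact div_self (by positivity)
  have hzero : ∀ i, σ.last ≤ i → histVal (scanOut S n τ) i = 0 := by
    intro i hi
    unfold histVal
    have : (scanOut S n τ).find? (fun q => decide (i + 1 ≤ q.1)) = none := by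
      rw [List.find?_eq_none]
      intro q hq' hiq
      exact absurd ((hq.1 i).1 ⟨q, hq', by simpa using hiq⟩) (not_lt.2 hi)
    rw [this]; rfl
  have hle : σ.last ≤ N := scan_last_le hSN n le_rfl
  have e1 : ∑ i ∈ range N, s i * (sampleFrac S n (i + 1) - sampleFrac S n i
      - histVal (scanOut S n τ) i) = ∑ i ∈ range σ.last, s i * (sampleFrac S n (i + 1)
      - sampleFrac S n i - histVal (scanOut S n τ) i) := by
    rw [← sum_range_add_sum_Ico _ hle, add_eq_left]
    refine sum_eq_zero fun i hi => ?_
    have hi' := (mem_Ico.1 hi).1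
    rw [hcount i hi', hcount (i + 1) (by omega), hzero i hi']
    ring
  rw [e1]
  refine (hq.2 s hs).trans (mul_le_mul_of_nonneg_left ?_ hτ)
  have h1 : ((jumpSet s σ.last).card : ℝ) ≤ (jumpSet s N).card := by
    exact_mod_cast card_le_card fun i hi => mem_jumpSet.2
      ⟨(mem_jumpSet.1 hi).1.trans_le hle, (mem_jumpSet.1 hi).2⟩
  linarith

end

end MHRLearning

namespace MHRLearning
open Finset

/-! ### Bounding the number of breaks -/

/-- Signed indicator of the index interval `[a, b)`. -/
def signedBlock (ε : ℝ) (a b i : ℕ) : ℝ := if a ≤ i ∧ i < b then ε else 0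

theorem card_jumpSet_add_signedBlock_le (s : ℕ → ℝ) (ε : ℝ) (a b N : ℕ) :
    (jumpSet (fun i => s i + signedBlock ε a b i) N).card ≤ (jumpSet s N).card + 2 := by
  classical
  have hsub : jumpSet (fun i => s i + signedBlock ε a b i) N
      ⊆ insert (a - 1) (insert (b - 1) (jumpSet s N)) := by
    intro i hi
    rw [mem_jumpSet] at hi
    rw [mem_insert, mem_insert, mem_jumpSet]
    by_contra h
    push Not at h
    obtain ⟨h1, h2, h3⟩ := h
    refine hi.2 ?_
    have h4 : (a ≤ i ∧ i < b) ↔ (a ≤ i + 1 ∧ i + 1 < b) := by omega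
    simp only [signedBlock, h4, h3 hi.1]
  have h1 := card_le_card hsub
  have h2 := card_insert_le (a - 1) (insert (b - 1) (jumpSet s N))
  have h3 := card_insert_le (b - 1) (jumpSet s N)
  omega

theorem sum_signedBlock_mul (V g : ℕ → ℝ) (ε c : ℝ) {a b N : ℕ} (hab : a ≤ b) (hb : b ≤ N)
    (hg : ∀ i, a ≤ i → i < b → g i = c) :
    ∑ i ∈ range N, signedBlock ε a b i * (V (i + 1) - V i - g i)
      = ε * (V b - V a - c * ((b : ℝ) - a)) := by
  have h1 : ∑ i ∈ range N, signedBlock ε a b i * (V (i + 1) - V i - g i)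
      = ∑ i ∈ Ico a b, ε * ((V (i + 1) - c * (i + 1 : ℕ)) - (V i - c * i)) := by
    symm
    refine sum_subset_zero_on_sdiff ?_ ?_ ?_
    · intro i hi
      exact mem_range.2 ((mem_Ico.1 hi).2.trans_le hb)
    · intro i hi
      have : ¬ (a ≤ i ∧ i < b) := fun h => (mem_sdiff.1 hi).2 (mem_Ico.2 h)
      rw [signedBlock, if_neg this, zero_mul]
    · intro i hi
      have hi' := mem_Ico.1 hi
      rw [signedBlock, if_pos hi', hg i hi'.1 hi'.2]
      push_cast
      ring
  rw [h1, ← mul_sum, sum_Ico_sub (fun i => V i - c * i) hab]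
  ring

/-- A test function that witnesses `q` breaks up to the position `b` against `g`. -/
def BreakWitness (V g : ℕ → ℝ) (τ : ℝ) (N b q : ℕ) (s : ℕ → ℝ) : Prop :=
  -- The witness is a sum of signed blocks, one for each break that is not charged to a jump of `g`.
  -- A block for the failure at `x` may include the index `x - 1`, which is the next base, so
  -- consecutive blocks can overlap there; hence the bound `2`.
  (∀ i, |s i| ≤ 2) ∧ (∀ i, b ≤ i → |s i| ≤ 1) ∧ (∀ i, b < i → s i = 0) ∧
    (jumpSet s N).card ≤ 2 * q ∧
    τ * ((q : ℝ) - (jumpSet g b).card) ≤ ∑ i ∈ range N, s i * (V (i + 1) - V i - g i)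

theorem card_jumpSet_mono {α : Type*} (g : ℕ → α) {b b' : ℕ} (h : b ≤ b') :
    (jumpSet g b).card ≤ (jumpSet g b').card :=
  card_le_card fun _ hi => mem_jumpSet.2 ⟨(mem_jumpSet.1 hi).1.trans_le h, (mem_jumpSet.1 hi).2⟩

theorem BreakWitness.mono {V g s : ℕ → ℝ} {τ : ℝ} {N b b' q : ℕ} (hτ : 0 ≤ τ)
    (h : BreakWitness V g τ N b q s) (hb : b ≤ b') : BreakWitness V g τ N b' q s := by
  obtain ⟨h1, h2, h3, h4, h5⟩ := h
  refine ⟨h1, fun i hi => h2 i (hb.trans hi), fun i hi => h3 i (hb.trans_lt hi), h4, le_trans ?_ h5⟩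
  refine mul_le_mul_of_nonneg_left ?_ hτ
  have : ((jumpSet g b).card : ℝ) ≤ (jumpSet g b').card := by
    exact_mod_cast card_jumpSet_mono g hb
  linarith

/-- If `g` jumps before `x - 1`, that jump pays for the break and `s` is kept. Otherwise `g` is
constant on the piece. By assumption this constant does not fit, so some initial block of the piece
has discrepancy above `τ`, which the signed block adds to the sum. -/
theorem BreakWitness.succ {V g s : ℕ → ℝ} {τ : ℝ} {N b x q : ℕ} (hτ : 0 ≤ τ)
    (hg : ∀ i, 0 ≤ g i ∧ g i ≤ 1) (h : BreakWitness V g τ N b q s) (hbx : b + 1 < x) (hxN : x ≤ N)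
    (hx : ∀ c, ¬ Fits V τ b x c) : ∃ s', BreakWitness V g τ N (x - 1) (q + 1) s' := by
  obtain ⟨h1, h2, h3, h4, h5⟩ := h
  by_cases hflat : ∃ i, b ≤ i ∧ i < x - 1 ∧ g i ≠ g (i + 1)
  · obtain ⟨i, hi1, hi2, hi3⟩ := hflat
    obtain ⟨k1, k2, k3, k4, k5⟩ := BreakWitness.mono hτ ⟨h1, h2, h3, h4, h5⟩
      (by omega : b ≤ x - 1)
    refine ⟨s, k1, k2, k3, by omega, le_trans (mul_le_mul_of_nonneg_left ?_ hτ) h5⟩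
    have hlt : (jumpSet g b).card < (jumpSet g (x - 1)).card := by
      refine card_lt_card (Finset.ssubset_iff_subset_ne.2 ⟨fun i' hi' => mem_jumpSet.2
        ⟨(mem_jumpSet.1 hi').1.trans_le (by omega), (mem_jumpSet.1 hi').2⟩, fun heq => ?_⟩)
      have : i ∈ jumpSet g b := heq ▸ mem_jumpSet.2 ⟨hi2, hi3⟩
      exact absurd (mem_jumpSet.1 this).1 (not_lt.2 hi1)
    have : ((jumpSet g b).card : ℝ) + 1 ≤ (jumpSet g (x - 1)).card := by exact_mod_cast hlt
    push_cast
    linarith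
  · push Not at hflat
    have hconst : ∀ i, b ≤ i → i < x → g i = g b := by
      intro i hi
      induction i, hi using Nat.le_induction with
      | base => intro _; rfl
      | succ m hm ih =>
        intro hmx
        rw [← hflat m hm (by omega)]
        exact ih (by omega)
    have hnf := hx (g b)
    unfold Fits at hnf
    push Not at hnf
    obtain ⟨y, hy1, hy2, hy3⟩ := hnf (hg b).1 (hg b).2
    obtain ⟨ε, hε, hεabs⟩ : ∃ ε : ℝ, |ε| = 1 ∧
        ε * (V y - V b - g b * ((y : ℝ) - b)) = |V y - V b - g b * ((y : ℝ) - b)| := by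
      rcases le_total 0 (V y - V b - g b * ((y : ℝ) - b)) with h6 | h6
      · exact ⟨1, by norm_num, by rw [abs_of_nonneg h6, one_mul]⟩
      · exact ⟨-1, by norm_num, by rw [abs_of_nonpos h6]; ring⟩
    have hblock : ∀ i, |signedBlock ε b y i| ≤ 1 := by
      intro i
      unfold signedBlock
      split_ifs
      · exact hε.le
      · simp
    have hblock0 : ∀ i, i < b ∨ y ≤ i → signedBlock ε b y i = 0 := fun i hi =>
      if_neg fun h => by omega
    refine ⟨fun i => s i + signedBlock ε b y i, fun i => ?_, fun i hi => ?_, fun i hi => ?_, ?_, ?_⟩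
    · rcases Nat.lt_or_ge i b with h6 | h6
      · simp only [hblock0 i (Or.inl h6), add_zero]; exact h1 i
      · refine (abs_add_le _ _).trans ?_
        linarith [h2 i h6, hblock i]
    · simp only [h3 i (by omega), zero_add]
      exact hblock i
    · simp only [h3 i (by omega), zero_add]
      exact hblock0 i (Or.inr (by omega))
    · have := card_jumpSet_add_signedBlock_le s ε b y N
      omega
    · simp_rw [add_mul]
      rw [sum_add_distrib, sum_signedBlock_mul V g ε (g b) hy1.le (hy2.trans hxN)
        fun i hi1 hi2 => hconst i hi1 (by omega), hεabs]
      have h6 : ((jumpSet g b).card : ℝ) ≤ (jumpSet g (x - 1)).card := by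
        exact_mod_cast card_jumpSet_mono g (by omega)
      have h7 : τ * ((jumpSet g b).card : ℝ) ≤ τ * (jumpSet g (x - 1)).card :=
        mul_le_mul_of_nonneg_left h6 hτ
      push_cast
      linarith

section
variable {S : ℕ → ℕ} {n N : ℕ} {τ : ℝ}

/-- The induction provides a witness for every `q` up to the number of breaks. Choosing `q` small
keeps the number of jumps of the witness small even when the scan breaks very often. -/
theorem exists_breakWitness_scan (hS1 : ∀ i < n, 1 ≤ S i) (hSN : ∀ i < n, S i ≤ N)
    (hS0 : S n = 0) (hS : ∀ i i', i ≤ i' → i' < n → S i ≤ S i') (hτ : 0 ≤ τ) {g : ℕ → ℝ}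
    (hg : ∀ i, 0 ≤ g i ∧ g i ≤ 1) : ∀ j ≤ n, ∀ q ≤ (scan S n τ j).breaks,
      ∃ s, BreakWitness (sampleFrac S n) g τ N (scan S n τ j).base q s := by
  refine scan_induction (fun σ => ∀ q ≤ σ.breaks,
      ∃ s, BreakWitness (sampleFrac S n) g τ N σ.base q s) ?_ ?_
  · intro q hq
    rw [Nat.le_zero.1 hq]
    refine ⟨fun _ => 0, fun i => by norm_num, fun i _ => by norm_num, fun i _ => rfl, ?_, ?_⟩
    · simp [jumpSet]
    · simp only [zero_mul, sum_const_zero]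
      rw [Nat.cast_zero, zero_sub]
      exact mul_nonpos_of_nonneg_of_nonpos hτ (neg_nonpos.2 (Nat.cast_nonneg _))
  · intro j hj he ih
    have hc := scanCounts_scan (τ := τ) hS1 hS0 hS j hj.le
    have hf := scanFits_scan hS1 hS0 hS hτ j hj.le
    have key := newLo_le_and_le_newHi_iff hc hj hS he hτ hf.2
    set σ := scan S n τ j
    have hlast : σ.last < S j := hc.last_lt j hc.lastCount_le hj
    have hbase := hc.base_le
    unfold Scan.step
    split_ifs with h1
    · exact ih
    · have hnofit : ∀ c, ¬ Fits (sampleFrac S n) τ σ.base (S j) c := fun c hcf =>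
        h1 (((key c).2 hcf).1.trans ((key c).2 hcf).2)
      -- A piece with a single position is fitted by its own frequency, so it cannot cause a break.
      have hgap : σ.base + 1 < S j := by
        by_contra hgap
        have hx : S j = σ.base + 1 := by omega
        refine hnofit (sampleFrac S n (S j) - sampleFrac S n σ.base)
          ⟨sub_nonneg.2 (sampleFrac_mono S n (by omega)), ?_, ?_⟩
        · linarith [sampleFrac_nonneg S n σ.base, sampleFrac_le_one S n (S j)]
        · intro y h2 h3
          have : y = S j := by omega
          rw [this, hx]
          push_cast
          ring_nf
          simpa using hτ
      intro q hq
      simp only at hq ⊢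
      rcases Nat.le_succ_iff.1 hq with h2 | h2
      · obtain ⟨s, hs⟩ := ih q h2
        exact ⟨s, hs.mono hτ (by omega)⟩
      · obtain ⟨s, hs⟩ := ih σ.breaks le_rfl
        rw [h2]
        exact hs.succ hτ hg hgap (hSN j hj) hnofit

/-- Many breaks are witnessed by a test function with few jumps. -/
theorem exists_test_of_le_breaks (hS1 : ∀ i < n, 1 ≤ S i) (hSN : ∀ i < n, S i ≤ N)
    (hS0 : S n = 0) (hS : ∀ i i', i ≤ i' → i' < n → S i ≤ S i') (hτ : 0 ≤ τ) {g : ℕ → ℝ}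
    (hg : ∀ i, 0 ≤ g i ∧ g i ≤ 1) {q : ℕ} (hq : q ≤ (scan S n τ n).breaks) :
    ∃ s : ℕ → ℝ, (∀ i, |s i| ≤ 2) ∧ (jumpSet s N).card ≤ 2 * q ∧
      τ * ((q : ℝ) - (jumpSet g N).card) ≤
        ∑ i ∈ range N, s i * (sampleFrac S n (i + 1) - sampleFrac S n i - g i) := by
  obtain ⟨s, h1, -, -, h4, h5⟩ := exists_breakWitness_scan hS1 hSN hS0 hS hτ hg n le_rfl q hq
  refine ⟨s, h1, h4, le_trans (mul_le_mul_of_nonneg_left ?_ hτ) h5⟩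
  have hc := scanCounts_scan (τ := τ) hS1 hS0 hS n le_rfl
  have : ((jumpSet g (scan S n τ n).base).card : ℝ) ≤ (jumpSet g N).card := by
    exact_mod_cast card_jumpSet_mono g (hc.base_le.trans (scan_last_le hSN n le_rfl))
  linarith

/-- With a coarse tolerance there are few breaks. -/
theorem mul_breaks_le (hS1 : ∀ i < n, 1 ≤ S i) (hSN : ∀ i < n, S i ≤ N)
    (hS0 : S n = 0) (hS : ∀ i i', i ≤ i' → i' < n → S i ≤ S i') (hτ : 0 ≤ τ) :
    τ * (scan S n τ n).breaks ≤ 2 := by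
  -- Against `g = 0`, no break can be charged to a jump, and a test function bounded by `2` gains at
  -- most twice the total empirical mass.
  obtain ⟨s, h1, -, h3⟩ := exists_test_of_le_breaks hS1 hSN hS0 hS hτ (g := fun _ => 0)
    (fun _ => ⟨le_rfl, zero_le_one⟩) le_rfl
  have h4 : jumpSet (fun _ : ℕ => (0 : ℝ)) N = ∅ := by
    ext i; simp [mem_jumpSet]
  rw [h4, card_empty, Nat.cast_zero, sub_zero] at h3
  refine h3.trans ?_
  have h5 : ∀ i ∈ range N, s i * (sampleFrac S n (i + 1) - sampleFrac S n i - 0)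
      ≤ 2 * (sampleFrac S n (i + 1) - sampleFrac S n i) := by
    intro i _
    rw [sub_zero]
    exact mul_le_mul_of_nonneg_right ((le_abs_self _).trans (h1 i))
      (sub_nonneg.2 (sampleFrac_mono S n (Nat.le_succ i)))
  refine (sum_le_sum h5).trans ?_
  rw [← mul_sum, sum_range_sub]
  linarith [sampleFrac_nonneg S n 0, sampleFrac_le_one S n N]

end

end MHRLearning

namespace MHRLearning
open Finset

/-! ### Accuracy of the scan -/

/-- The array of the first `n` samples in sorted order, followed by zeros. -/
noncomputable def sampleArray {N : ℕ} (ω : ℕ → Fin N) (n : ℕ) : ℕ → ℕ := fun j =>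
  (RealRAM.sortedSamples ω 0 n).getD j 0

theorem abs_eq_sign_mul (x : ℝ) : |x| = Real.sign x * x := by
  rcases lt_trichotomy x 0 with h | h | h
  · rw [Real.sign_of_neg h, abs_of_neg h]; ring
  · simp [h]
  · rw [Real.sign_of_pos h, abs_of_pos h, one_mul]

section
variable {N : ℕ} (ω : ℕ → Fin N) (n : ℕ)

theorem length_sortedSamples : (RealRAM.sortedSamples ω 0 n).length = n := by
  simp [RealRAM.sortedSamples]

theorem sampleArray_eq {j : ℕ} (hj : j < n) : sampleArray ω n j
    = (RealRAM.sortedSamples ω 0 n)[j]'((length_sortedSamples ω n).symm ▸ hj) := by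
  unfold sampleArray
  rw [List.getD_eq_getElem]

theorem sampleArray_self : sampleArray ω n n = 0 := by
  unfold sampleArray
  rw [List.getD_eq_default]
  rw [length_sortedSamples]

theorem sampleArray_mem {j : ℕ} (hj : j < n) : ∃ i < n, sampleArray ω n j = ω i + 1 := by
  rw [sampleArray_eq ω n hj]
  have h := List.getElem_mem (l := RealRAM.sortedSamples ω 0 n)
    ((length_sortedSamples ω n).symm ▸ hj)
  unfold RealRAM.sortedSamples at h
  rw [Multiset.mem_sort, Multiset.mem_map] at h
  obtain ⟨i, hi, he⟩ := h
  refine ⟨i, by simpa using hi, ?_⟩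
  rw [zero_add] at he
  exact he.symm

theorem one_le_sampleArray : ∀ j < n, 1 ≤ sampleArray ω n j := fun j hj => by
  obtain ⟨i, -, h⟩ := sampleArray_mem ω n hj
  omega

theorem sampleArray_le : ∀ j < n, sampleArray ω n j ≤ N := fun j hj => by
  obtain ⟨i, -, h⟩ := sampleArray_mem ω n hj
  have := (ω i).2
  omega

theorem sampleArray_mono : ∀ i j, i ≤ j → j < n → sampleArray ω n i ≤ sampleArray ω n j := by
  intro i j hij hj
  rw [sampleArray_eq ω n hj, sampleArray_eq ω n (hij.trans_lt hj)]
  have h : (RealRAM.sortedSamples ω 0 n).Pairwise (· ≤ ·) := Multiset.pairwise_sort _ _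
  exact h.rel_get_of_le (a := ⟨i, _⟩) (b := ⟨j, _⟩) hij

theorem sampleCount_sampleArray (y : ℕ) :
    sampleCount (sampleArray ω n) n y = ((range n).filter fun j => (ω j : ℕ) < y).card := by
  have h1 : sampleCount (sampleArray ω n) n y
      = ((RealRAM.sortedSamples ω 0 n).countP fun x => decide (x ≤ y)) := by
    have h2 : RealRAM.sortedSamples ω 0 n = (List.range n).map (sampleArray ω n) := by
      apply List.ext_getElem
      · simp [length_sortedSamples]
      · intro i h3 h4
        rw [List.getElem_map, List.getElem_range, sampleArray_eq]
        rwa [length_sortedSamples] at h3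
    unfold sampleCount
    rw [h2, List.countP_map, List.countP_eq_length_filter]
    rfl
  have h3 : ((RealRAM.sortedSamples ω 0 n).countP fun x => decide (x ≤ y))
      = Multiset.countP (fun x => x ≤ y) ((Multiset.range n).map fun j => (ω (0 + j) : ℕ) + 1) := by
    unfold RealRAM.sortedSamples
    rw [← Multiset.coe_countP, Multiset.sort_eq]
  rw [h1, h3, Multiset.countP_map]
  simp only [zero_add]
  rfl

theorem sampleFrac_sampleArray (y : ℕ) : sampleFrac (sampleArray ω n) n y = empCum ω n y := by
  unfold sampleFrac empCum
  rw [sampleCount_sampleArray]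

variable {ω n} in
/-- If the tolerance is acceptable and either the initial one or the smallest acceptable one, the
histogram found by the scan is as close to the sampled distribution as any histogram `g` with few
jumps, up to constants. -/
theorem sum_abs_histVal_sub_le (hn : 0 < n) (f : PMF (Fin N)) {g : ℕ → ℝ} {t δ τ τ₀ : ℝ} {M : ℕ}
    (hg : ∀ i, 0 ≤ g i ∧ g i ≤ 1) (ht : 1 ≤ t) (hgt : ((jumpSet g N).card : ℝ) ≤ t)
    (hM : 8 * t ≤ M) (hτ : 0 ≤ τ) (hτ₀ : 0 ≤ τ₀)
    (hdev : ∀ s : ℕ → ℝ, (∀ i, |s i| ≤ 1) → (jumpSet s N).card ≤ M →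
      |∑ i ∈ range N, s i * (empCum ω n (i + 1) - empCum ω n i - extendZero (massFn f) i)| ≤ δ)
    (hacc : ((scan (sampleArray ω n) n τ n).breaks : ℝ) ≤ 3 * t)
    (hrej : τ ≤ τ₀ ∨ 3 * t < (scan (sampleArray ω n) n (τ / 2) n).breaks) :
    ∑ i ∈ range N, |histVal (scanOut (sampleArray ω n) n τ) i - extendZero (massFn f) i| ≤
      48 * (∑ i ∈ range N, |g i - extendZero (massFn f) i|) + 47 * δ + 23 * (τ₀ * t) := by
  set S := sampleArray ω n with hSdef
  set Δ := ∑ i ∈ range N, |g i - extendZero (massFn f) i| with hΔ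
  have hΔ0 : 0 ≤ Δ := sum_nonneg fun i _ => abs_nonneg _
  have hδ0 : 0 ≤ δ := by
    have := hdev (fun _ => 0) (fun _ => by norm_num) (by simp [jumpSet])
    exact (abs_nonneg _).trans this
  have hS1 := one_le_sampleArray ω n
  have hSN := sampleArray_le ω n
  have hS0 := sampleArray_self ω n
  have hS := sampleArray_mono ω n
  have hcard : ∀ s : ℕ → ℝ, ((jumpSet s N).card : ℝ) ≤ 8 * t → (jumpSet s N).card ≤ M := by
    intro s hs
    exact_mod_cast hs.trans hM
  have hτt : τ * t ≤ τ₀ * t + 2 * δ + 2 * Δ := by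
    rcases hrej with h | h
    · have : τ * t ≤ τ₀ * t := mul_le_mul_of_nonneg_right h (by linarith)
      linarith
    -- At the rejected tolerance `τ / 2`, a witness of just over `3 t` breaks has at most `6 t + 2 ≤
    -- 8 t` jumps. At most `t` breaks are charged to `g`, so the other `2 t` or more give `τ t ≤ 2 δ
    -- + 2 Δ`. Halving `s` makes the deviation bound applicable.
    · set q := ⌊3 * t⌋₊ + 1 with hq
      have hq1 : 3 * t < q := by rw [hq]; push_cast; exact Nat.lt_floor_add_one _
      have hq2 : (q : ℝ) ≤ 3 * t + 1 := by
        rw [hq]; push_cast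
        linarith [Nat.floor_le (by linarith : 0 ≤ 3 * t)]
      have hqb : q ≤ (scan S n (τ / 2) n).breaks := by
        have := (Nat.floor_lt (by linarith : 0 ≤ 3 * t)).2 h
        omega
      obtain ⟨s, h1, h2, h3⟩ := exists_test_of_le_breaks hS1 hSN hS0 hS (τ := τ / 2)
        (by linarith) hg hqb
      have h2' : ((jumpSet s N).card : ℝ) ≤ 8 * t := by
        have : ((jumpSet s N).card : ℝ) ≤ 2 * q := by exact_mod_cast h2
        linarith
      have hhalf : jumpSet (fun i => s i / 2) N = jumpSet s N := by
        ext i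
        rw [mem_jumpSet, mem_jumpSet, ne_eq, ne_eq, div_left_inj' (by norm_num : (2 : ℝ) ≠ 0)]
      have h4 := hdev (fun i => s i / 2) (fun i => by
        rw [abs_div, abs_of_pos (by norm_num : (0 : ℝ) < 2)]; linarith [h1 i])
        (by rw [hhalf]; exact hcard s h2')
      have h5 : ∑ i ∈ range N, s i * (sampleFrac S n (i + 1) - sampleFrac S n i - g i)
          = 2 * (∑ i ∈ range N, s i / 2 * (empCum ω n (i + 1) - empCum ω n i
            - extendZero (massFn f) i)) + ∑ i ∈ range N, s i * (extendZero (massFn f) i - g i) := by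
        rw [mul_sum, ← sum_add_distrib]
        refine sum_congr rfl fun i _ => ?_
        rw [hSdef, sampleFrac_sampleArray, sampleFrac_sampleArray]
        ring
      have h6 : ∑ i ∈ range N, s i * (extendZero (massFn f) i - g i) ≤ 2 * Δ := by
        rw [hΔ, mul_sum]
        refine sum_le_sum fun i _ => (le_abs_self _).trans ?_
        rw [abs_mul, abs_sub_comm]
        exact mul_le_mul_of_nonneg_right (h1 i) (abs_nonneg _)
      rw [h5] at h3
      have h7 : τ / 2 * (2 * t) ≤ τ / 2 * ((q : ℝ) - (jumpSet g N).card) :=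
        mul_le_mul_of_nonneg_left (by linarith) (by linarith)
      have h8 := (abs_le.1 h4).2
      have h9 : 0 ≤ τ₀ * t := mul_nonneg hτ₀ (by linarith)
      linarith
  set h := histVal (scanOut S n τ) with hh
  -- Testing against this sign function gives the full `ℓ₁`-distance of `g` and `h`. It jumps only
  -- where `g` or `h` does: at most `t` plus the output length `2 · 3 t + 1 ≤ 7 t`.
  set s : ℕ → ℝ := fun i => Real.sign (g i - h i) with hs
  have hs1 : ∀ i, |s i| ≤ 1 := by
    intro i
    simp only [hs]
    rcases Real.sign_apply_eq (g i - h i) with h1 | h1 | h1 <;> rw [h1] <;> norm_num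
  have hlen : ((scanOut S n τ).length : ℝ) ≤ 7 * t := by
    rw [length_scanOut hS1 hS0 hS hτ]
    push_cast
    linarith
  have hjs : ((jumpSet s N).card : ℝ) ≤ 8 * t := by
    have hsub : jumpSet s N ⊆ jumpSet g N ∪ jumpSet h N := by
      intro i hi
      rw [mem_union, mem_jumpSet, mem_jumpSet]
      rw [mem_jumpSet] at hi
      by_contra hcon
      push Not at hcon
      refine hi.2 ?_
      simp only [hs, hcon.1 hi.1, hcon.2 hi.1]
    have h1 : (jumpSet s N).card ≤ (jumpSet g N).card + (scanOut S n τ).length :=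
      (card_le_card hsub).trans ((card_union_le _ _).trans
        (Nat.add_le_add_left (card_jumpSet_histVal_le _ N) _))
    have h2 : ((jumpSet s N).card : ℝ) ≤ (jumpSet g N).card + (scanOut S n τ).length := by
      exact_mod_cast h1
    linarith
  have hq := scanOut_quality hn hS1 hSN hS0 hS hτ s hs1
  have hd := hdev s hs1 (hcard s hjs)
  have hgh : ∑ i ∈ range N, |g i - h i| ≤ Δ + δ + τ * (7 * t + 2 * (8 * t)) := by
    have e1 : ∑ i ∈ range N, |g i - h i|
        = ∑ i ∈ range N, s i * (g i - extendZero (massFn f) i)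
          - ∑ i ∈ range N, s i * (empCum ω n (i + 1) - empCum ω n i - extendZero (massFn f) i)
          + ∑ i ∈ range N, s i * (sampleFrac S n (i + 1) - sampleFrac S n i - h i) := by
      rw [← sum_sub_distrib, ← sum_add_distrib]
      refine sum_congr rfl fun i _ => ?_
      rw [hSdef, sampleFrac_sampleArray, sampleFrac_sampleArray, abs_eq_sign_mul]
      simp only [hs]
      ring
    have h1 : ∑ i ∈ range N, s i * (g i - extendZero (massFn f) i) ≤ Δ := by
      refine sum_le_sum fun i _ => (le_abs_self _).trans ?_
      rw [abs_mul]
      exact mul_le_of_le_one_left (abs_nonneg _) (hs1 i)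
    have h2 := (abs_le.1 hd).1
    have h3 := (abs_le.1 hq).2
    have h4 : τ * ((scanOut S n τ).length + 2 * (jumpSet s N).card)
        ≤ τ * (7 * t + 2 * (8 * t)) := mul_le_mul_of_nonneg_left (by linarith) hτ
    rw [e1]
    linarith
  have htri : ∑ i ∈ range N, |h i - extendZero (massFn f) i| ≤ ∑ i ∈ range N, |g i - h i| + Δ := by
    rw [hΔ, ← sum_add_distrib]
    refine sum_le_sum fun i _ => ?_
    rw [abs_sub_comm (g i) (h i)]
    exact abs_sub_le _ _ _
  have e2 : τ * (7 * t + 2 * (8 * t)) = 23 * (τ * t) := by ring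
  linarith

end

end MHRLearning

namespace MHRLearning
open RealRAM

/-! ### Executing programs -/

/-- The effect of a command without loops and draws. -/
noncomputable def run : Cmd → State → State
  | .skip, s => s
  | .nset x e, s => { s with nvar := Function.update s.nvar x (e.eval s) }
  | .nwrite a i e, s => { s with
      narr := Function.update s.narr a (Function.update (s.narr a) (i.eval s) (e.eval s)) }
  | .rset x e, s => { s with rvar := Function.update s.rvar x (e.eval s) }
  | .rwrite a i e, s => { s with
      rarr := Function.update s.rarr a (Function.update (s.rarr a) (i.eval s) (e.eval s)) }
  | .draw _ _, s => s
  | .emit e v, s => { s with out := s.out ++ [(e.eval s, v.eval s)] }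
  | .seq c₁ c₂, s => run c₂ (run c₁ s)
  | .ite b c₁ c₂, s => open scoped Classical in if b.eval s then run c₁ s else run c₂ s
  | .loop _ _, s => s

theorem run_ite_of_eval {b : Test} {c₁ c₂ : Cmd} {s : State} (h : b.eval s) :
    run (.ite b c₁ c₂) s = run c₁ s := if_pos h

theorem run_ite_of_not_eval {b : Test} {c₁ c₂ : Cmd} {s : State} (h : ¬ b.eval s) :
    run (.ite b c₁ c₂) s = run c₂ s := if_neg h

/-- Commands without loops and draws. -/
def Straight : Cmd → Prop
  | .draw _ _ => False
  | .loop _ _ => False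
  | .seq c₁ c₂ => Straight c₁ ∧ Straight c₂
  | .ite _ c₁ c₂ => Straight c₁ ∧ Straight c₂
  | _ => True

/-- An upper bound for the running time of a command without loops and draws. -/
def maxCost : Cmd → ℕ
  | .skip => 1
  | .nset _ e => e.cost + 1
  | .nwrite _ i e => i.cost + e.cost + 1
  | .rset _ e => e.cost + 1
  | .rwrite _ i e => i.cost + e.cost + 1
  | .draw _ _ => 0
  | .emit e v => e.cost + v.cost + 1
  | .seq c₁ c₂ => maxCost c₁ + maxCost c₂
  | .ite b c₁ c₂ => b.cost + (maxCost c₁ + maxCost c₂) + 1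
  | .loop _ _ => 0

section
variable {N : ℕ} {ω : ℕ → Fin N}

theorem exec_run : ∀ (c : Cmd) (s : State), Straight c →
    ∃ T, Exec ω c s T (run c s) ∧ T ≤ maxCost c
  | .skip, s, _ => ⟨_, .skip s, le_rfl⟩
  | .nset x e, s, _ => ⟨_, .nset s x e, le_rfl⟩
  | .nwrite a i e, s, _ => ⟨_, .nwrite s a i e, le_rfl⟩
  | .rset x e, s, _ => ⟨_, .rset s x e, le_rfl⟩
  | .rwrite a i e, s, _ => ⟨_, .rwrite s a i e, le_rfl⟩
  | .draw _ _, _, h => h.elim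
  | .loop _ _, _, h => h.elim
  | .emit e v, s, _ => ⟨_, .emit s e v, le_rfl⟩
  | .seq c₁ c₂, s, h => by
    obtain ⟨T₁, h₁, l₁⟩ := exec_run c₁ s h.1
    obtain ⟨T₂, h₂, l₂⟩ := exec_run c₂ (run c₁ s) h.2
    exact ⟨_, .seq h₁ h₂, Nat.add_le_add l₁ l₂⟩
  | .ite b c₁ c₂, s, h => by
    by_cases hb : b.eval s
    · obtain ⟨T, h₁, l₁⟩ := exec_run c₁ s h.1
      refine ⟨_, by rw [run, if_pos hb]; exact .iteTrue hb h₁, ?_⟩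
      simp only [maxCost]
      omega
    · obtain ⟨T, h₁, l₁⟩ := exec_run c₂ s h.2
      refine ⟨_, by rw [run, if_neg hb]; exact .iteFalse hb h₁, ?_⟩
      simp only [maxCost]
      omega

/-- Loops with an invariant and at most `m` iterations. -/
theorem exec_loop {b : Test} {c : Cmd} (Inv : ℕ → State → Prop) (m Tb : ℕ)
    (h : ∀ i s, Inv i s → b.eval s →
      i < m ∧ ∃ T s', Exec ω c s T s' ∧ T ≤ Tb ∧ Inv (i + 1) s') :
    ∀ d i s, m - i = d → Inv i s → ∃ T s' i', Exec ω (.loop b c) s T s' ∧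
      T ≤ d * (Tb + b.cost + 1) + b.cost + 1 ∧ Inv i' s' ∧ ¬ b.eval s' := by
  intro d
  induction d with
  | zero =>
    intro i s hd hi
    have hb : ¬ b.eval s := fun hb => by
      have := (h i s hi hb).1
      omega
    exact ⟨_, s, i, .loopDone hb, by omega, hi, hb⟩
  | succ d ih =>
    intro i s hd hi
    by_cases hb : b.eval s
    · obtain ⟨-, T, s', h₁, l₁, hi'⟩ := h i s hi hb
      obtain ⟨T', s'', i', h₂, l₂, hi'', hb'⟩ := ih (i + 1) s' (by omega) hi'
      refine ⟨_, s'', i', .loopStep hb h₁ h₂, ?_, hi'', hb'⟩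
      rw [add_one_mul]
      omega
    · refine ⟨_, s, i, .loopDone hb, ?_, hi, hb⟩
      rw [add_one_mul]
      omega

end

/-! ### The program -/

/-- Set a real variable to the maximum of two others. -/
def rsetMax (x a b : ℕ) : Cmd := .ite (.rle (.var b) (.var a)) (.rset x (.var a)) (.rset x (.var b))

/-- Set a real variable to the minimum of two others. -/
def rsetMin (x a b : ℕ) : Cmd := .ite (.rle (.var a) (.var b)) (.rset x (.var a)) (.rset x (.var b))

theorem run_rsetMax (x a b : ℕ) (s : State) : run (rsetMax x a b) s =
    { s with rvar := Function.update s.rvar x (max (s.rvar a) (s.rvar b)) } := by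
  by_cases h : s.rvar b ≤ s.rvar a
  · rw [max_eq_left h, rsetMax, run_ite_of_eval (b := .rle (.var b) (.var a)) h]; rfl
  · rw [max_eq_right (not_le.1 h).le, rsetMax,
      run_ite_of_not_eval (b := .rle (.var b) (.var a)) h]; rfl

theorem run_rsetMin (x a b : ℕ) (s : State) : run (rsetMin x a b) s =
    { s with rvar := Function.update s.rvar x (min (s.rvar a) (s.rvar b)) } := by
  by_cases h : s.rvar a ≤ s.rvar b
  · rw [min_eq_left h, rsetMin, run_ite_of_eval (b := .rle (.var a) (.var b)) h]; rfl
  · rw [min_eq_right (not_le.1 h).le, rsetMin,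
      run_ite_of_not_eval (b := .rle (.var a) (.var b)) h]; rfl

/-- Compute `Scan.newLo` in the real variable `6` and `Scan.newHi` in the real variable `7`. -/
def boundsCmd : Cmd :=
  .seq (.rset 8 (.div (.sub (.div (.ofNat (.sub (.var 5) (.var 7))) (.ofNat (.var 3))) (.var 3))
    (.ofNat (.sub (.var 10) (.var 6)))))
  (.seq (rsetMax 6 4 8)
  (.seq (.rset 8 (.div (.add (.div (.ofNat (.sub (.var 5) (.var 7))) (.ofNat (.var 3))) (.var 3))
    (.ofNat (.sub (.var 10) (.var 6)))))
  (.seq (rsetMin 7 5 8)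
  (.ite (.nle (.var 10) (.add (.var 6) (.const 1))) .skip
    (.seq (.rset 8 (.div
      (.add (.div (.ofNat (.sub (.var 9) (.var 7))) (.ofNat (.var 3))) (.var 3))
      (.ofNat (.sub (.var 10) (.add (.var 6) (.const 1))))))
    (rsetMin 7 7 8))))))

/-- Close the current piece and start a new one. -/
def breakCmd (emitting : Bool) : Cmd :=
  .seq (if emitting then .seq (.emit (.var 8) (.var 4))
      (.emit (.sub (.var 10) (.const 1)) (.ofNat (.const 0))) else .skip)
  (.seq (.nset 4 (.add (.var 4) (.const 1)))
  (.seq (.nset 6 (.sub (.var 10) (.const 1)))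
  (.seq (.nset 7 (.var 9))
  (.seq (.rset 8 (.div (.ofNat (.sub (.var 5) (.var 9))) (.ofNat (.var 3))))
  (.seq (.rset 4 (.sub (.var 8) (.var 3)))
  (.seq (.rset 6 (.ofNat (.const 0)))
  (.seq (rsetMax 4 6 4)
  (.seq (.rset 5 (.add (.var 8) (.var 3)))
  (.seq (.rset 6 (.ofNat (.const 1)))
  (rsetMin 5 6 5))))))))))

/-- Process the position in the variable `10`. -/
def stepCmd (emitting : Bool) : Cmd :=
  .seq boundsCmd
  (.seq (.ite (.rle (.var 6) (.var 7)) (.seq (.rset 4 (.var 6)) (.rset 5 (.var 7)))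
    (breakCmd emitting))
  (.seq (.nset 8 (.var 10)) (.nset 9 (.var 5))))

/-- Read the next sample, and process its position if it is the last sample there. -/
def scanBody (emitting : Bool) : Cmd :=
  .seq (.nset 10 (.read 0 (.var 5)))
  (.seq (.nset 5 (.add (.var 5) (.const 1)))
  (.ite (.and (.nle (.var 10) (.read 0 (.var 5))) (.nle (.read 0 (.var 5)) (.var 10))) .skip
    (stepCmd emitting)))

/-- Initialize the scan. -/
def scanInit : Cmd :=
  .seq (.nset 4 (.const 0)) (.seq (.nset 5 (.const 0)) (.seq (.nset 6 (.const 0))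
  (.seq (.nset 7 (.const 0)) (.seq (.nset 8 (.const 0)) (.seq (.nset 9 (.const 0))
  (.seq (.rset 4 (.ofNat (.const 0))) (.rset 5 (.ofNat (.const 1)))))))))

/-- Scan the samples. -/
def scanCmd (emitting : Bool) : Cmd :=
  .seq scanInit
  (.seq (.loop (.not (.nle (.var 3) (.var 5))) (scanBody emitting))
  (if emitting then .emit (.var 8) (.var 4) else .skip))

/-- The data that a scan uses but does not change. -/
structure Ready {N : ℕ} (ω : ℕ → Fin N) (n : ℕ) (t τ : ℝ) (s : State) : Prop where
  n_eq : s.nvar 3 = n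
  t_eq : s.rvar 2 = t
  τ_eq : s.rvar 3 = τ
  narr_eq : s.narr 0 = sampleArray ω n
  drawn_eq : s.drawn = n

/-- The machine state `s` represents the state `σ` of the scan after `j` samples. -/
structure Represents (emitting : Bool) (σ : Scan) (j : ℕ) (s : State) : Prop where
  breaks_eq : s.nvar 4 = σ.breaks
  j_eq : s.nvar 5 = j
  base_eq : s.nvar 6 = σ.base
  baseCount_eq : s.nvar 7 = σ.baseCount
  last_eq : s.nvar 8 = σ.last
  lastCount_eq : s.nvar 9 = σ.lastCount
  lo_eq : s.rvar 4 = σ.lo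
  hi_eq : s.rvar 5 = σ.hi
  out_eq : s.out = if emitting then σ.out else []

theorem run_boundsCmd (s : State) (σ : Scan) (n j x : ℕ) (τ : ℝ) (h3 : s.nvar 3 = n)
    (h5 : s.nvar 5 = j) (h6 : s.nvar 6 = σ.base) (h7 : s.nvar 7 = σ.baseCount)
    (h9 : s.nvar 9 = σ.lastCount) (h10 : s.nvar 10 = x) (r3 : s.rvar 3 = τ) (r4 : s.rvar 4 = σ.lo)
    (r5 : s.rvar 5 = σ.hi) :
    ∃ rv : ℕ → ℝ, run boundsCmd s = { s with rvar := rv } ∧ rv 6 = σ.newLo n τ x j ∧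
      rv 7 = σ.newHi n τ x j ∧ ∀ y < 6, rv y = s.rvar y := by
  by_cases hx : x ≤ σ.base + 1
  · simp only [boundsCmd, run, run_rsetMax, run_rsetMin, Test.eval, RExpr.eval, NExpr.eval, h3, h5,
      h6, h7, h10, hx, if_true]
    refine ⟨_, rfl, ?_, ?_, fun y hy => ?_⟩
    · simp [r3, r4, Scan.newLo]
    · simp [r3, r5, Scan.newHi, hx]
    · have e6 : y ≠ 6 := by omega
      have e7 : y ≠ 7 := by omega
      have e8 : y ≠ 8 := by omega
      simp [e6, e7, e8]
  · simp only [boundsCmd, run, run_rsetMax, run_rsetMin, Test.eval, RExpr.eval, NExpr.eval, h3, h5,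
      h6, h7, h9, h10, hx, if_false]
    refine ⟨_, rfl, ?_, ?_, fun y hy => ?_⟩
    · simp [r3, r4, Scan.newLo]
    · simp [r3, r5, Scan.newHi, hx]
    · have e6 : y ≠ 6 := by omega
      have e7 : y ≠ 7 := by omega
      have e8 : y ≠ 8 := by omega
      simp [e6, e7, e8]

theorem run_stepCmd {N : ℕ} {ω : ℕ → Fin N} {n j x : ℕ} {t τ : ℝ} {s : State} {σ : Scan}
    {emitting : Bool} (hr : Ready ω n t τ s) (hs : Represents emitting σ j s)
    (h10 : s.nvar 10 = x) :
    Ready ω n t τ (run (stepCmd emitting) s) ∧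
      Represents emitting (σ.step n τ x j) j (run (stepCmd emitting) s) := by
  obtain ⟨rv, e1, e2, e3, e4⟩ := run_boundsCmd s σ n j x τ hr.n_eq hs.j_eq hs.base_eq
    hs.baseCount_eq hs.lastCount_eq h10 hr.τ_eq hs.lo_eq hs.hi_eq
  have v2 := (e4 2 (by norm_num)).trans hr.t_eq
  have v3 := (e4 3 (by norm_num)).trans hr.τ_eq
  have v4 := (e4 4 (by norm_num)).trans hs.lo_eq
  have v5 := (e4 5 (by norm_num)).trans hs.hi_eq
  unfold Scan.step
  by_cases hle : σ.newLo n τ x j ≤ σ.newHi n τ x j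
  · simp only [stepCmd, run, e1, Test.eval, RExpr.eval, NExpr.eval, e2, e3, hle, if_true]
    constructor
    · constructor <;> simp [v2, v3, hr.n_eq, hr.narr_eq, hr.drawn_eq]
    · constructor <;> simp [e3, hs.breaks_eq, hs.j_eq, hs.base_eq,
        hs.baseCount_eq, hs.out_eq, h10]
  · cases emitting
    all_goals
      simp only [stepCmd, breakCmd, run, run_rsetMax, run_rsetMin, e1, Test.eval, RExpr.eval,
        NExpr.eval, e2, e3, hle, if_false, if_true, Bool.false_eq_true]
      constructor
      · constructor <;> simp [v2, v3, hr.n_eq, hr.narr_eq, hr.drawn_eq]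
      · constructor <;> simp [v3, v4, hs.breaks_eq, hs.j_eq, hs.last_eq,
          hs.lastCount_eq, hs.out_eq, h10, hr.n_eq]

theorem run_scanBody {N : ℕ} {ω : ℕ → Fin N} {n j : ℕ} {t τ : ℝ} {s : State}
    {emitting : Bool} (hr : Ready ω n t τ s)
    (hs : Represents emitting (scan (sampleArray ω n) n τ j) j s) :
    Ready ω n t τ (run (scanBody emitting) s) ∧ Represents emitting
      (scan (sampleArray ω n) n τ (j + 1)) (j + 1) (run (scanBody emitting) s) := by
  obtain ⟨s', hs'⟩ : ∃ s' : State, s' = { s with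
      nvar := Function.update (Function.update s.nvar 10 (sampleArray ω n j)) 5 (j + 1) } := ⟨_, rfl⟩
  have hr' : Ready ω n t τ s' := by
    constructor <;> simp [hs', hr.n_eq, hr.t_eq, hr.τ_eq, hr.narr_eq, hr.drawn_eq]
  have hrep : Represents emitting (scan (sampleArray ω n) n τ j) (j + 1) s' := by
    constructor <;> simp [hs', hs.breaks_eq, hs.base_eq, hs.baseCount_eq, hs.last_eq,
      hs.lastCount_eq, hs.lo_eq, hs.hi_eq, hs.out_eq]
  have e1 : run (scanBody emitting) s =
      if sampleArray ω n j = sampleArray ω n (j + 1) then s' else run (stepCmd emitting) s' := by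
    simp only [scanBody, run, Test.eval, NExpr.eval, hr.narr_eq, hs.j_eq]
    simp [hs', le_antisymm_iff, hs.j_eq]
  rw [e1, scan]
  split_ifs
  · exact ⟨hr', hrep⟩
  · exact run_stepCmd hr' hrep (by simp [hs'])

theorem straight_scanBody (emitting : Bool) : Straight (scanBody emitting) := by
  cases emitting <;> simp [scanBody, stepCmd, boundsCmd, breakCmd, rsetMax, rsetMin, Straight]

theorem maxCost_scanBody_le (emitting : Bool) : maxCost (scanBody emitting) ≤ 300 := by
  cases emitting <;> simp [scanBody, stepCmd, boundsCmd, breakCmd, rsetMax, rsetMin, maxCost,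
    NExpr.cost, RExpr.cost, Test.cost]

/-- Each sample is handled by straight-line code of bounded cost, so a scan is linear in `n`. Output
cannot be withdrawn; scans at tolerances still under trial are therefore run silently and only count
breaks. -/
theorem exec_scanCmd {N : ℕ} {ω : ℕ → Fin N} {n : ℕ} {t τ : ℝ} {s : State}
    (emitting : Bool) (hr : Ready ω n t τ s) (hout : s.out = []) :
    ∃ T s', Exec ω (scanCmd emitting) s T s' ∧ T ≤ 400 * (n + 1) ∧ Ready ω n t τ s' ∧
      s'.nvar 4 = (scan (sampleArray ω n) n τ n).breaks ∧
      s'.out = if emitting then scanOut (sampleArray ω n) n τ else [] := by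
  obtain ⟨T₁, h₁, l₁⟩ := exec_run (ω := ω) scanInit s (by simp [scanInit, Straight])
  have hr₁ : Ready ω n t τ (run scanInit s) := by
    constructor <;> simp [scanInit, run, hr.n_eq, hr.t_eq, hr.τ_eq, hr.narr_eq, hr.drawn_eq]
  have hs₁ : Represents emitting (scan (sampleArray ω n) n τ 0) 0 (run scanInit s) := by
    constructor <;> simp [scanInit, run, scan, Scan.init, NExpr.eval, RExpr.eval, hout]
  obtain ⟨T₂, s₂, i, h₂, l₂, ⟨hin, hr₂, hs₂⟩, hb⟩ := exec_loop (ω := ω)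
    (b := .not (.nle (.var 3) (.var 5))) (c := scanBody emitting)
    (fun j s => j ≤ n ∧ Ready ω n t τ s ∧ Represents emitting (scan (sampleArray ω n) n τ j) j s)
    n 300 (fun j s ⟨hj, hr, hs⟩ hb => by
      have hjn : j < n := by
        simpa [Test.eval, NExpr.eval, hr.n_eq, hs.j_eq] using hb
      obtain ⟨T, hT, lT⟩ := exec_run (ω := ω) (scanBody emitting) s (straight_scanBody _)
      exact ⟨hjn, T, _, hT, lT.trans (maxCost_scanBody_le _), hjn, run_scanBody hr hs⟩)
    n 0 _ rfl ⟨Nat.zero_le _, hr₁, hs₁⟩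
  have hi : i = n := by
    simp only [Test.eval, NExpr.eval, hr₂.n_eq, hs₂.j_eq, not_not] at hb
    exact le_antisymm hin hb
  subst hi
  have l₀ : maxCost scanInit ≤ 40 := by simp [scanInit, maxCost, NExpr.cost, RExpr.cost]
  have lb : (Test.not (.nle (.var 3) (.var 5))).cost = 4 := rfl
  rw [lb] at l₂
  cases emitting
  · exact ⟨_, s₂, .seq h₁ (.seq h₂ (.skip s₂)), by omega, hr₂, hs₂.breaks_eq, hs₂.out_eq⟩
  · refine ⟨_, _, .seq h₁ (.seq h₂ (.emit s₂ _ _)), ?_, ⟨hr₂.n_eq, hr₂.t_eq, hr₂.τ_eq, hr₂.narr_eq,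
      hr₂.drawn_eq⟩, hs₂.breaks_eq, ?_⟩
    · simp only [NExpr.cost, RExpr.cost]
      omega
    · simp [NExpr.eval, RExpr.eval, hs₂.out_eq, hs₂.last_eq, hs₂.lo_eq, scanOut]

end MHRLearning

/-! ### The learner: parameters, tolerance search and number of steps. -/

namespace MHRLearning
open RealRAM

/-- `⌈log₂ (N / ε)⌉`. -/
noncomputable def logSize (N : ℕ) (ε : ℝ) : ℕ := ⌈Real.logb 2 (N / ε)⌉₊

/-- The number of pieces that the learner aims at. -/
noncomputable def pieceBound (N k : ℕ) (ε : ℝ) : ℝ := 20000 * (k * logSize N ε) / ε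

/-- The number of samples that the learner draws. -/
noncomputable def sampleSize (N k : ℕ) (ε : ℝ) : ℕ :=
  ⌈36000000000 * pieceBound N k ε / (ε * ε)⌉₊

/-- Compute `logSize` in the variable `2`. -/
def logSizeCmd : Cmd :=
  .seq (.rset 1 (.ofNat (.const 1)))
  (.loop (.not (.rle (.ofNat (.var 0)) (.mul (.var 1) (.var 0))))
    (.seq (.rset 1 (.add (.var 1) (.var 1))) (.nset 2 (.add (.var 2) (.const 1)))))

/-- Compute `pieceBound` in the real variable `2`, and `sampleSize` in the variable `3`. -/
def sampleSizeCmd : Cmd :=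
  .seq (.rset 2 (.div (.mul (.ofNat (.const 20000)) (.mul (.ofNat (.var 1)) (.ofNat (.var 2))))
    (.var 0)))
  (.seq (.rset 9 (.div (.mul (.ofNat (.const 36000000000)) (.var 2)) (.mul (.var 0) (.var 0))))
  (.loop (.not (.rle (.var 9) (.ofNat (.var 3)))) (.nset 3 (.add (.var 3) (.const 1)))))

/-- Set the initial tolerance. -/
def toleranceCmd : Cmd :=
  .seq (.rset 3 (.div (.div (.var 0) (.ofNat (.const 200))) (.var 2))) (.nset 4 (.var 3))

/-- Double the tolerance until the scan has few breaks. -/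
def searchCmd : Cmd :=
  .loop (.not (.rle (.ofNat (.var 4)) (.mul (.ofNat (.const 3)) (.var 2))))
    (.seq (.rset 3 (.add (.var 3) (.var 3))) (scanCmd false))

/-- The learner. -/
def learner : Cmd :=
  .seq logSizeCmd (.seq sampleSizeCmd (.seq (.draw 0 (.var 3)) (.seq toleranceCmd
    (.seq searchCmd (scanCmd true)))))

section
variable {N k n : ℕ} {ε t τ : ℝ} {ω : ℕ → Fin N}

/-- This comparison lets the machine find the rounded logarithm by repeated doubling. -/
theorem le_two_pow_mul_iff (hN : 1 ≤ N) (hε : 0 < ε) (i : ℕ) :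
    (N : ℝ) ≤ 2 ^ i * ε ↔ logSize N ε ≤ i := by
  have hN' : (0 : ℝ) < N := by exact_mod_cast hN
  rw [logSize, Nat.ceil_le, Real.logb_le_iff_le_rpow one_lt_two (div_pos hN' hε), div_le_iff₀ hε,
    Real.rpow_natCast]

theorem exec_logSizeCmd (hN : 1 ≤ N) (hε : 0 < ε) : ∃ T s,
    Exec ω logSizeCmd (initState N k ε) T s ∧ T ≤ 20 * (logSize N ε + 1) ∧ s.nvar 1 = k ∧
      s.nvar 2 = logSize N ε ∧ s.nvar 3 = 0 ∧ s.rvar 0 = ε ∧ s.narr 0 = 0 ∧ s.drawn = 0 ∧ s.out = [] := by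
  obtain ⟨T, s, i, h, l, ⟨hi, h0, h1, h2, h3, r0, r1, hz, hd, ho⟩, hb⟩ := exec_loop (ω := ω)
    (b := .not (.rle (.ofNat (.var 0)) (.mul (.var 1) (.var 0))))
    (c := .seq (.rset 1 (.add (.var 1) (.var 1))) (.nset 2 (.add (.var 2) (.const 1))))
    (fun i s => i ≤ logSize N ε ∧ s.nvar 0 = N ∧ s.nvar 1 = k ∧ s.nvar 2 = i ∧ s.nvar 3 = 0 ∧
      s.rvar 0 = ε ∧ s.rvar 1 = 2 ^ i ∧ s.narr 0 = 0 ∧ s.drawn = 0 ∧ s.out = []) (logSize N ε) 8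
    (fun i s ⟨hi, h0, h1, h2, h3, r0, r1, hz, hd, ho⟩ hb => by
      simp only [Test.eval, RExpr.eval, NExpr.eval, h0, r0, r1, le_two_pow_mul_iff hN hε,
        not_le] at hb
      refine ⟨hb, _, _, .seq (.rset _ _ _) (.nset _ _ _), by simp [NExpr.cost, RExpr.cost], hb, ?_⟩
      simp [NExpr.eval, RExpr.eval, h0, h1, h2, h3, r0, r1, hz, hd, ho, pow_succ, mul_two])
    (logSize N ε) 0 (run (.rset 1 (.ofNat (.const 1))) (initState N k ε)) rfl
    (by simp [run, initState, NExpr.eval, RExpr.eval, Pi.zero_def])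
  refine ⟨_, s, .seq (.rset _ _ _) h, ?_, h1, ?_, h3, r0, hz, hd, ho⟩
  · simp only [NExpr.cost, RExpr.cost, Test.cost] at l ⊢
    omega
  · simp only [Test.eval, RExpr.eval, NExpr.eval, h0, r0, r1, le_two_pow_mul_iff hN hε,
      not_not] at hb
    rw [h2]
    exact le_antisymm hi hb

/-- The machine cannot round, so the sample size is found by counting up. This costs no more, up to
a constant, than drawing the samples. -/
theorem exec_sampleSizeCmd {s : State} (h1 : s.nvar 1 = k) (h2 : s.nvar 2 = logSize N ε)
    (h3 : s.nvar 3 = 0) (r0 : s.rvar 0 = ε) (hz : s.narr 0 = 0) (hd : s.drawn = 0) (ho : s.out = []) : ∃ T s',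
    Exec ω sampleSizeCmd s T s' ∧ T ≤ 40 * (sampleSize N k ε + 1) ∧
      s'.nvar 3 = sampleSize N k ε ∧ s'.rvar 0 = ε ∧ s'.rvar 2 = pieceBound N k ε ∧
      s'.narr 0 = 0 ∧ s'.drawn = 0 ∧ s'.out = [] := by
  obtain ⟨T, s', i, h, l, ⟨hi, h3', r0', r2', r9', hz', hd', ho'⟩, hb⟩ := exec_loop (ω := ω)
    (b := .not (.rle (.var 9) (.ofNat (.var 3)))) (c := .nset 3 (.add (.var 3) (.const 1)))
    (fun i s => i ≤ sampleSize N k ε ∧ s.nvar 3 = i ∧ s.rvar 0 = ε ∧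
      s.rvar 2 = pieceBound N k ε ∧ s.rvar 9 = 36000000000 * pieceBound N k ε / (ε * ε) ∧
      s.narr 0 = 0 ∧ s.drawn = 0 ∧ s.out = []) (sampleSize N k ε) 4
    (fun i s ⟨hi, h3, r0, r2, r9, hz, hd, ho⟩ hb => by
      simp only [Test.eval, RExpr.eval, NExpr.eval, h3, r9, ← Nat.ceil_le, not_le] at hb
      refine ⟨hb, _, _, .nset _ _ _, by simp [NExpr.cost], hb, ?_⟩
      simp [NExpr.eval, h3, r0, r2, r9, hz, hd, ho])
    (sampleSize N k ε) 0 _ rfl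
    (by
      show _ ∧ (run (.seq (.rset 2 (.div (.mul (.ofNat (.const 20000))
        (.mul (.ofNat (.var 1)) (.ofNat (.var 2)))) (.var 0))) (.rset 9 (.div
          (.mul (.ofNat (.const 36000000000)) (.var 2)) (.mul (.var 0) (.var 0))))) s).nvar 3 = _ ∧ _
      simp [run, NExpr.eval, RExpr.eval, h1, h2, h3, r0, hz, hd, ho, pieceBound])
  refine ⟨_, s', .seq (.rset _ _ _) (.seq (.rset _ _ _) h), ?_, ?_, r0', r2', hz', hd', ho'⟩
  · simp only [NExpr.cost, RExpr.cost, Test.cost] at l ⊢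
    omega
  · simp only [Test.eval, RExpr.eval, NExpr.eval, h3', r9', ← Nat.ceil_le, not_not] at hb
    rw [h3']
    exact le_antisymm hi hb

theorem exec_drawCmd {s : State} (h3 : s.nvar 3 = n) (r0 : s.rvar 0 = ε) (r2 : s.rvar 2 = t)
    (hz : s.narr 0 = 0) (hd : s.drawn = 0) (ho : s.out = []) : ∃ T s',
    Exec ω (.seq (.draw 0 (.var 3)) toleranceCmd) s T s' ∧ T ≤ 20 * (n + 1) ∧
      Ready ω n t (ε / 200 / t) s' ∧ s'.nvar 4 = n ∧ s'.out = [] := by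
  refine ⟨_, _, .seq (.draw _ _ _) (.seq (.rset _ _ _) (.nset _ _ _)), ?_, ⟨?_, ?_, ?_, ?_, ?_⟩,
    ?_, ?_⟩
  · simp only [NExpr.cost, RExpr.cost, NExpr.eval, h3]
    omega
  · simp [h3]
  · simp [r2]
  · simp [r0, r2, RExpr.eval, NExpr.eval]
  · ext j
    simp [NExpr.eval, h3, hd, hz, sampleArray]
  · simp [hd, h3, NExpr.eval]
  · simp [h3, NExpr.eval]
  · exact ho

/-- The variable `4` starts at `n > 3 t`, which forces at least one scan; as the tolerance is
doubled beforehand, the first one uses `ε / 100 / t`. When the loop stops, either this was the only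
scan or the previous tolerance, half the final one, was rejected. -/
theorem exec_searchCmd {s : State} (hε : 0 < ε) (hε1 : ε ≤ 1 / 2) (ht : 0 < t)
    (hn : 3 * t < n) (hr : Ready ω n t (ε / 200 / t) s) (h4 : s.nvar 4 = n)
    (ho : s.out = []) : ∃ T s' τ,
    Exec ω searchCmd s T s' ∧ T ≤ ⌈Real.logb 2 (400 / ε)⌉₊ * (500 * (n + 1)) + 20 ∧
      Ready ω n t τ s' ∧ s'.out = [] ∧ 0 ≤ τ ∧ ((scan (sampleArray ω n) n τ n).breaks : ℝ) ≤ 3 * t ∧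
      (τ ≤ ε / 100 / t ∨ 3 * t < (scan (sampleArray ω n) n (τ / 2) n).breaks) := by
  obtain ⟨m, hm⟩ : ∃ m, m = ⌈Real.logb 2 (400 / ε)⌉₊ := ⟨_, rfl⟩
  rw [← hm]
  set br : ℝ → ℕ := fun τ => (scan (sampleArray ω n) n τ n).breaks with hbr
  have hτ0 : 0 < ε / 200 / t := by positivity
  have htest : ∀ {τ : ℝ} {s : State}, Ready ω n t τ s →
      ((Test.not (.rle (.ofNat (.var 4)) (.mul (.ofNat (.const 3)) (.var 2)))).eval s ↔
        3 * t < s.nvar 4) := fun hr => by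
    simp [Test.eval, RExpr.eval, NExpr.eval, hr.t_eq]
  obtain ⟨T, s', i, h, l, ⟨τ, hτi, hr', ho', hi⟩, hb⟩ := exec_loop (ω := ω)
    (b := .not (.rle (.ofNat (.var 4)) (.mul (.ofNat (.const 3)) (.var 2))))
    (c := .seq (.rset 3 (.add (.var 3) (.var 3))) (scanCmd false))
    (fun i s => ∃ τ, τ = ε / 200 / t * 2 ^ i ∧ Ready ω n t τ s ∧ s.out = [] ∧
      (i = 0 ∧ s.nvar 4 = n ∨
        0 < i ∧ s.nvar 4 = br τ ∧ (τ ≤ ε / 100 / t ∨ 3 * t < br (τ / 2))))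
    m (400 * (n + 1) + 4)
    (fun i s ⟨τ, hτi, hr, ho, hi⟩ hb => by
      rw [htest hr] at hb
      have hτ : 0 < τ := by rw [hτi]; positivity
      -- More than `3 t` breaks at tolerance `2 ^ i ε / (200 t)` would contradict `mul_breaks_le`
      -- once `2 ^ i ε` reaches `400`.
      have him : i < m := by
        rw [hm, Nat.lt_ceil, Real.lt_logb_iff_rpow_lt one_lt_two (by positivity), Real.rpow_natCast,
          lt_div_iff₀ hε]
        rcases hi with ⟨rfl, -⟩ | ⟨-, hi, -⟩
        · linarith
        · rw [hi] at hb
          have h1 := mul_breaks_le (one_le_sampleArray ω n) (sampleArray_le ω n)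
            (sampleArray_self ω n) (sampleArray_mono ω n) hτ.le
          have h2 := mul_lt_mul_of_pos_left hb hτ
          have h3 : τ * (3 * t) = 3 / 200 * (2 ^ i * ε) := by
            rw [hτi]; field_simp
          have h4 : 0 < 2 ^ i * ε := by positivity
          linarith
      have hr₁ : Ready ω n t (2 * τ)
          { s with rvar := Function.update s.rvar 3 (s.rvar 3 + s.rvar 3) } := by
        constructor <;> simp [hr.n_eq, hr.t_eq, hr.τ_eq, hr.narr_eq, hr.drawn_eq, two_mul]
      obtain ⟨T, s', h, l, hr', h4', ho'⟩ := exec_scanCmd false hr₁ ho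
      refine ⟨him, _, s', .seq (.rset s 3 _) h, ?_, 2 * τ, by rw [hτi, pow_succ]; ring, hr', ho',
        .inr ⟨i.succ_pos, h4', ?_⟩⟩
      · simp only [RExpr.cost]
        omega
      · rcases hi with ⟨rfl, -⟩ | ⟨-, hi, -⟩
        · left
          rw [hτi]
          exact le_of_eq (by ring)
        · right
          rwa [mul_div_cancel_left₀ _ two_ne_zero, ← hi])
    _ 0 s rfl ⟨_, by simp, hr, ho, .inl ⟨rfl, h4⟩⟩
  rw [htest hr', not_lt] at hb
  rcases hi with ⟨-, hi⟩ | ⟨hi0, hi, hi'⟩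
  · rw [hi] at hb
    exact absurd hb (not_le.2 hn)
  · rw [hi] at hb
    refine ⟨T, s', τ, h, l.trans ?_, hr', ho', ?_, hb, hi'⟩
    · rw [show (Test.not (.rle (.ofNat (.var 4)) (.mul (.ofNat (.const 3)) (.var 2)))).cost = 8
        from rfl]
      have := Nat.mul_le_mul_left m
        (show 400 * (n + 1) + 4 + 8 + 1 ≤ 500 * (n + 1) by omega)
      rw [Nat.sub_zero]
      linarith
    · rw [hτi]; positivity

theorem one_le_logSize (hN : 1 ≤ N) (hε : 0 < ε) (hε1 : ε ≤ 1 / 2) : 1 ≤ logSize N ε := by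
  rw [Nat.one_le_iff_ne_zero, Ne, ← Nat.le_zero, ← le_two_pow_mul_iff hN hε, not_le]
  have : (1 : ℝ) ≤ N := by exact_mod_cast hN
  linarith

theorem pieceBound_pos (hk : 1 ≤ k) (hε : 0 < ε) (hL : 1 ≤ logSize N ε) :
    0 < pieceBound N k ε := by
  have h1 : (0 : ℝ) < k := by exact_mod_cast hk
  have h2 : (0 : ℝ) < logSize N ε := by exact_mod_cast hL
  unfold pieceBound
  positivity

theorem exec_learner (hN : 1 ≤ N) (hk : 1 ≤ k) (hε : 0 < ε) (hε1 : ε ≤ 1 / 2) : ∃ T s τ,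
    Exec ω learner (initState N k ε) T s ∧
      T ≤ (⌈Real.logb 2 (400 / ε)⌉₊ + 1) * (1000 * (sampleSize N k ε + logSize N ε + 1)) ∧
      s.drawn = sampleSize N k ε ∧
      s.out = scanOut (sampleArray ω (sampleSize N k ε)) (sampleSize N k ε) τ ∧ 0 ≤ τ ∧
      ((scan (sampleArray ω (sampleSize N k ε)) (sampleSize N k ε) τ
        (sampleSize N k ε)).breaks : ℝ) ≤ 3 * pieceBound N k ε ∧
      (τ ≤ ε / 100 / pieceBound N k ε ∨ 3 * pieceBound N k ε <
        (scan (sampleArray ω (sampleSize N k ε)) (sampleSize N k ε) (τ / 2)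
          (sampleSize N k ε)).breaks) := by
  have ht := pieceBound_pos hk hε (one_le_logSize hN hε hε1)
  have hn : 3 * pieceBound N k ε < sampleSize N k ε := by
    refine lt_of_lt_of_le ?_ (Nat.le_ceil _)
    rw [lt_div_iff₀ (by positivity)]
    have : ε * ε ≤ 1 := mul_le_one₀ (by linarith) hε.le (by linarith)
    nlinarith
  obtain ⟨T₁, s₁, e₁, l₁, h1, h2, h3, r0, hz, hd, ho⟩ := exec_logSizeCmd (ω := ω) (k := k) hN hε
  obtain ⟨T₂, s₂, e₂, l₂, h3', r0', r2', hz', hd', ho'⟩ :=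
    exec_sampleSizeCmd (ω := ω) h1 h2 h3 r0 hz hd ho
  obtain ⟨T₃, s₃, e₃, l₃, hr, h4, ho₃⟩ := exec_drawCmd (ω := ω) h3' r0' r2' hz' hd' ho'
  obtain ⟨T₄, s₄, τ, e₄, l₄, hr₄, ho₄, hτ, hacc, hrej⟩ := exec_searchCmd hε hε1 ht hn hr h4 ho₃
  obtain ⟨T₅, s₅, e₅, l₅, hr₅, -, ho₅⟩ := exec_scanCmd true hr₄ ho₄
  cases e₃ with
  | seq e₃ e₃' =>
    refine ⟨_, s₅, τ, .seq e₁ (.seq e₂ (.seq e₃ (.seq e₃' (.seq e₄ e₅)))), ?_, hr₅.drawn_eq, ho₅,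
      hτ, hacc, hrej⟩
    rw [add_one_mul]
    have := Nat.mul_le_mul_left ⌈Real.logb 2 (400 / ε)⌉₊
      (show 500 * (sampleSize N k ε + 1) ≤ 1000 * (sampleSize N k ε + logSize N ε + 1) by omega)
    omega

end

end MHRLearning

namespace MHRLearning
open Finset MeasureTheory

/-! ### Accuracy and complexity of the learner -/

section
variable {N k : ℕ} {ε : ℝ}

theorem log_div_le_logSize (hN : 1 ≤ N) (hε : 0 < ε) (hε1 : ε ≤ 1 / 2) :
    Real.log (N / (ε / 1000)) ≤ 8 * logSize N ε := by
  have hN' : (0 : ℝ) < N := by exact_mod_cast hN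
  have hL : (1 : ℝ) ≤ logSize N ε := by exact_mod_cast one_le_logSize hN hε hε1
  have h1 : (N : ℝ) / (ε / 1000) ≤ 2 ^ (logSize N ε + 10) := by
    rw [div_le_iff₀ (by positivity), pow_add]
    have h2 := (le_two_pow_mul_iff hN hε _).2 le_rfl
    have h3 : (0 : ℝ) < 2 ^ logSize N ε * ε := by positivity
    linarith
  have h2 := Real.log_le_log (by positivity) h1
  rw [Real.log_pow] at h2
  push_cast at h2
  have h3 := Real.log_two_lt_d9
  have h4 : ((logSize N ε : ℝ) + 10) * Real.log 2 ≤ (logSize N ε + 10) * 0.6931471808 :=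
    mul_le_mul_of_nonneg_left h3.le (by positivity)
  linarith

theorem one_le_pieceBound (hN : 1 ≤ N) (hk : 1 ≤ k) (hε : 0 < ε) (hε1 : ε ≤ 1 / 2) :
    1 ≤ pieceBound N k ε := by
  have hk' : (1 : ℝ) ≤ k := by exact_mod_cast hk
  have hL : (1 : ℝ) ≤ logSize N ε := by exact_mod_cast one_le_logSize hN hε hε1
  have := one_le_mul_of_one_le_of_one_le hk' hL
  rw [pieceBound, le_div_iff₀ hε]
  linarith

/-- Here the constant `20000` is consumed: `log_div_le_logSize` gives `2 · 1000 · 8 = 16000` times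
`logSize`, and the rest covers the summand `2`. -/
theorem card_le_pieceBound (hN : 1 ≤ N) (hε : 0 < ε) (hε1 : ε ≤ 1 / 2) :
    (k : ℝ) * (2 * (Real.log (N / (ε / 1000)) / (ε / 1000)) + 2) ≤ pieceBound N k ε := by
  have hL : (1 : ℝ) ≤ logSize N ε := by exact_mod_cast one_le_logSize hN hε hε1
  have h1 := log_div_le_logSize hN hε hε1
  have h2 : pieceBound N k ε = k * (20000 * logSize N ε / ε) := by
    rw [pieceBound]; ring
  rw [h2]
  refine mul_le_mul_of_nonneg_left ?_ (Nat.cast_nonneg k)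
  generalize Real.log (N / (ε / 1000)) = a at h1 ⊢
  have h3 : (2 * (a / (ε / 1000)) + 2) * ε = 2000 * a + 2 * ε := by field_simp; ring
  rw [le_div_iff₀ hε, h3]
  linarith

/-- The constant in `sampleSize` is `40000 · 9 · 10⁵`; the surplus of `9` over `8` absorbs the
rounding, as `pieceBound` is at least `1`. -/
theorem ceil_mul_le_sampleSize (hN : 1 ≤ N) (hk : 1 ≤ k) (hε : 0 < ε) (hε1 : ε ≤ 1 / 2) :
    (10 ^ 5 * ⌈8 * pieceBound N k ε⌉₊ : ℝ) ≤ sampleSize N k ε * (ε / 200) ^ 2 := by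
  have ht := one_le_pieceBound hN hk hε hε1
  have h1 : 36000000000 * pieceBound N k ε / (ε * ε) ≤ sampleSize N k ε := Nat.le_ceil _
  have h2 := (Nat.ceil_lt_add_one (show 0 ≤ 8 * pieceBound N k ε by linarith)).le
  rw [div_le_iff₀ (by positivity)] at h1
  have h3 : (sampleSize N k ε : ℝ) * (ε / 200) ^ 2 = sampleSize N k ε * (ε * ε) / 40000 := by ring
  rw [h3]
  linarith

theorem isMHR_pure_zero [NeZero N] : IsMHR (PMF.pure (0 : Fin N)) := by
  intro i j hij hj
  have hj0 : j = 0 := by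
    by_contra h
    refine hj.ne' (sum_eq_zero fun x hx => ?_)
    have hx0 : x ≠ 0 := by
      rintro rfl
      exact h (le_antisymm (mem_Ici.1 hx) (Fin.zero_le _))
    simp [massFn, PMF.pure_apply, hx0]
  subst hj0
  rw [le_antisymm hij (Fin.zero_le _)]

/-- Without nonemptiness the real infimum in `optDist` would be the default value `0`, and no
mixture would approach it. -/
theorem mixtures_nonempty (hN : 1 ≤ N) (hk : 1 ≤ k) :
    (mixtures k {p : PMF (Fin N) | IsMHR p}).Nonempty := by
  have : NeZero N := ⟨by omega⟩
  have : NeZero k := ⟨by omega⟩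
  exact ⟨_, PMF.pure 0, fun _ => PMF.pure 0, fun _ => isMHR_pure_zero, rfl⟩

theorem l1Dist_eq_sum_range (g h : Fin N → ℝ) :
    l1Dist g h = ∑ i ∈ range N, |extendZero g i - extendZero h i| := by
  rw [l1Dist, sum_range]
  exact sum_congr rfl fun i _ => by rw [extendZero_val, extendZero_val]

theorem l1Dist_hypothesis (l : List (ℕ × ℝ)) (f : Fin N → ℝ) :
    l1Dist (RealRAM.hypothesis N l) f = ∑ i ∈ range N, |histVal l i - extendZero f i| := by
  rw [l1Dist, sum_range]
  exact sum_congr rfl fun i _ => by rw [extendZero_val]; rfl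

/-- Some histogram with few pieces is nearly as close to `f` as the best mixture. -/
theorem exists_histogram_near_optDist (hN : 1 ≤ N) (hk : 1 ≤ k) (hε : 0 < ε) (hε1 : ε ≤ 1 / 2)
    (f : PMF (Fin N)) : ∃ g : ℕ → ℝ, (∀ i, 0 ≤ g i ∧ g i ≤ 1) ∧
      ((jumpSet g N).card : ℝ) ≤ pieceBound N k ε ∧
      ∑ i ∈ range N, |g i - extendZero (massFn f) i| ≤
        optDist (mixtures k {p | IsMHR p}) f + ε / 200 := by
  -- No minimiser is needed. The slack `ε / 1000` and the histogram error `4 ε / 1000` add up to `ε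
  -- / 200`.
  obtain ⟨_, ⟨q, hq, rfl⟩, hlt⟩ := exists_lt_of_csInf_lt
    ((mixtures_nonempty hN hk).image fun q => l1Dist (massFn q) (massFn f))
    (show sInf _ < optDist (mixtures k {p | IsMHR p}) f + ε / 1000 from
      lt_add_of_pos_right _ (by positivity))
  obtain ⟨g, hg, -, hgj, hgq⟩ :=
    exists_histogram_near_mixture hN hq (η := ε / 1000) (by positivity) (by linarith)
  refine ⟨g, hg, hgj.trans (card_le_pieceBound hN hε hε1), ?_⟩
  simp only [l1Dist_eq_sum_range] at hlt
  have h1 : ∑ i ∈ range N, |g i - extendZero (massFn f) i| ≤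
      ∑ i ∈ range N, |g i - extendZero (massFn q) i| +
        ∑ i ∈ range N, |extendZero (massFn q) i - extendZero (massFn f) i| := by
    rw [← sum_add_distrib]
    exact sum_le_sum fun i _ => abs_sub_le _ _ _
  linarith

theorem logSize_le (hN : 1 ≤ N) (hε : 0 < ε) (hε1 : ε ≤ 1 / 2) :
    (logSize N ε : ℝ) ≤ 4 * Real.log (N / ε) := by
  have hN' : (1 : ℝ) ≤ N := by exact_mod_cast hN
  have h1 : (2 : ℝ) ≤ N / ε := by
    rw [le_div_iff₀ hε]; linarith
  have h2 := Real.log_le_log two_pos h1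
  have h3 := Real.log_two_gt_d9
  have h4 : 0 ≤ Real.logb 2 (N / ε) := Real.logb_nonneg one_lt_two (by linarith)
  have h5 := (Nat.ceil_lt_add_one h4).le
  have h6 : Real.logb 2 (N / ε) + 1 ≤ 4 * Real.log (N / ε) := by
    rw [Real.logb, div_add_one (by positivity), div_le_iff₀ (by positivity)]
    nlinarith
  exact h5.trans h6

theorem ceil_logb_le (hε : 0 < ε) (hε1 : ε ≤ 1 / 2) :
    (⌈Real.logb 2 (400 / ε)⌉₊ : ℝ) + 1 ≤ 24 * Real.log (1 / ε) := by
  have h1 : (2 : ℝ) ≤ 1 / ε := by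
    rw [le_div_iff₀ hε]; linarith
  have h2 := Real.log_le_log two_pos h1
  have h3 := Real.log_two_gt_d9
  have h4 : 0 ≤ Real.logb 2 (400 / ε) :=
    Real.logb_nonneg one_lt_two (by rw [le_div_iff₀ hε]; linarith)
  have h5 := (Nat.ceil_lt_add_one h4).le
  have h7 : Real.log (400 / ε) ≤ 10 * Real.log (1 / ε) := by
    have h8 : Real.log 400 ≤ 9 * Real.log 2 := by
      have := Real.log_le_log (show (0 : ℝ) < 400 by norm_num) (show (400 : ℝ) ≤ 2 ^ 9 by norm_num)
      rwa [Real.log_pow] at this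
    rw [show 400 / ε = 400 * (1 / ε) by ring, Real.log_mul (by norm_num) (by positivity)]
    linarith
  have h6 : Real.logb 2 (400 / ε) + 1 + 1 ≤ 24 * Real.log (1 / ε) := by
    rw [Real.logb, div_add_one (by positivity), div_add_one (by positivity),
      div_le_iff₀ (by positivity)]
    nlinarith
  linarith

theorem one_le_complexity (hN : 1 ≤ N) (hk : 1 ≤ k) (hε : 0 < ε) (hε1 : ε ≤ 1 / 2) :
    1 ≤ k * Real.log (N / ε) / ε ^ 3 ∧ Real.log (N / ε) ≤ k * Real.log (N / ε) / ε ^ 3 := by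
  have hN' : (1 : ℝ) ≤ N := by exact_mod_cast hN
  have hk' : (1 : ℝ) ≤ k := by exact_mod_cast hk
  have h1 : (2 : ℝ) ≤ N / ε := by
    rw [le_div_iff₀ hε]; linarith
  have h2 := Real.log_le_log two_pos h1
  have h3 := Real.log_two_gt_d9
  have h4 : ε ^ 3 ≤ (1 / 2) ^ 3 := pow_le_pow_left₀ hε.le hε1 3
  have h5 : Real.log (N / ε) ≤ k * Real.log (N / ε) :=
    le_mul_of_one_le_left (by linarith) hk'
  constructor
  · rw [le_div_iff₀ (by positivity)]
    linarith
  · rw [le_div_iff₀ (by positivity)]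
    nlinarith

theorem sampleSize_le (hN : 1 ≤ N) (hk : 1 ≤ k) (hε : 0 < ε) (hε1 : ε ≤ 1 / 2) :
    (sampleSize N k ε : ℝ) ≤ (3 * 10 ^ 15) * (k * Real.log (N / ε) / ε ^ 3) := by
  have ht := one_le_pieceBound hN hk hε hε1
  have h1 := (Nat.ceil_lt_add_one
    (show 0 ≤ 36000000000 * pieceBound N k ε / (ε * ε) by positivity)).le
  have h2 := (one_le_complexity hN hk hε hε1).1
  have h3 : 36000000000 * pieceBound N k ε / (ε * ε) ≤
      (36000000000 * 80000) * (k * Real.log (N / ε) / ε ^ 3) := by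
    have e1 : 36000000000 * pieceBound N k ε / (ε * ε) =
        36000000000 * 20000 * (k / ε ^ 3) * logSize N ε := by
      rw [pieceBound]; field_simp
    have e2 : (36000000000 * 80000) * (k * Real.log (N / ε) / ε ^ 3) =
        36000000000 * 20000 * (k / ε ^ 3) * (4 * Real.log (N / ε)) := by ring
    rw [e1, e2]
    exact mul_le_mul_of_nonneg_left (logSize_le hN hε hε1) (by positivity)
  exact h1.trans (by linarith)

theorem time_le (hN : 1 ≤ N) (hk : 1 ≤ k) (hε : 0 < ε) (hε1 : ε ≤ 1 / 2) {T : ℕ}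
    (hT : T ≤ (⌈Real.logb 2 (400 / ε)⌉₊ + 1) * (1000 * (sampleSize N k ε + logSize N ε + 1))) :
    (T : ℝ) ≤ 10 ^ 20 * (k * Real.log (N / ε) / ε ^ 3 * Real.log (1 / ε)) := by
  have h1 : (T : ℝ) ≤ (⌈Real.logb 2 (400 / ε)⌉₊ + 1) *
      (1000 * (sampleSize N k ε + logSize N ε + 1)) := by exact_mod_cast hT
  have h2 := ceil_logb_le hε hε1
  have h3 := sampleSize_le hN hk hε hε1
  have h4 := logSize_le hN hε hε1
  obtain ⟨h5, h6⟩ := one_le_complexity hN hk hε hε1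
  set Q := k * Real.log (N / ε) / ε ^ 3
  have h7 : (1000 * (sampleSize N k ε + logSize N ε + 1) : ℝ) ≤ 4 * 10 ^ 18 * Q := by linarith
  have h8 : 0 ≤ Real.log (1 / ε) :=
    Real.log_nonneg (by rw [le_div_iff₀ hε]; linarith)
  have h9 := mul_le_mul h2 h7 (by positivity) (by positivity)
  have h10 : 0 ≤ Q * Real.log (1 / ε) := by positivity
  linarith

end

end MHRLearning

/-! ### Assembly of the theorem. -/

theorem mainTheorem8 :
    ∃ (P : RealRAM.Cmd) (C A B : ℝ), 1 ≤ C ∧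
      ∀ (N k : ℕ) (ε : ℝ), 1 ≤ N → 1 ≤ k → 0 < ε → ε ≤ 1 / 2 →
        (∀ ω : ℕ → Fin N, ∃ (T : ℕ) (s : RealRAM.State),
          RealRAM.Exec ω P (RealRAM.initState N k ε) T s ∧
          (s.drawn : ℝ) ≤ A * (k * Real.log (N / ε) / ε ^ 3) ∧
          (T : ℝ) ≤ B * (k * Real.log (N / ε) / ε ^ 3 * Real.log (1 / ε))) ∧
        ∀ f : PMF (Fin N),
          9 / 10 ≤ MeasureTheory.Measure.infinitePi (fun _ : ℕ => f.toMeasure)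
            {ω | ∃ (T : ℕ) (s : RealRAM.State),
              RealRAM.Exec ω P (RealRAM.initState N k ε) T s ∧
              l1Dist (RealRAM.hypothesis N s.out) (massFn f) ≤
                C * optDist (mixtures k {p | IsMHR p}) f + ε} := by
  open MHRLearning in
  refine ⟨learner, 48, 3 * 10 ^ 15, 10 ^ 20, by norm_num, fun N k ε hN hk hε hε1 =>
    ⟨fun ω => ?_, fun f => ?_⟩⟩
  · obtain ⟨T, s, τ, hT, hle, hd, -⟩ := exec_learner (ω := ω) hN hk hε hε1
    exact ⟨T, s, hT, hd ▸ sampleSize_le hN hk hε hε1, time_le hN hk hε hε1 hle⟩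
  · have ht := one_le_pieceBound hN hk hε hε1
    have hn : 0 < sampleSize N k ε := Nat.ceil_pos.2 (by positivity)
    refine (nine_tenths_le_sampleLaw_uniform_deviation f (M := ⌈8 * pieceBound N k ε⌉₊)
      (Nat.ceil_pos.2 (by linarith)) (show 0 < ε / 200 by positivity) (by linarith)
      (ceil_mul_le_sampleSize hN hk hε hε1)).trans (MeasureTheory.measure_mono fun ω hω => ?_)
    obtain ⟨g, hg, hgj, hgf⟩ := exists_histogram_near_optDist hN hk hε hε1 f
    obtain ⟨T, s, τ, hT, -, -, hout, hτ, hacc, hrej⟩ := exec_learner (ω := ω) hN hk hε hε1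
    refine ⟨T, s, hT, ?_⟩
    rw [l1Dist_hypothesis, hout]
    -- With `δ = ε / 200`, `τ₀ t = ε / 100` and `Δ ≤ OPT + ε / 200`, the total is `48 OPT + (48 + 47
    -- + 46) ε / 200`, which leaves room below `48 OPT + ε`.
    have h := sum_abs_histVal_sub_le hn f hg ht hgj (Nat.le_ceil _) hτ (by positivity) hω hacc hrej
    rw [div_mul_cancel₀ _ (by positivity)] at h
    linarith
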